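/- Let $(H,\mathcal R)$ be a quasi-triangular Hopf algebra over a field $k$, i.e. $\mathcal R\in H\otimes H$ is invertible, $\Delta^{op}(x)\mathcal R=\mathcal R\Delta(x)$, $(\Delta\otimes\mathrm{id})\mathcal R=\mathcal R^{1,3}\mathcal R^{2,3}$, $(\mathrm{id}\otimes\Delta)\mathcal R=\mathcal R^{1,3}\mathcal R^{1,2}$. Let $H^\circ$ be the space of linear forms on $H$ vanishing on a two-sided ideal of finite codimension, let $m$ be its product $m(f\otimes g)(u)=f(u_{(1)})g(u_{(2)})$, and let $H\otimes H$ act on $H^\circ$ by $((x\otimes y)\vartriangleright f)(u)=f(S^{-1}(x)\,u\,y)$. * The braided dual $\tilde H=\tilde H_0$ is $H^\circ$ with the product $f\cdot g=m(F\vartriangleright(g\otimes f))$, $F=\mathcal R^{1,3}\mathcal R^{1,4}$, and unit $\epsilon$; equivalently, its canonical element satisfies $X^{0,12}=(\mathcal R^{1,2})^{-1}X^{0,2}\mathcal R^{1,2}X^{0,1}$. * The elliptic double $E_H^{(0)}$ is the vector space $\tilde H\otimes\tilde H$ in which $\tilde H\otimes 1$ and $1\otimes\tilde H$ are subalgebras,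 $(f\otimes1)(1\otimes g)=f\otimes g$ and $(1\otimes g)(f\otimes 1)=T\vartriangleright(f\otimes g)$, where $T=(\mathcal R^{3,2})^{-1}(\mathcal R^{3,1})^{-1}(\mathcal R^{4,2})^{-1}\mathcal R^{1,4}$. * Let $H^{[2]}$ be the algebra $H\otimes H$ whose coproduct $h\mapsto h_{(1)}\otimes h_{(2)}$ is opposite to $h\mapsto F^{-1}\Delta_{H^e}(h)F$, where $\Delta_{H^e}(x\otimes y)=(x_{(2)}\otimes y_{(1)})\otimes(x_{(1)}\otimes y_{(2)})$. In the semi-direct product $\tilde H\rtimes H^{[2]}$, the vector space $\tilde H\otimes(H\otimes H)$ with product $(f\otimes h)(f'\otimes h')=f\,(h_{(1)}\vartriangleright f')\otimes h_{(2)}h'$, put $D_H=\tilde H\rtimes(H\otimes1)$ (the Heisenberg double) and $D_H'=\tilde H\rtimes(I_H\otimes 1)$, where $I_H$ is the image of the factorization map $\phi:\tilde H\to H$, $\phi(f)=(\mathrm{id}\otimes f)(\mathcal R^{2,1}\mathcal R^{1,2})$. $H$ is called factorizable if $\phi$ is injective. Theorem. The antipode of $H$ is bijective; $\tilde H$, $E_H^{(0)}$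 and $\tilde H\rtimes H^{[2]}$ are associative unital algebras; $D_H$ and $D_H'\subseteq D_H$ are unital subalgebras of the last one. There is a unique algebra homomorphism $\Phi:E_H^{(0)}\to D_H$ with $\Phi(f\otimes1)=f\otimes(1\otimes 1)$ and $\Phi(1\otimes f)=1\otimes(\phi(f)\otimes1)$ for all $f\in\tilde H$. If $H$ is factorizable, then $\Phi$ is an isomorphism of algebras from $E_H^{(0)}$ onto $D_H'$. -/

import Mathlib

open scoped TensorProduct

section QuasiTriangular

variable {k H A : Type*} [Field k] [Ring H] [HopfAlgebra k H] [Ring A] [Algebra k A]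

/-- Given algebra maps `i, j : H → A` (typically inclusions of tensor legs), the linear map
`H ⊗ H → A`, `a ⊗ b ↦ i a * j b`. If `i`, `j` are the inclusions of the legs number `p`, `q` in a
tensor power of `H`, then the image of `R` is `R^{p,q}`. -/
noncomputable def onLegs (i j : H →ₐ[k] A) : H ⊗[k] H →ₗ[k] A :=
  TensorProduct.lift ((LinearMap.mul k A).compl₁₂ i.toLinearMap j.toLinearMap)

variable (k H)

/-- A universal R-matrix on the Hopf algebra `H`: an invertible element `R` of `H ⊗ H` with
`Δᵒᵖ(x) R = R Δ(x)`, `(Δ ⊗ id)(R) = R^{1,3} R^{2,3}`, `(id ⊗ Δ)(R) = R^{1,3} R^{1,2}`.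
A quasi-triangular Hopf algebra is a Hopf algebra with such an element. -/
structure UniversalRMatrix where
  R : (H ⊗[k] H)ˣ
  comul_op_mul : ∀ x : H,
    TensorProduct.comm k H H (Coalgebra.comul (R := k) x) * (R : H ⊗[k] H) =
      (R : H ⊗[k] H) * Coalgebra.comul (R := k) x
  comul_left :
    (Coalgebra.comul (R := k) (A := H)).rTensor H (R : H ⊗[k] H) =
      onLegs ((Algebra.TensorProduct.includeLeft (R := k) (S := k) (A := H ⊗[k] H) (B := H)).comp
          Algebra.TensorProduct.includeLeft) Algebra.TensorProduct.includeRight (R : H ⊗[k] H) *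
        onLegs ((Algebra.TensorProduct.includeLeft (R := k) (S := k) (A := H ⊗[k] H)
          (B := H)).comp Algebra.TensorProduct.includeRight)
          Algebra.TensorProduct.includeRight (R : H ⊗[k] H)
  comul_right :
    (Coalgebra.comul (R := k) (A := H)).lTensor H (R : H ⊗[k] H) =
      onLegs Algebra.TensorProduct.includeLeft
          ((Algebra.TensorProduct.includeRight (R := k) (A := H) (B := H ⊗[k] H)).comp
            Algebra.TensorProduct.includeRight) (R : H ⊗[k] H) *
        onLegs Algebra.TensorProduct.includeLeft
          ((Algebra.TensorProduct.includeRight (R := k) (A := H) (B := H ⊗[k] H)).comp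
            Algebra.TensorProduct.includeLeft) (R : H ⊗[k] H)

/-- The inverse `S⁻¹` of the antipode (`Ring.inverse` is taken in the algebra of linear
endomorphisms of `H`; the antipode of a quasi-triangular Hopf algebra is bijective). -/
noncomputable def antipodeInv : H →ₗ[k] H :=
  Ring.inverse (HopfAlgebra.antipode k : Module.End k H)

/-- The four legs `H → (H ⊗ H) ⊗ (H ⊗ H)`. -/
noncomputable def leg₁ : H →ₐ[k] (H ⊗[k] H) ⊗[k] (H ⊗[k] H) :=
  Algebra.TensorProduct.includeLeft.comp Algebra.TensorProduct.includeLeft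

/-- The second leg. -/
noncomputable def leg₂ : H →ₐ[k] (H ⊗[k] H) ⊗[k] (H ⊗[k] H) :=
  Algebra.TensorProduct.includeLeft.comp Algebra.TensorProduct.includeRight

/-- The third leg. -/
noncomputable def leg₃ : H →ₐ[k] (H ⊗[k] H) ⊗[k] (H ⊗[k] H) :=
  Algebra.TensorProduct.includeRight.comp Algebra.TensorProduct.includeLeft

/-- The fourth leg. -/
noncomputable def leg₄ : H →ₐ[k] (H ⊗[k] H) ⊗[k] (H ⊗[k] H) :=
  Algebra.TensorProduct.includeRight.comp Algebra.TensorProduct.includeRight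

/-- The coproduct of `H^e = H^coop ⊗ H`: `x ⊗ y ↦ (x₂ ⊗ y₁) ⊗ (x₁ ⊗ y₂)`. -/
noncomputable def comulEnv : H ⊗[k] H →ₗ[k] (H ⊗[k] H) ⊗[k] (H ⊗[k] H) :=
  (TensorProduct.tensorTensorTensorComm k H H H H).toLinearMap ∘ₗ
    TensorProduct.map ((TensorProduct.comm k H H).toLinearMap ∘ₗ Coalgebra.comul)
      Coalgebra.comul

/-- The restricted (finite) dual `H°`: the linear forms that vanish on a two-sided ideal of
finite codimension. -/
def restrictedDual : Submodule k (Module.Dual k H) where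
  carrier := {f | ∃ I : Ideal H, I.IsTwoSided ∧ Module.Finite k (H ⧸ I) ∧ ∀ x ∈ I, f x = 0}
  zero_mem' := ⟨⊤, inferInstance, inferInstance, fun _ _ => rfl⟩
  add_mem' := by
    rintro f g ⟨I, hI, fI, hf⟩ ⟨J, hJ, fJ, hg⟩
    refine ⟨I ⊓ J, ⟨fun b h => ⟨I.mul_mem_right b h.1, J.mul_mem_right b h.2⟩⟩, ?_, fun x hx => by simp [hf x hx.1, hg x hx.2]⟩
    let φ : H →ₗ[k] (H ⧸ I) × (H ⧸ J) :=
      ((I.mkQ).restrictScalars k).prod ((J.mkQ).restrictScalars k)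
    have hk : LinearMap.ker φ = (I ⊓ J).restrictScalars k := by
      ext x
      simp [φ]
    have e1 : Module.Finite k (H ⧸ LinearMap.ker φ) :=
      Module.Finite.equiv φ.quotKerEquivRange.symm
    rw [hk] at e1
    exact Module.Finite.equiv (Submodule.Quotient.restrictScalarsEquiv k (I ⊓ J))
  smul_mem' := by
    rintro c f ⟨I, hI, fI, hf⟩
    exact ⟨I, hI, fI, fun x hx => by simp [hf x hx]⟩

variable {k H}

theorem translate_mem_restrictedDual {f : Module.Dual k H} (hf : f ∈ restrictedDual k H)
    (a b : H) :
    f ∘ₗ LinearMap.mulLeft k a ∘ₗ LinearMap.mulRight k b ∈ restrictedDual k H := by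
  obtain ⟨I, hI, fI, h⟩ := hf
  refine ⟨I, hI, fI, fun x hx => ?_⟩
  exact h _ (I.mul_mem_left _ (I.mul_mem_right _ hx))

theorem convolution_mem_restrictedDual {f g : Module.Dual k H} (hf : f ∈ restrictedDual k H)
    (hg : g ∈ restrictedDual k H) :
    TensorProduct.dualDistrib k H H (f ⊗ₜ g) ∘ₗ Coalgebra.comul ∈ restrictedDual k H := by
  obtain ⟨I, hI, fI, hf⟩ := hf
  obtain ⟨J, hJ, fJ, hg⟩ := hg
  let ψ : H →ₐ[k] (H ⧸ I) ⊗[k] (H ⧸ J) :=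
    (Algebra.TensorProduct.map (Ideal.Quotient.mkₐ k I) (Ideal.Quotient.mkₐ k J)).comp
      (Bialgebra.comulAlgHom k H)
  refine ⟨RingHom.ker ψ, inferInstance, ?_, fun x hx => ?_⟩
  · have e1 : Module.Finite k (H ⧸ (RingHom.ker ψ).restrictScalars k) :=
      Module.Finite.equiv ψ.toLinearMap.quotKerEquivRange.symm
    exact Module.Finite.equiv (Submodule.Quotient.restrictScalarsEquiv k (RingHom.ker ψ))
  · let f' : (H ⧸ I) →ₗ[k] k := Submodule.liftQ (I.restrictScalars k) f hf
    let g' : (H ⧸ J) →ₗ[k] k := Submodule.liftQ (J.restrictScalars k) g hg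
    have key : TensorProduct.dualDistrib k H H (f ⊗ₜ g) =
        TensorProduct.dualDistrib k (H ⧸ I) (H ⧸ J) (f' ⊗ₜ g') ∘ₗ
          (Algebra.TensorProduct.map (Ideal.Quotient.mkₐ k I)
            (Ideal.Quotient.mkₐ k J)).toLinearMap := by
      ext a b
      rfl
    have hx' : ψ x = 0 := hx
    rw [key]
    change TensorProduct.dualDistrib k (H ⧸ I) (H ⧸ J) (f' ⊗ₜ g') (ψ x) = 0
    rw [hx', map_zero]

theorem counit_mem_restrictedDual :
    (Coalgebra.counit : H →ₗ[k] k) ∈ restrictedDual k H := by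
  refine ⟨RingHom.ker (Bialgebra.counitAlgHom k H), inferInstance, ?_, fun x hx => hx⟩
  have e1 : Module.Finite k (H ⧸ (RingHom.ker (Bialgebra.counitAlgHom k H)).restrictScalars k) :=
    Module.Finite.equiv (Bialgebra.counitAlgHom k H).toLinearMap.quotKerEquivRange.symm
  exact Module.Finite.equiv (Submodule.Quotient.restrictScalarsEquiv k
    (RingHom.ker (Bialgebra.counitAlgHom k H)))

variable (k H)

/-- The product of the Hopf algebra `H°`: `(f g)(u) = f(u₁) g(u₂)`. -/
noncomputable def dualMul :
    restrictedDual k H →ₗ[k] restrictedDual k H →ₗ[k] restrictedDual k H :=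
  LinearMap.mk₂ k
    (fun f g => ⟨TensorProduct.dualDistrib k H H (f.1 ⊗ₜ g.1) ∘ₗ Coalgebra.comul,
      convolution_mem_restrictedDual f.2 g.2⟩)
    (fun f f' g => by ext; simp [TensorProduct.add_tmul])
    (fun c f g => by ext; simp [← TensorProduct.smul_tmul'])
    (fun f g g' => by ext; simp [TensorProduct.tmul_add])
    (fun c f g => by ext; simp)

/-- The left action of `H ⊗ H` on `H°`: `((x ⊗ y) ▷ f)(u) = f(S⁻¹(x) u y)`. -/
noncomputable def dualAct : H ⊗[k] H →ₗ[k] restrictedDual k H →ₗ[k] restrictedDual k H :=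
  TensorProduct.lift <| LinearMap.mk₂ k
    (fun x y =>
      { toFun := fun f => ⟨f.1 ∘ₗ LinearMap.mulLeft k (antipodeInv k H x) ∘ₗ
          LinearMap.mulRight k y, translate_mem_restrictedDual f.2 _ _⟩
        map_add' := fun f g => by ext; simp
        map_smul' := fun c f => by ext; simp })
    (fun x x' y => by ext; simp [add_mul])
    (fun c x y => by ext; simp)
    (fun x y y' => by ext; simp [mul_add])
    (fun c x y => by ext; simp)

variable {k H}

namespace UniversalRMatrix

variable (𝓡 : UniversalRMatrix k H)

/-- The twist `F = R^{1,3} R^{1,4}` of `H^e`. -/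
noncomputable def twist : (H ⊗[k] H) ⊗[k] (H ⊗[k] H) :=
  onLegs (leg₁ k H) (leg₃ k H) 𝓡.R.val * onLegs (leg₁ k H) (leg₄ k H) 𝓡.R.val

/-- `F⁻¹ = (R^{1,4})⁻¹ (R^{1,3})⁻¹`. -/
noncomputable def twistInv : (H ⊗[k] H) ⊗[k] (H ⊗[k] H) :=
  onLegs (leg₁ k H) (leg₄ k H) 𝓡.R.inv * onLegs (leg₁ k H) (leg₃ k H) 𝓡.R.inv

/-- The coproduct `h ↦ F⁻¹ Δ(h) F` of the twisted Hopf algebra `(H^e)^F`. -/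
noncomputable def comulTwisted : H ⊗[k] H →ₗ[k] (H ⊗[k] H) ⊗[k] (H ⊗[k] H) :=
  LinearMap.mulLeft k 𝓡.twistInv ∘ₗ LinearMap.mulRight k 𝓡.twist ∘ₗ comulEnv k H

/-- The coproduct of the Hopf algebra which acts on the braided dual: the co-opposite of
`comulTwisted`. -/
noncomputable def comulBraided : H ⊗[k] H →ₗ[k] (H ⊗[k] H) ⊗[k] (H ⊗[k] H) :=
  (TensorProduct.comm k (H ⊗[k] H) (H ⊗[k] H)).toLinearMap ∘ₗ 𝓡.comulTwisted

/-- The product of the braided dual `H̃ = H̃₀`, on the vector space `H°`: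
`f · g = m (F ▷ (g ⊗ f))` where `m` is the product of `H°`.
Equivalently, the canonical element `X` satisfies
`X^{0,12} = (R^{1,2})⁻¹ X^{0,2} R^{1,2} X^{0,1}`. -/
noncomputable def braidedMul :
    restrictedDual k H →ₗ[k] restrictedDual k H →ₗ[k] restrictedDual k H :=
  (TensorProduct.mk k (restrictedDual k H) (restrictedDual k H)).flip.compr₂
    (TensorProduct.lift (dualMul k H) ∘ₗ TensorProduct.map₂ (dualAct k H) (dualAct k H) 𝓡.twist)

/-- The braided dual `H̃ = H̃₀`: the vector space `H°` with the product `braidedMul`, and with the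
counit of `H` as unit. -/
def BraidedDual (_ : UniversalRMatrix k H) : Type _ := restrictedDual k H

noncomputable instance : AddCommGroup 𝓡.BraidedDual :=
  inferInstanceAs (AddCommGroup (restrictedDual k H))

noncomputable instance : Module k 𝓡.BraidedDual :=
  inferInstanceAs (Module k (restrictedDual k H))

noncomputable instance : Mul 𝓡.BraidedDual := ⟨fun f g => 𝓡.braidedMul f g⟩

noncomputable instance : One 𝓡.BraidedDual := ⟨⟨Coalgebra.counit, counit_mem_restrictedDual⟩⟩

/-- The product of the braided dual as a bilinear map. -/
noncomputable def mulB : 𝓡.BraidedDual →ₗ[k] 𝓡.BraidedDual →ₗ[k] 𝓡.BraidedDual := 𝓡.braidedMul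

/-- The action of `H ⊗ H` on the braided dual (it is `dualAct`). -/
noncomputable def actB : H ⊗[k] H →ₗ[k] 𝓡.BraidedDual →ₗ[k] 𝓡.BraidedDual := dualAct k H

/-- `T = (R^{3,2})⁻¹ (R^{3,1})⁻¹ (R^{4,2})⁻¹ R^{1,4}`. -/
noncomputable def crossing : (H ⊗[k] H) ⊗[k] (H ⊗[k] H) :=
  onLegs (leg₃ k H) (leg₂ k H) 𝓡.R.inv * onLegs (leg₃ k H) (leg₁ k H) 𝓡.R.inv *
    onLegs (leg₄ k H) (leg₂ k H) 𝓡.R.inv * onLegs (leg₁ k H) (leg₄ k H) 𝓡.R.val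

/-- The product of the elliptic double,
`(f ⊗ g)(f' ⊗ g') = (f ⊗ 1) (T ▷ (f' ⊗ g)) (1 ⊗ g')`, i.e. `H̃ ⊗ 1` and `1 ⊗ H̃` are subalgebras,
`(f ⊗ 1)(1 ⊗ g) = f ⊗ g` and `(1 ⊗ g)(f ⊗ 1) = T ▷ (f ⊗ g)`. -/
noncomputable def ellipticMul :
    𝓡.BraidedDual ⊗[k] 𝓡.BraidedDual →ₗ[k]
      𝓡.BraidedDual ⊗[k] 𝓡.BraidedDual →ₗ[k] 𝓡.BraidedDual ⊗[k] 𝓡.BraidedDual :=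
  TensorProduct.lift <| LinearMap.mk₂ k
    (fun f g => TensorProduct.lift <| LinearMap.mk₂ k
      (fun f' g' => TensorProduct.map (𝓡.mulB f) (𝓡.mulB.flip g')
        (TensorProduct.map₂ 𝓡.actB 𝓡.actB 𝓡.crossing (f' ⊗ₜ g)))
      (fun _ _ _ => by simp only [TensorProduct.add_tmul, map_add])
      (fun _ _ _ => by simp only [← TensorProduct.smul_tmul', map_smul])
      (fun _ _ _ => by simp only [map_add, TensorProduct.map_add_right, LinearMap.add_apply])
      (fun _ _ _ => by simp only [map_smul, TensorProduct.map_smul_right, LinearMap.smul_apply]))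
    (fun _ _ _ => by
      apply TensorProduct.ext'
      intro _ _
      simp [TensorProduct.map_add_left])
    (fun _ _ _ => by
      apply TensorProduct.ext'
      intro _ _
      simp [TensorProduct.map_smul_left])
    (fun _ _ _ => by
      apply TensorProduct.ext'
      intro _ _
      simp [TensorProduct.tmul_add])
    (fun _ _ _ => by
      apply TensorProduct.ext'
      intro _ _
      simp)

/-- The elliptic double `E_H = E_H^{(0)}`: the vector space `H̃ ⊗ H̃`, with the product
`ellipticMul`. -/
def EllipticDouble : Type _ := 𝓡.BraidedDual ⊗[k] 𝓡.BraidedDual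

noncomputable instance : AddCommGroup 𝓡.EllipticDouble :=
  inferInstanceAs (AddCommGroup (𝓡.BraidedDual ⊗[k] 𝓡.BraidedDual))

noncomputable instance : Module k 𝓡.EllipticDouble :=
  inferInstanceAs (Module k (𝓡.BraidedDual ⊗[k] 𝓡.BraidedDual))

/-- The element `f ⊗ g` of the elliptic double. -/
noncomputable def ellipticMk : 𝓡.BraidedDual →ₗ[k] 𝓡.BraidedDual →ₗ[k] 𝓡.EllipticDouble :=
  TensorProduct.mk k 𝓡.BraidedDual 𝓡.BraidedDual

noncomputable instance : Mul 𝓡.EllipticDouble := ⟨fun x y => 𝓡.ellipticMul x y⟩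

noncomputable instance : One 𝓡.EllipticDouble := ⟨𝓡.ellipticMk 1 1⟩

/-- The product of the semi-direct product, `(f ⊗ h)(f' ⊗ h') = f (h₁ ▷ f') ⊗ h₂ h'`. -/
noncomputable def semidirectMul :
    𝓡.BraidedDual ⊗[k] (H ⊗[k] H) →ₗ[k]
      𝓡.BraidedDual ⊗[k] (H ⊗[k] H) →ₗ[k] 𝓡.BraidedDual ⊗[k] (H ⊗[k] H) :=
  TensorProduct.lift <| LinearMap.mk₂ k
    (fun f h => TensorProduct.lift <| LinearMap.mk₂ k
      (fun f' h' => TensorProduct.map (𝓡.mulB f ∘ₗ 𝓡.actB.flip f')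
        ((LinearMap.mul k (H ⊗[k] H)).flip h') (𝓡.comulBraided h))
      (fun _ _ _ => by simp only [map_add, LinearMap.comp_add, TensorProduct.map_add_left,
        LinearMap.add_apply])
      (fun _ _ _ => by simp only [map_smul, LinearMap.comp_smul, TensorProduct.map_smul_left,
        LinearMap.smul_apply])
      (fun _ _ _ => by simp only [map_add, TensorProduct.map_add_right, LinearMap.add_apply])
      (fun _ _ _ => by simp only [map_smul, TensorProduct.map_smul_right, LinearMap.smul_apply]))
    (fun _ _ _ => by
      apply TensorProduct.ext'
      intro _ _
      simp [LinearMap.add_comp, TensorProduct.map_add_left])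
    (fun _ _ _ => by
      apply TensorProduct.ext'
      intro _ _
      simp [LinearMap.smul_comp, TensorProduct.map_smul_left])
    (fun _ _ _ => by
      apply TensorProduct.ext'
      intro _ _
      simp)
    (fun _ _ _ => by
      apply TensorProduct.ext'
      intro _ _
      simp)

/-- The semi-direct product of the braided dual and the Hopf algebra `H ⊗ H` (with coproduct
`comulBraided`) that acts on it: the vector space `H̃ ⊗ (H ⊗ H)`, with the product
`semidirectMul`. -/
def SemidirectProduct : Type _ := 𝓡.BraidedDual ⊗[k] (H ⊗[k] H)

noncomputable instance : AddCommGroup 𝓡.SemidirectProduct :=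
  inferInstanceAs (AddCommGroup (𝓡.BraidedDual ⊗[k] (H ⊗[k] H)))

noncomputable instance : Module k 𝓡.SemidirectProduct :=
  inferInstanceAs (Module k (𝓡.BraidedDual ⊗[k] (H ⊗[k] H)))

/-- The element `f ⊗ h` of the semi-direct product. -/
noncomputable def semidirectMk : 𝓡.BraidedDual →ₗ[k] H ⊗[k] H →ₗ[k] 𝓡.SemidirectProduct :=
  TensorProduct.mk k 𝓡.BraidedDual (H ⊗[k] H)

noncomputable instance : Mul 𝓡.SemidirectProduct := ⟨fun x y => 𝓡.semidirectMul x y⟩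

noncomputable instance : One 𝓡.SemidirectProduct := ⟨𝓡.semidirectMk 1 1⟩

/-- For a subspace `V` of `H`, the subspace `H̃ ⊗ (V ⊗ 1)` of the semi-direct product. -/
noncomputable def semidirectWith (V : Submodule k H) : Submodule k 𝓡.SemidirectProduct :=
  Submodule.span k {z | ∃ f : 𝓡.BraidedDual, ∃ v ∈ V, z = 𝓡.semidirectMk f (v ⊗ₜ 1)}

/-- The Heisenberg double `D_H = H̃ ⋊ (H ⊗ 1)`. -/
noncomputable def heisenbergDouble : Submodule k 𝓡.SemidirectProduct := 𝓡.semidirectWith ⊤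

/-- The double braiding `R^{2,1} R^{1,2}`. -/
noncomputable def doubleBraiding : H ⊗[k] H :=
  TensorProduct.comm k H H 𝓡.R.val * 𝓡.R.val

/-- The linear form on `H` underlying an element of the braided dual. -/
def toDual : 𝓡.BraidedDual →ₗ[k] Module.Dual k H := (restrictedDual k H).subtype

/-- The factorization map `φ : H̃ → H`, `φ(f) = (id ⊗ f)(R^{2,1} R^{1,2})`. -/
noncomputable def factorizationMap : 𝓡.BraidedDual →ₗ[k] H where
  toFun f := TensorProduct.rid k H (LinearMap.lTensor H (𝓡.toDual f) 𝓡.doubleBraiding)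
  map_add' f g := by simp [LinearMap.lTensor_add]
  map_smul' c f := by simp [LinearMap.lTensor_smul]

/-- `(H, R)` is factorizable if the factorization map is injective. -/
def IsFactorizable : Prop := Function.Injective 𝓡.factorizationMap

/-- The subspace `D_H' = H̃ ⋊ (I_H ⊗ 1)`, where `I_H` is the image of the factorization map. -/
noncomputable def heisenbergDouble' : Submodule k 𝓡.SemidirectProduct :=
  𝓡.semidirectWith (LinearMap.range 𝓡.factorizationMap)

end UniversalRMatrix

end QuasiTriangular

/-- The given product is associative and unital. -/
def IsAssociativeUnital (A : Type*) [Mul A] [One A] : Prop :=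
  (∀ a b c : A, a * b * c = a * (b * c)) ∧ ∀ a : A, 1 * a = a ∧ a * 1 = a

/-- The subspace `W` is a unital subalgebra. -/
def IsUnitalSubalgebra {k A : Type*} [Field k] [AddCommGroup A] [Module k A] [Mul A] [One A]
    (W : Submodule k A) : Prop :=
  (1 : A) ∈ W ∧ ∀ a ∈ W, ∀ b ∈ W, a * b ∈ W

/-!
All structure in sight is expressed through the universal R-matrix placed on pairs of tensor legs,
and every identity reduces to an identity between words in such elements. A *leg* is an algebra map
`H → A`; for commuting legs `i`, `j` there are the unit `R^{i,j}` of `A` (`legUnit`) and the leg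
`x ↦ i x₁ * j x₂` (`comulLegs`). The axioms of an R-matrix say that `R^{-,-}` is multiplicative in
coproducts of legs and that conjugation by `R^{i,j}` reverses the coproduct, and these give the
Yang–Baxter equation `yangBaxter`.

*The antipode.* `R⁻¹ = (S ⊗ id)(R)` and `R = (id ⊗ S)(R⁻¹)`, so that the Drinfeld element is
invertible and implements `S²` (`bijective_antipode`).

*The braided dual and the semi-direct product.* The twist `F` is a 2-cocycle (`twist_cocycle`), so
the twisted product of `H°` is associative. The coproduct of `H^[2]`, opposite to the twisted one,
is the conjugate by `R^{3,2}` of the opposite coproduct of `H ⊗ H`; this makes it coassociative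
(`comulBraided_coassoc`), and the braided dual is a module algebra for it (`actHom_mulB`).

*The elliptic double.* Both the elliptic double and the semi-direct product are twisted tensor
products of two algebras with respect to an exchange map, which are associative as soon as the
exchange map is compatible with both products (`twistedTensorProduct_assoc`). For the elliptic
double this compatibility is the pair of hexagon identities `crossing_comulBraided_left` and
`crossing_comulBraided_right` for the crossing `T`.

*The canonical homomorphism.* It is the linear map `f ⊗ g ↦ f ⊗ (φ(g) ⊗ 1)`. It is multiplicative
provided that `φ` is multiplicative (`factorizationMap_mulB`) and intertwines the two exchange maps
(`semidirectExchange_factorizationLeft`). For both facts, the action of `H ⊗ H` on functionals is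
moved to the double braiding `Q = R^{2,1} R^{1,2}` by transposition, where it becomes left
multiplication by `S⁻¹` of one leg and right multiplication by another. The identities to be shown
are then `unop_sandwich_twist` and `unop_mixedSandwich_crossing`; they follow from the Yang–Baxter
equation and the fact that `Q` commutes with coproducts. The range of the homomorphism is `D_H'`,
which is therefore a subalgebra, and over a field the map is injective when `φ` is.
-/

/-! ### R-matrices on tensor legs -/

section LegCalculus

variable {k H A A' : Type*} [Field k] [Ring H] [HopfAlgebra k H] [Ring A] [Algebra k A]
  [Ring A'] [Algebra k A']

/-- Two legs commute: every element of the image of `i` commutes with every element of the image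
of `j`. -/
abbrev LegsCommute {B C : Type*} [Ring B] [Algebra k B] [Ring C] [Algebra k C] (i : B →ₐ[k] A)
    (j : C →ₐ[k] A) : Prop := ∀ x y, Commute (i x) (j y)

section LegsCommute

variable {B C D : Type*} [Ring B] [Algebra k B] [Ring C] [Algebra k C] [Ring D] [Algebra k D]

theorem LegsCommute.symm {i : B →ₐ[k] A} {j : C →ₐ[k] A} (h : LegsCommute i j) :
    LegsCommute j i :=
  fun x y => (h y x).symm

theorem LegsCommute.map {i : B →ₐ[k] A} {j : C →ₐ[k] A} (h : LegsCommute i j)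
    (g : A →ₐ[k] A') : LegsCommute (g.comp i) (g.comp j) :=
  fun x y => (h x y).map g

theorem LegsCommute.comp_left {i : B →ₐ[k] A} {j : C →ₐ[k] A} (h : LegsCommute i j)
    (f : D →ₐ[k] B) : LegsCommute (i.comp f) j :=
  fun x y => h (f x) y

theorem LegsCommute.comp_right {i : B →ₐ[k] A} {j : C →ₐ[k] A} (h : LegsCommute i j)
    (f : D →ₐ[k] C) : LegsCommute i (j.comp f) :=
  fun x y => h x (f y)

theorem LegsCommute.lift_left {i : B →ₐ[k] A} {j : C →ₐ[k] A} {l : D →ₐ[k] A}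
    (h : LegsCommute i j) (hi : LegsCommute i l) (hj : LegsCommute j l) :
    LegsCommute (Algebra.TensorProduct.lift i j h) l := by
  intro X y
  induction X using TensorProduct.induction_on with
  | zero => simp
  | tmul a b => simpa using (hi a y).mul_left (hj b y)
  | add a b ha hb => simpa using ha.add_left hb

theorem LegsCommute.lift_right {i : B →ₐ[k] A} {j : C →ₐ[k] A} {l : D →ₐ[k] A}
    (h : LegsCommute i j) (hi : LegsCommute l i) (hj : LegsCommute l j) :
    LegsCommute l (Algebra.TensorProduct.lift i j h) :=
  (h.lift_left hi.symm hj.symm).symm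

theorem legsCommute_includeLeft_includeRight :
    LegsCommute (Algebra.TensorProduct.includeLeft : B →ₐ[k] B ⊗[k] C)
      (Algebra.TensorProduct.includeRight : C →ₐ[k] B ⊗[k] C) :=
  fun x y => by simp [Commute, SemiconjBy]

end LegsCommute

@[simp]
theorem onLegs_tmul (i j : H →ₐ[k] A) (x y : H) : onLegs i j (x ⊗ₜ[k] y) = i x * j y := rfl

theorem map_onLegs (g : A →ₐ[k] A') (i j : H →ₐ[k] A) (X : H ⊗[k] H) :
    g (onLegs i j X) = onLegs (g.comp i) (g.comp j) X := by
  induction X using TensorProduct.induction_on with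
  | zero => simp
  | tmul x y => simp
  | add x y hx hy => simp [hx, hy]

theorem onLegs_eq_lift {i j : H →ₐ[k] A} (h : LegsCommute i j) (X : H ⊗[k] H) :
    onLegs i j X = Algebra.TensorProduct.lift i j h X := by
  induction X using TensorProduct.induction_on with
  | zero => simp
  | tmul x y => rfl
  | add x y hx hy => simp [hx, hy]

theorem onLegs_mul {i j : H →ₐ[k] A} (h : LegsCommute i j) (X Y : H ⊗[k] H) :
    onLegs i j (X * Y) = onLegs i j X * onLegs i j Y := by
  simp [onLegs_eq_lift h]

theorem onLegs_one {i j : H →ₐ[k] A} (h : LegsCommute i j) :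
    onLegs i j (1 : H ⊗[k] H) = 1 := by
  simp [onLegs_eq_lift h]

theorem onLegs_comm {i j : H →ₐ[k] A} (h : LegsCommute i j) (X : H ⊗[k] H) :
    onLegs i j (TensorProduct.comm k H H X) = onLegs j i X := by
  induction X using TensorProduct.induction_on with
  | zero => simp
  | tmul x y => simpa using (h y x).eq
  | add x y hx hy => simp [hx, hy]

theorem commute_onLegs {i j : H →ₐ[k] A} {a : A} (hi : ∀ x, Commute a (i x))
    (hj : ∀ x, Commute a (j x)) (X : H ⊗[k] H) : Commute a (onLegs i j X) := by
  induction X using TensorProduct.induction_on with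
  | zero => simp
  | tmul x y => simpa using (hi x).mul_right (hj y)
  | add x y hx hy => simpa using hx.add_right hy

variable (k H A) in
/-- The trivial leg `x ↦ ε(x) 1`. -/
noncomputable def trivialLeg : H →ₐ[k] A :=
  (Algebra.ofId k A).comp (Bialgebra.counitAlgHom k H)

open scoped Classical in
/-- The coproduct followed by the legs `i`, `j`: the algebra map `x ↦ i x₁ * j x₂`. The value is
the trivial leg if `i` and `j` do not commute. -/
noncomputable def comulLegs (i j : H →ₐ[k] A) : H →ₐ[k] A :=
  if h : LegsCommute i j then
    (Algebra.TensorProduct.lift i j h).comp (Bialgebra.comulAlgHom k H)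
  else trivialLeg k H A

theorem comulLegs_apply {i j : H →ₐ[k] A} (h : LegsCommute i j) (x : H) :
    comulLegs i j x = onLegs i j (Coalgebra.comul (R := k) x) := by
  rw [comulLegs, dif_pos h, onLegs_eq_lift h]
  rfl

theorem map_comulLegs (g : A →ₐ[k] A') {i j : H →ₐ[k] A} (h : LegsCommute i j) :
    g.comp (comulLegs i j) = comulLegs (g.comp i) (g.comp j) := by
  ext x
  rw [AlgHom.comp_apply, comulLegs_apply h, comulLegs_apply (h.map g), map_onLegs]

theorem LegsCommute.comulLegs_left {i j l : H →ₐ[k] A} (h : LegsCommute i j)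
    (hi : LegsCommute i l) (hj : LegsCommute j l) : LegsCommute (comulLegs i j) l := by
  intro x y
  rw [comulLegs_apply h]
  exact (commute_onLegs (fun z => (hi z y).symm) (fun z => (hj z y).symm) _).symm

theorem LegsCommute.comulLegs_right {i j l : H →ₐ[k] A} (h : LegsCommute i j)
    (hi : LegsCommute l i) (hj : LegsCommute l j) : LegsCommute l (comulLegs i j) :=
  (LegsCommute.comulLegs_left h hi.symm hj.symm).symm

theorem comulLegs_assoc {i j l : H →ₐ[k] A} (hij : LegsCommute i j) (hil : LegsCommute i l)
    (hjl : LegsCommute j l) :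
    comulLegs (comulLegs i j) l = comulLegs i (comulLegs j l) := by
  ext x
  let Ξ : H ⊗[k] (H ⊗[k] H) →ₗ[k] A :=
    TensorProduct.lift ((LinearMap.mul k A).compl₁₂ i.toLinearMap (onLegs j l))
  have h1 : ∀ X : H ⊗[k] H, onLegs (comulLegs i j) l X =
      Ξ (TensorProduct.assoc k H H H (Coalgebra.comul.rTensor H X)) := by
    intro X
    induction X using TensorProduct.induction_on with
    | zero => simp
    | add x y hx hy => simp [hx, hy]
    | tmul x y =>
      rw [LinearMap.rTensor_tmul, onLegs_tmul, comulLegs_apply hij]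
      induction Coalgebra.comul (R := k) x using TensorProduct.induction_on with
      | zero => simp
      | add x y hx hy => simp [hx, hy, add_mul, TensorProduct.add_tmul]
      | tmul x z => simp [Ξ, mul_assoc]
  have h2 : ∀ X : H ⊗[k] H, onLegs i (comulLegs j l) X =
      Ξ (Coalgebra.comul.lTensor H X) := by
    intro X
    induction X using TensorProduct.induction_on with
    | zero => simp
    | add x y hx hy => simp [hx, hy]
    | tmul x y => simp [Ξ, comulLegs_apply hjl]
  rw [comulLegs_apply (hij.comulLegs_left hil hjl),
    comulLegs_apply (hjl.comulLegs_right hij hil), h1, h2, Coalgebra.coassoc_apply]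

theorem trivialLeg_apply (x : H) :
    trivialLeg k H A x = algebraMap k A (Coalgebra.counit (R := k) x) := rfl

theorem legsCommute_trivialLeg_left (i : H →ₐ[k] A) : LegsCommute (trivialLeg k H A) i :=
  fun x y => by
    rw [trivialLeg_apply]
    exact Algebra.commute_algebraMap_left _ _

theorem legsCommute_trivialLeg_right (i : H →ₐ[k] A) : LegsCommute i (trivialLeg k H A) :=
  (legsCommute_trivialLeg_left i).symm

theorem comulLegs_trivialLeg_left (i : H →ₐ[k] A) :
    comulLegs (trivialLeg k H A) i = i := by
  ext x
  have h : ∀ X : H ⊗[k] H, onLegs (trivialLeg k H A) i X =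
      i (TensorProduct.lid k H (Coalgebra.counit.rTensor H X)) := by
    intro X
    induction X using TensorProduct.induction_on with
    | zero => simp
    | add x y hx hy => simp [hx, hy]
    | tmul x y => simp [trivialLeg_apply, Algebra.smul_def]
  rw [comulLegs_apply (legsCommute_trivialLeg_left i), h, Coalgebra.rTensor_counit_comul]
  simp

theorem comulLegs_trivialLeg_right (i : H →ₐ[k] A) :
    comulLegs i (trivialLeg k H A) = i := by
  ext x
  have h : ∀ X : H ⊗[k] H, onLegs i (trivialLeg k H A) X =
      i (TensorProduct.rid k H (Coalgebra.counit.lTensor H X)) := by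
    intro X
    induction X using TensorProduct.induction_on with
    | zero => simp
    | add x y hx hy => simp [hx, hy]
    | tmul x y => simp [trivialLeg_apply, Algebra.smul_def, Algebra.commutes]
  rw [comulLegs_apply (legsCommute_trivialLeg_right i), h, Coalgebra.lTensor_counit_comul]
  simp

/-- Conjugation `a ↦ u⁻¹ a u` by a unit. -/
noncomputable def conjBy (k : Type*) {A : Type*} [Field k] [Ring A] [Algebra k A] (u : Aˣ) :
    A →ₐ[k] A :=
  AlgHom.ofLinearMap (LinearMap.mulLeft k (↑u⁻¹ : A) ∘ₗ LinearMap.mulRight k (u : A))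
    (by simp) (fun x y => by simp [mul_assoc])

@[simp]
theorem conjBy_apply (u : Aˣ) (a : A) : conjBy k u a = ↑u⁻¹ * a * u := by
  simp [conjBy, mul_assoc]

theorem conjBy_comp_of_commute {u : Aˣ} {i : H →ₐ[k] A} (h : ∀ x, Commute (u : A) (i x)) :
    (conjBy k u).comp i = i := by
  ext x
  simp [mul_assoc, ← (h x).eq]

theorem conjBy_comp_conjBy (u v : Aˣ) : (conjBy k u).comp (conjBy k v) = conjBy k (v * u) := by
  ext x
  simp [mul_assoc]

theorem comp_conjBy (g : A →ₐ[k] A') (u : Aˣ) :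
    g.comp (conjBy k u) = (conjBy k (Units.map (g : A →* A') u)).comp g := by
  ext x
  simp [← map_inv]

namespace UniversalRMatrix

variable (𝓡 : UniversalRMatrix k H)

open scoped Classical in
/-- The image of the R-matrix under a pair of commuting legs, as a unit; the value is `1` if the
legs do not commute. -/
noncomputable def legUnit (i j : H →ₐ[k] A) : Aˣ :=
  if h : LegsCommute i j then Units.map (Algebra.TensorProduct.lift i j h : H ⊗[k] H →* A) 𝓡.R
  else 1

variable {𝓡}

theorem coe_legUnit {i j : H →ₐ[k] A} (h : LegsCommute i j) :
    (𝓡.legUnit i j : A) = onLegs i j 𝓡.R.val := by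
  rw [legUnit, dif_pos h, onLegs_eq_lift h]
  rfl

theorem coe_inv_legUnit {i j : H →ₐ[k] A} (h : LegsCommute i j) :
    (↑(𝓡.legUnit i j)⁻¹ : A) = onLegs i j 𝓡.R.inv := by
  rw [legUnit, dif_pos h, onLegs_eq_lift h]
  rfl

theorem map_legUnit (g : A →ₐ[k] A') {i j : H →ₐ[k] A} (h : LegsCommute i j) :
    𝓡.legUnit (g.comp i) (g.comp j) = Units.map (g : A →* A') (𝓡.legUnit i j) := by
  ext
  rw [coe_legUnit (h.map g), ← map_onLegs, ← coe_legUnit h]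
  rfl

theorem legUnit_conjBy (u : Aˣ) {i j : H →ₐ[k] A} (h : LegsCommute i j) :
    𝓡.legUnit ((conjBy k u).comp i) ((conjBy k u).comp j) = u⁻¹ * 𝓡.legUnit i j * u := by
  ext
  rw [map_legUnit _ h]
  simp

theorem commute_legUnit_apply {i j l : H →ₐ[k] A} (hij : LegsCommute i j) (hi : LegsCommute i l)
    (hj : LegsCommute j l) (x : H) : Commute (𝓡.legUnit i j : A) (l x) := by
  rw [coe_legUnit hij]
  exact (commute_onLegs (fun z => (hi z x).symm) (fun z => (hj z x).symm) _).symm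

theorem commute_legUnit {i j l m : H →ₐ[k] A} (hij : LegsCommute i j) (hlm : LegsCommute l m)
    (hil : LegsCommute i l) (him : LegsCommute i m) (hjl : LegsCommute j l)
    (hjm : LegsCommute j m) : Commute (𝓡.legUnit i j) (𝓡.legUnit l m) := by
  rw [Commute, SemiconjBy, Units.ext_iff, Units.val_mul, Units.val_mul, coe_legUnit hlm]
  exact commute_onLegs (commute_legUnit_apply hij hil hjl) (commute_legUnit_apply hij him hjm) _

theorem legUnit_comulLegs_left {i j l : H →ₐ[k] A} (hij : LegsCommute i j)
    (hil : LegsCommute i l) (hjl : LegsCommute j l) :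
    𝓡.legUnit (comulLegs i j) l = 𝓡.legUnit i l * 𝓡.legUnit j l := by
  let θ : (H ⊗[k] H) ⊗[k] H →ₐ[k] A :=
    Algebra.TensorProduct.lift (Algebra.TensorProduct.lift i j hij) l (fun X y => by
      rw [← onLegs_eq_lift hij]
      exact (commute_onLegs (fun z => (hil z y).symm) (fun z => (hjl z y).symm) _).symm)
  have h : ∀ X : H ⊗[k] H, onLegs (comulLegs i j) l X =
      θ ((Coalgebra.comul (R := k) (A := H)).rTensor H X) := by
    intro X
    induction X using TensorProduct.induction_on with
    | zero => simp
    | add x y hx hy => simp [hx, hy]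
    | tmul x y =>
      simp only [onLegs_tmul, comulLegs_apply hij, onLegs_eq_lift hij]
      rfl
  ext
  rw [coe_legUnit (hij.comulLegs_left hil hjl), h, 𝓡.comul_left, map_mul, map_onLegs, map_onLegs,
    Units.val_mul, coe_legUnit hil, coe_legUnit hjl]
  congr 2 <;> congr 1 <;> ext x <;> simp [θ]

theorem legUnit_comulLegs_right {i j l : H →ₐ[k] A} (hij : LegsCommute i j)
    (hli : LegsCommute l i) (hlj : LegsCommute l j) :
    𝓡.legUnit l (comulLegs i j) = 𝓡.legUnit l j * 𝓡.legUnit l i := by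
  let θ : H ⊗[k] (H ⊗[k] H) →ₐ[k] A :=
    Algebra.TensorProduct.lift l (Algebra.TensorProduct.lift i j hij) (fun y X => by
      rw [← onLegs_eq_lift hij]
      exact commute_onLegs (fun z => hli y z) (fun z => hlj y z) _)
  have h : ∀ X : H ⊗[k] H, onLegs l (comulLegs i j) X =
      θ ((Coalgebra.comul (R := k) (A := H)).lTensor H X) := by
    intro X
    induction X using TensorProduct.induction_on with
    | zero => simp
    | add x y hx hy => simp [hx, hy]
    | tmul x y =>
      simp only [onLegs_tmul, comulLegs_apply hij, onLegs_eq_lift hij]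
      rfl
  ext
  rw [coe_legUnit (hij.comulLegs_right hli hlj), h, 𝓡.comul_right, map_mul, map_onLegs,
    map_onLegs, Units.val_mul, coe_legUnit hli, coe_legUnit hlj]
  congr 2 <;> congr 1 <;> ext x <;> simp [θ]

theorem legUnit_mul_comulLegs {i j : H →ₐ[k] A} (h : LegsCommute i j) (x : H) :
    (𝓡.legUnit i j : A) * comulLegs i j x = comulLegs j i x * 𝓡.legUnit i j := by
  rw [comulLegs_apply h, comulLegs_apply h.symm, coe_legUnit h, ← onLegs_mul h, ← 𝓡.comul_op_mul,
    onLegs_mul h, onLegs_comm h]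

/-- Conjugation by the R-matrix turns the opposite coproduct into the coproduct. -/
theorem conjBy_legUnit_comp_comulLegs {i j : H →ₐ[k] A} (h : LegsCommute i j) :
    (conjBy k (𝓡.legUnit i j)).comp (comulLegs j i) = comulLegs i j := by
  ext x
  rw [AlgHom.comp_apply, conjBy_apply, mul_assoc, ← legUnit_mul_comulLegs h, ← mul_assoc,
    Units.inv_mul, one_mul]

/-- The quantum Yang–Baxter equation: conjugating `R^{j,l} R^{i,l}`, which is `(Δᵒᵖ ⊗ id)(R)`, by
`R^{i,j}` gives `(Δ ⊗ id)(R)`. -/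
theorem yangBaxter {i j l : H →ₐ[k] A} (hij : LegsCommute i j) (hil : LegsCommute i l)
    (hjl : LegsCommute j l) :
    𝓡.legUnit i j * 𝓡.legUnit i l * 𝓡.legUnit j l =
      𝓡.legUnit j l * 𝓡.legUnit i l * 𝓡.legUnit i j := by
  have h := legUnit_conjBy (𝓡 := 𝓡) (𝓡.legUnit i j) (hij.symm.comulLegs_left hjl hil)
  rw [conjBy_legUnit_comp_comulLegs hij, conjBy_comp_of_commute (commute_legUnit_apply hij hil hjl),
    legUnit_comulLegs_left hij hil hjl, legUnit_comulLegs_left hij.symm hjl hil] at h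
  rw [mul_assoc, h]
  group

/-- The double braiding commutes with the coproduct. -/
theorem commute_doubleBraiding_comulLegs {i j : H →ₐ[k] A} (h : LegsCommute i j) (x : H) :
    Commute ((𝓡.legUnit j i * 𝓡.legUnit i j : Aˣ) : A) (comulLegs i j x) := by
  rw [Commute, SemiconjBy, Units.val_mul, mul_assoc, legUnit_mul_comulLegs h, ← mul_assoc,
    legUnit_mul_comulLegs h.symm, mul_assoc]

/-- `(ε ⊗ id)(R) = 1`, because this unit is equal to its square. -/
theorem legUnit_trivialLeg_left (i : H →ₐ[k] A) : 𝓡.legUnit (trivialLeg k H A) i = 1 := by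
  have h := legUnit_comulLegs_left (𝓡 := 𝓡) (legsCommute_trivialLeg_left (trivialLeg k H A))
    (legsCommute_trivialLeg_left i) (legsCommute_trivialLeg_left i)
  rwa [comulLegs_trivialLeg_left, left_eq_mul] at h

theorem legUnit_trivialLeg_right (i : H →ₐ[k] A) : 𝓡.legUnit i (trivialLeg k H A) = 1 := by
  have h := legUnit_comulLegs_right (𝓡 := 𝓡) (legsCommute_trivialLeg_left (trivialLeg k H A))
    (legsCommute_trivialLeg_right i) (legsCommute_trivialLeg_right i)
  rwa [comulLegs_trivialLeg_left, left_eq_mul] at h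

end UniversalRMatrix

end LegCalculus

/-! ### Words in a Yang–Baxter family -/

section GroupWords

variable {G : Type*} [Group G] (r : Fin 6 → Fin 6 → G)

/-- The identity of words behind `UniversalRMatrix.twist_cocycle`, where `r p q` stands for the
R-matrix on the legs `p`, `q` of a six-fold tensor product: entries on disjoint legs commute and
the Yang–Baxter equation holds. -/
theorem twist_word
    (hc : ∀ p q s t, p ≠ q ∧ s ≠ t ∧ p ≠ s ∧ p ≠ t ∧ q ≠ s ∧ q ≠ t → Commute (r p q) (r s t))
    (hy : ∀ p q s, p ≠ q ∧ p ≠ s ∧ q ≠ s →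
      r p q * r p s * r q s = r q s * r p s * r p q) :
    r 0 2 * r 0 4 * (r 0 5 * r 0 3) * (r 2 4 * r 2 5) =
      r 2 4 * r 0 4 * (r 2 5 * r 0 5) * (r 0 2 * r 0 3) := by
  have h03 : Commute (r 0 3) (r 2 4 * r 2 5) :=
    (hc 0 3 2 4 (by decide)).mul_right (hc 0 3 2 5 (by decide))
  have h05 : Commute (r 0 5) (r 2 4) := hc 0 5 2 4 (by decide)
  calc r 0 2 * r 0 4 * (r 0 5 * r 0 3) * (r 2 4 * r 2 5)
      = r 0 2 * r 0 4 * r 0 5 * (r 0 3 * (r 2 4 * r 2 5)) := by group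
    _ = r 0 2 * r 0 4 * (r 0 5 * r 2 4) * r 2 5 * r 0 3 := by rw [h03.eq]; group
    _ = (r 0 2 * r 0 4 * r 2 4) * r 0 5 * r 2 5 * r 0 3 := by rw [h05.eq]; group
    _ = r 2 4 * r 0 4 * (r 0 2 * r 0 5 * r 2 5) * r 0 3 := by
      rw [hy 0 2 4 (by decide)]; group
    _ = _ := by rw [hy 0 2 5 (by decide)]; group

/-- The identity of words behind `UniversalRMatrix.crossing_comulBraided_left`. The conjugations by
`r 2 1` come from the coproduct of `H^[2]`; pulling this factor through the word uses the
Yang–Baxter equation twice and cancels it. -/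
theorem crossing_word_left
    (hc : ∀ p q s t, p ≠ q ∧ s ≠ t ∧ p ≠ s ∧ p ≠ t ∧ q ≠ s ∧ q ≠ t → Commute (r p q) (r s t))
    (hy : ∀ p q s, p ≠ q ∧ p ≠ s ∧ q ≠ s →
      r p q * r p s * r q s = r q s * r p s * r p q) :
    ((r 2 1)⁻¹ * (r 4 1 * r 4 3) * r 2 1)⁻¹ * ((r 2 1)⁻¹ * (r 4 0 * r 4 2) * r 2 1)⁻¹ *
        ((r 2 1)⁻¹ * (r 5 1 * r 5 3) * r 2 1)⁻¹ * ((r 2 1)⁻¹ * (r 2 5 * r 0 5) * r 2 1) =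
      (r 4 3)⁻¹ * (r 4 2)⁻¹ * (r 5 3)⁻¹ * r 2 5 *
        ((r 4 1)⁻¹ * (r 4 0)⁻¹ * (r 5 1)⁻¹ * r 0 5) := by
  have s1 : SemiconjBy (r 2 1) ((r 4 2)⁻¹ * (r 4 1)⁻¹) ((r 4 1)⁻¹ * (r 4 2)⁻¹) := by
    rw [← mul_inv_rev, ← mul_inv_rev, SemiconjBy.inv_right_iff, SemiconjBy, ← mul_assoc]
    exact (hy 4 2 1 (by decide)).symm
  have s2 : SemiconjBy (r 2 1) (r 2 5 * (r 5 1)⁻¹) ((r 5 1)⁻¹ * r 2 5) := by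
    have := hy 2 5 1 (by decide)
    rw [SemiconjBy, ← mul_assoc, mul_inv_eq_iff_eq_mul, mul_assoc, mul_assoc,
      ← mul_assoc (r 2 5), this]
    group
  have s := ((((hc 2 1 4 3 (by decide)).inv_right.semiconjBy.mul_right s1).mul_right
    ((hc 2 1 4 0 (by decide)).inv_right.semiconjBy.mul_right
      (hc 2 1 5 3 (by decide)).inv_right.semiconjBy)).mul_right s2).mul_right
    (hc 2 1 0 5 (by decide)).semiconjBy
  have c1 : Commute ((r 5 3)⁻¹ * r 2 5) ((r 4 1)⁻¹ * (r 4 0)⁻¹) := by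
    apply Commute.mul_left <;> apply Commute.mul_right
    · exact (hc 5 3 4 1 (by decide)).inv_inv
    · exact (hc 5 3 4 0 (by decide)).inv_inv
    · exact (hc 2 5 4 1 (by decide)).inv_right
    · exact (hc 2 5 4 0 (by decide)).inv_right
  calc _ = (r 2 1)⁻¹ * (((r 4 3)⁻¹ * ((r 4 1)⁻¹ * (r 4 2)⁻¹) * ((r 4 0)⁻¹ * (r 5 3)⁻¹) *
        ((r 5 1)⁻¹ * r 2 5) * r 0 5) * r 2 1) := by group
    _ = (r 4 3)⁻¹ * (r 4 2)⁻¹ * ((r 4 1)⁻¹ * (r 4 0)⁻¹ * ((r 5 3)⁻¹ * r 2 5)) * (r 5 1)⁻¹ *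
        r 0 5 := by rw [← s.eq]; group
    _ = _ := by rw [← c1.eq]; group

/-- The identity of words behind `UniversalRMatrix.crossing_comulBraided_right`; here the factor
`r 4 3` is pulled through the word. -/
theorem crossing_word_right
    (hc : ∀ p q s t, p ≠ q ∧ s ≠ t ∧ p ≠ s ∧ p ≠ t ∧ q ≠ s ∧ q ≠ t → Commute (r p q) (r s t))
    (hy : ∀ p q s, p ≠ q ∧ p ≠ s ∧ q ≠ s →
      r p q * r p s * r q s = r q s * r p s * r p q) :
    ((r 4 3)⁻¹ * (r 4 1 * r 2 1) * r 4 3)⁻¹ * ((r 4 3)⁻¹ * (r 4 0 * r 2 0) * r 4 3)⁻¹ *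
        ((r 4 3)⁻¹ * (r 5 1 * r 3 1) * r 4 3)⁻¹ * ((r 4 3)⁻¹ * (r 0 3 * r 0 5) * r 4 3) =
      (r 2 1)⁻¹ * (r 2 0)⁻¹ * (r 3 1)⁻¹ * r 0 3 *
        ((r 4 1)⁻¹ * (r 4 0)⁻¹ * (r 5 1)⁻¹ * r 0 5) := by
  have s1 : SemiconjBy (r 4 3) ((r 3 1)⁻¹ * (r 4 1)⁻¹) ((r 4 1)⁻¹ * (r 3 1)⁻¹) := by
    rw [← mul_inv_rev, ← mul_inv_rev, SemiconjBy.inv_right_iff, SemiconjBy, ← mul_assoc]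
    exact hy 4 3 1 (by decide)
  have s2 : SemiconjBy (r 4 3) (r 0 3 * (r 4 0)⁻¹) ((r 4 0)⁻¹ * r 0 3) := by
    have := hy 4 0 3 (by decide)
    rw [SemiconjBy, ← mul_assoc, mul_inv_eq_iff_eq_mul, mul_assoc, mul_assoc,
      ← mul_assoc (r 0 3), ← this]
    group
  have s := ((((hc 4 3 2 1 (by decide)).inv_right.semiconjBy.mul_right
      (hc 4 3 2 0 (by decide)).inv_right.semiconjBy).mul_right s1).mul_right s2).mul_right
    ((hc 4 3 5 1 (by decide)).inv_right.semiconjBy.mul_right (hc 4 3 0 5 (by decide)).semiconjBy)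
  have c1 : Commute (r 4 1)⁻¹ (r 2 0)⁻¹ := (hc 4 1 2 0 (by decide)).inv_inv
  have c2 : Commute (r 4 0)⁻¹ (r 3 1)⁻¹ := (hc 4 0 3 1 (by decide)).inv_inv
  have c3 : Commute (r 5 1)⁻¹ (r 0 3) := (hc 5 1 0 3 (by decide)).inv_left
  have c4 : Commute (r 0 3) (r 4 1)⁻¹ := (hc 0 3 4 1 (by decide)).inv_right
  calc _ = (r 4 3)⁻¹ * ((r 2 1)⁻¹ * ((r 4 1)⁻¹ * (r 2 0)⁻¹) * ((r 4 0)⁻¹ * (r 3 1)⁻¹) *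
        ((r 5 1)⁻¹ * r 0 3) * r 0 5 * r 4 3) := by group
    _ = (r 4 3)⁻¹ * (((r 2 1)⁻¹ * (r 2 0)⁻¹ * ((r 4 1)⁻¹ * (r 3 1)⁻¹) * ((r 4 0)⁻¹ * r 0 3) *
        ((r 5 1)⁻¹ * r 0 5)) * r 4 3) := by rw [c1.eq, c2.eq, c3.eq]; group
    _ = (r 2 1)⁻¹ * (r 2 0)⁻¹ * (r 3 1)⁻¹ * ((r 4 1)⁻¹ * r 0 3) * (r 4 0)⁻¹ * (r 5 1)⁻¹ *
        r 0 5 := by rw [← s.eq]; group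
    _ = _ := by rw [← c4.eq]; group

end GroupWords

/-! ### The twist, the crossing and the coproduct of `H^[2]` -/

section Legs

variable {k H A A' : Type*} [Field k] [Ring H] [HopfAlgebra k H] [Ring A] [Algebra k A]
  [Ring A'] [Algebra k A']

theorem legsCommute_leg {p q : Fin 4} (hpq : p ≠ q) :
    LegsCommute (![leg₁ k H, leg₂ k H, leg₃ k H, leg₄ k H] p)
      (![leg₁ k H, leg₂ k H, leg₃ k H, leg₄ k H] q) := by
  intro x y
  fin_cases p <;> fin_cases q <;>
    first
    | exact absurd rfl hpq
    | simp [leg₁, leg₂, leg₃, leg₄, Commute, SemiconjBy]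

variable (k H)

theorem legsCommute_leg₁₂ : LegsCommute (leg₁ k H) (leg₂ k H) :=
  legsCommute_leg (p := 0) (q := 1) (by decide)

theorem legsCommute_leg₁₃ : LegsCommute (leg₁ k H) (leg₃ k H) :=
  legsCommute_leg (p := 0) (q := 2) (by decide)

theorem legsCommute_leg₁₄ : LegsCommute (leg₁ k H) (leg₄ k H) :=
  legsCommute_leg (p := 0) (q := 3) (by decide)

theorem legsCommute_leg₂₃ : LegsCommute (leg₂ k H) (leg₃ k H) :=
  legsCommute_leg (p := 1) (q := 2) (by decide)

theorem legsCommute_leg₂₄ : LegsCommute (leg₂ k H) (leg₄ k H) :=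
  legsCommute_leg (p := 1) (q := 3) (by decide)

theorem legsCommute_leg₃₄ : LegsCommute (leg₃ k H) (leg₄ k H) :=
  legsCommute_leg (p := 2) (q := 3) (by decide)

/-- `comulEnv` as an algebra map. -/
noncomputable def comulEnvHom : H ⊗[k] H →ₐ[k] (H ⊗[k] H) ⊗[k] (H ⊗[k] H) :=
  Algebra.TensorProduct.lift (comulLegs (leg₃ k H) (leg₁ k H)) (comulLegs (leg₂ k H) (leg₄ k H))
    (LegsCommute.comulLegs_left (legsCommute_leg₁₃ k H).symm
      (LegsCommute.comulLegs_right (legsCommute_leg₂₄ k H) (legsCommute_leg₂₃ k H).symm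
        (legsCommute_leg₃₄ k H))
      (LegsCommute.comulLegs_right (legsCommute_leg₂₄ k H) (legsCommute_leg₁₂ k H)
        (legsCommute_leg₁₄ k H)))

variable {k H}

theorem comulEnvHom_apply (h : H ⊗[k] H) : comulEnvHom k H h = comulEnv k H h := by
  have key : ∀ X Y : H ⊗[k] H,
      onLegs (leg₃ k H) (leg₁ k H) X * onLegs (leg₂ k H) (leg₄ k H) Y =
        TensorProduct.tensorTensorTensorComm k H H H H (TensorProduct.comm k H H X ⊗ₜ Y) := by
    intro X Y
    induction X using TensorProduct.induction_on with
    | zero => simp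
    | add x y hx hy => simp [hx, hy, add_mul, TensorProduct.add_tmul]
    | tmul x y =>
      induction Y using TensorProduct.induction_on with
      | zero => simp
      | add x y hx hy => rw [map_add, mul_add, hx, hy, TensorProduct.tmul_add, map_add]
      | tmul z w => simp [leg₁, leg₂, leg₃, leg₄]
  induction h using TensorProduct.induction_on with
  | zero => simp
  | add x y hx hy => simp [hx, hy]
  | tmul x y =>
    rw [comulEnvHom, Algebra.TensorProduct.lift_tmul, comulLegs_apply (legsCommute_leg₁₃ k H).symm,
      comulLegs_apply (legsCommute_leg₂₄ k H), key]
    rfl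

theorem comp_comulEnvHom_comp_includeLeft
    (θ : (H ⊗[k] H) ⊗[k] (H ⊗[k] H) →ₐ[k] A) :
    (θ.comp (comulEnvHom k H)).comp Algebra.TensorProduct.includeLeft =
      comulLegs (θ.comp (leg₃ k H)) (θ.comp (leg₁ k H)) := by
  rw [AlgHom.comp_assoc, comulEnvHom, Algebra.TensorProduct.lift_comp_includeLeft,
    map_comulLegs _ (legsCommute_leg₁₃ k H).symm]

theorem comp_comulEnvHom_comp_includeRight
    (θ : (H ⊗[k] H) ⊗[k] (H ⊗[k] H) →ₐ[k] A) :
    (θ.comp (comulEnvHom k H)).comp Algebra.TensorProduct.includeRight =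
      comulLegs (θ.comp (leg₂ k H)) (θ.comp (leg₄ k H)) := by
  rw [AlgHom.comp_assoc, comulEnvHom, Algebra.TensorProduct.lift_comp_includeRight',
    map_comulLegs _ (legsCommute_leg₂₄ k H)]

namespace UniversalRMatrix

variable (𝓡 : UniversalRMatrix k H)

/-- The twist `F` as a unit. -/
noncomputable def twistUnit : ((H ⊗[k] H) ⊗[k] (H ⊗[k] H))ˣ :=
  𝓡.legUnit (leg₁ k H) (leg₃ k H) * 𝓡.legUnit (leg₁ k H) (leg₄ k H)

theorem coe_twistUnit : (𝓡.twistUnit : (H ⊗[k] H) ⊗[k] (H ⊗[k] H)) = 𝓡.twist := by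
  rw [twistUnit, Units.val_mul, coe_legUnit (legsCommute_leg₁₃ k H),
    coe_legUnit (legsCommute_leg₁₄ k H)]
  rfl

theorem coe_inv_twistUnit :
    (↑𝓡.twistUnit⁻¹ : (H ⊗[k] H) ⊗[k] (H ⊗[k] H)) = 𝓡.twistInv := by
  rw [twistUnit, mul_inv_rev, Units.val_mul, coe_inv_legUnit (legsCommute_leg₁₃ k H),
    coe_inv_legUnit (legsCommute_leg₁₄ k H)]
  rfl

theorem map_twist (θ : (H ⊗[k] H) ⊗[k] (H ⊗[k] H) →ₐ[k] A) :
    θ 𝓡.twist = ↑(𝓡.legUnit (θ.comp (leg₁ k H)) (θ.comp (leg₃ k H)) *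
      𝓡.legUnit (θ.comp (leg₁ k H)) (θ.comp (leg₄ k H))) := by
  rw [map_legUnit θ (legsCommute_leg₁₃ k H), map_legUnit θ (legsCommute_leg₁₄ k H), ← map_mul,
    ← coe_twistUnit]
  rfl

theorem map_crossing (θ : (H ⊗[k] H) ⊗[k] (H ⊗[k] H) →ₐ[k] A) :
    θ 𝓡.crossing = ↑((𝓡.legUnit (θ.comp (leg₃ k H)) (θ.comp (leg₂ k H)))⁻¹ *
      (𝓡.legUnit (θ.comp (leg₃ k H)) (θ.comp (leg₁ k H)))⁻¹ *
      (𝓡.legUnit (θ.comp (leg₄ k H)) (θ.comp (leg₂ k H)))⁻¹ *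
      𝓡.legUnit (θ.comp (leg₁ k H)) (θ.comp (leg₄ k H))) := by
  rw [crossing, map_mul, map_mul, map_mul, map_onLegs, map_onLegs, map_onLegs, map_onLegs,
    Units.val_mul, Units.val_mul, Units.val_mul,
    coe_inv_legUnit ((legsCommute_leg₂₃ k H).symm.map θ),
    coe_inv_legUnit ((legsCommute_leg₁₃ k H).symm.map θ),
    coe_inv_legUnit ((legsCommute_leg₂₄ k H).symm.map θ),
    coe_legUnit ((legsCommute_leg₁₄ k H).map θ)]

/-- `comulBraided` as an algebra map. Although it is defined as the opposite of a twist of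
`comulEnv`, it is conjugate by `R^{3,2}` to the opposite of the ordinary coproduct of `H ⊗ H`. -/
noncomputable def comulBraidedHom : H ⊗[k] H →ₐ[k] (H ⊗[k] H) ⊗[k] (H ⊗[k] H) :=
  (Algebra.TensorProduct.comm k (H ⊗[k] H) (H ⊗[k] H)).toAlgHom.comp
    ((conjBy k 𝓡.twistUnit).comp (comulEnvHom k H))

theorem comulBraidedHom_apply (h : H ⊗[k] H) : 𝓡.comulBraidedHom h = 𝓡.comulBraided h := by
  change TensorProduct.comm k _ _ (conjBy k 𝓡.twistUnit (comulEnvHom k H h)) =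
    TensorProduct.comm k _ _ (𝓡.twistInv * (comulEnv k H h * 𝓡.twist))
  rw [conjBy_apply, coe_inv_twistUnit, coe_twistUnit, comulEnvHom_apply, mul_assoc]

/-- On the first factor of `H ⊗ H`, the coproduct of `H^[2]` is the opposite coproduct conjugated by
`R^{3,2}`; `θ` allows the four legs to be placed in any algebra. -/
theorem comp_comulBraidedHom_comp_includeLeft
    (θ : (H ⊗[k] H) ⊗[k] (H ⊗[k] H) →ₐ[k] A) :
    (θ.comp 𝓡.comulBraidedHom).comp Algebra.TensorProduct.includeLeft =
      (conjBy k (𝓡.legUnit (θ.comp (leg₃ k H)) (θ.comp (leg₂ k H)))).comp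
        (comulLegs (θ.comp (leg₃ k H)) (θ.comp (leg₁ k H))) := by
  have h := comp_comulEnvHom_comp_includeLeft (AlgHom.id k ((H ⊗[k] H) ⊗[k] (H ⊗[k] H)))
  simp only [AlgHom.id_comp] at h
  simp only [comulBraidedHom, AlgHom.comp_assoc, h]
  rw [twistUnit, ← conjBy_comp_conjBy, AlgHom.comp_assoc,
    conjBy_legUnit_comp_comulLegs (legsCommute_leg₁₃ k H), ← AlgHom.comp_assoc, ← AlgHom.comp_assoc,
    comp_conjBy, ← map_legUnit _ (legsCommute_leg₁₄ k H), AlgHom.comp_assoc,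
    map_comulLegs _ (legsCommute_leg₁₃ k H)]
  rfl

theorem comp_comulBraidedHom_comp_includeRight
    (θ : (H ⊗[k] H) ⊗[k] (H ⊗[k] H) →ₐ[k] A) :
    (θ.comp 𝓡.comulBraidedHom).comp Algebra.TensorProduct.includeRight =
      (conjBy k (𝓡.legUnit (θ.comp (leg₃ k H)) (θ.comp (leg₂ k H)))).comp
        (comulLegs (θ.comp (leg₄ k H)) (θ.comp (leg₂ k H))) := by
  have h := comp_comulEnvHom_comp_includeRight (AlgHom.id k ((H ⊗[k] H) ⊗[k] (H ⊗[k] H)))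
  simp only [AlgHom.id_comp] at h
  simp only [comulBraidedHom, AlgHom.comp_assoc, h]
  rw [twistUnit, ← conjBy_comp_conjBy, AlgHom.comp_assoc,
    conjBy_comp_of_commute (commute_legUnit_apply (legsCommute_leg₁₃ k H)
      (LegsCommute.comulLegs_right (legsCommute_leg₂₄ k H) (legsCommute_leg₁₂ k H)
        (legsCommute_leg₁₄ k H))
      (LegsCommute.comulLegs_right (legsCommute_leg₂₄ k H) (legsCommute_leg₂₃ k H).symm
        (legsCommute_leg₃₄ k H))), ← AlgHom.comp_assoc, ← AlgHom.comp_assoc,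
    comp_conjBy, ← map_legUnit _ (legsCommute_leg₁₄ k H), AlgHom.comp_assoc,
    map_comulLegs _ (legsCommute_leg₂₄ k H)]
  rfl

end UniversalRMatrix

end Legs

/-! ### Cocycle, hexagon and coassociativity identities -/

section TripleLegs

variable {k H A : Type*} [Field k] [Ring H] [HopfAlgebra k H] [Ring A] [Algebra k A]

theorem lift_comp_leg₁ {P Q : H ⊗[k] H →ₐ[k] A} (h : LegsCommute P Q) :
    (Algebra.TensorProduct.lift P Q h).comp (leg₁ k H) =
      P.comp Algebra.TensorProduct.includeLeft := by
  ext x; simp [leg₁]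

theorem lift_comp_leg₂ {P Q : H ⊗[k] H →ₐ[k] A} (h : LegsCommute P Q) :
    (Algebra.TensorProduct.lift P Q h).comp (leg₂ k H) =
      P.comp Algebra.TensorProduct.includeRight := by
  ext x; simp [leg₂]

theorem lift_comp_leg₃ {P Q : H ⊗[k] H →ₐ[k] A} (h : LegsCommute P Q) :
    (Algebra.TensorProduct.lift P Q h).comp (leg₃ k H) =
      Q.comp Algebra.TensorProduct.includeLeft := by
  ext x; simp [leg₃]

theorem lift_comp_leg₄ {P Q : H ⊗[k] H →ₐ[k] A} (h : LegsCommute P Q) :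
    (Algebra.TensorProduct.lift P Q h).comp (leg₄ k H) =
      Q.comp Algebra.TensorProduct.includeRight := by
  ext x; simp [leg₄]

open Algebra.TensorProduct in
/-- The six legs of a triple of maps from `H ⊗ H`. -/
noncomputable def sixLegs (P₁ P₂ P₃ : H ⊗[k] H →ₐ[k] A) : Fin 6 → (H →ₐ[k] A) :=
  ![P₁.comp includeLeft, P₁.comp Algebra.TensorProduct.includeRight,
    P₂.comp includeLeft, P₂.comp Algebra.TensorProduct.includeRight,
    P₃.comp includeLeft, P₃.comp Algebra.TensorProduct.includeRight]

open Algebra.TensorProduct in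
theorem legsCommute_sixLegs {P₁ P₂ P₃ : H ⊗[k] H →ₐ[k] A} (h₁₂ : LegsCommute P₁ P₂)
    (h₁₃ : LegsCommute P₁ P₃) (h₂₃ : LegsCommute P₂ P₃) (p q : Fin 6) (hpq : p ≠ q) :
    LegsCommute (sixLegs P₁ P₂ P₃ p) (sixLegs P₁ P₂ P₃ q) := by
  intro x y
  have hl : ∀ (P : H ⊗[k] H →ₐ[k] A) (x y : H), Commute (P (x ⊗ₜ 1)) (P (1 ⊗ₜ y)) :=
    fun P => legsCommute_includeLeft_includeRight.map P
  fin_cases p <;> fin_cases q <;>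
    simp only [sixLegs, Fin.zero_eta, Fin.mk_one, Fin.reduceFinMk, Matrix.cons_val,
      AlgHom.comp_apply, includeLeft_apply, includeRight_apply] <;>
    with_reducible first
    | exact absurd rfl hpq
    | exact hl _ _ _
    | exact (hl _ _ _).symm
    | exact h₁₂ _ _
    | exact (h₁₂ _ _).symm
    | exact h₁₃ _ _
    | exact (h₁₃ _ _).symm
    | exact h₂₃ _ _
    | exact (h₂₃ _ _).symm

namespace UniversalRMatrix

variable (𝓡 : UniversalRMatrix k H)

theorem legFamily_commute {e : Fin 6 → (H →ₐ[k] A)}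
    (he : ∀ p q, p ≠ q → LegsCommute (e p) (e q)) (p q s t : Fin 6)
    (h : p ≠ q ∧ s ≠ t ∧ p ≠ s ∧ p ≠ t ∧ q ≠ s ∧ q ≠ t) :
    Commute (𝓡.legUnit (e p) (e q)) (𝓡.legUnit (e s) (e t)) :=
  commute_legUnit (he _ _ h.1) (he _ _ h.2.1) (he _ _ h.2.2.1) (he _ _ h.2.2.2.1)
    (he _ _ h.2.2.2.2.1) (he _ _ h.2.2.2.2.2)

theorem legFamily_yangBaxter {e : Fin 6 → (H →ₐ[k] A)}
    (he : ∀ p q, p ≠ q → LegsCommute (e p) (e q)) (p q s : Fin 6)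
    (h : p ≠ q ∧ p ≠ s ∧ q ≠ s) :
    𝓡.legUnit (e p) (e q) * 𝓡.legUnit (e p) (e s) * 𝓡.legUnit (e q) (e s) =
      𝓡.legUnit (e q) (e s) * 𝓡.legUnit (e p) (e s) * 𝓡.legUnit (e p) (e q) :=
  yangBaxter (he _ _ h.1) (he _ _ h.2.1) (he _ _ h.2.2)

variable {P₁ P₂ P₃ : H ⊗[k] H →ₐ[k] A} (h₁₂ : LegsCommute P₁ P₂)
    (h₁₃ : LegsCommute P₁ P₃) (h₂₃ : LegsCommute P₂ P₃)

open Algebra.TensorProduct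

/-- The 2-cocycle property of the twist `F` with respect to the coproduct of `H^e`. -/
theorem twist_cocycle :
    lift P₁ ((lift P₂ P₃ h₂₃).comp (comulEnvHom k H)) ((h₂₃.lift_right h₁₂ h₁₃).comp_right _)
        𝓡.twist * lift P₂ P₃ h₂₃ 𝓡.twist =
      lift ((lift P₁ P₂ h₁₂).comp (comulEnvHom k H)) P₃ ((h₁₂.lift_left h₁₃ h₂₃).comp_left _)
        𝓡.twist * lift P₁ P₂ h₁₂ 𝓡.twist := by
  have he := legsCommute_sixLegs h₁₂ h₁₃ h₂₃
  simp only [map_twist, lift_comp_leg₁, lift_comp_leg₂, lift_comp_leg₃, lift_comp_leg₄,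
    comp_comulEnvHom_comp_includeLeft, comp_comulEnvHom_comp_includeRight]
  generalize hs : sixLegs P₁ P₂ P₃ = e at he
  have e0 : P₁.comp includeLeft = e 0 := by rw [← hs]; rfl
  have e2 : P₂.comp includeLeft = e 2 := by rw [← hs]; rfl
  have e3 : P₂.comp includeRight = e 3 := by rw [← hs]; rfl
  have e4 : P₃.comp includeLeft = e 4 := by rw [← hs]; rfl
  have e5 : P₃.comp includeRight = e 5 := by rw [← hs]; rfl
  rw [e0, e2, e3, e4, e5,
    legUnit_comulLegs_right (he 4 2 (by decide)) (he 0 4 (by decide)) (he 0 2 (by decide)),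
    legUnit_comulLegs_right (he 3 5 (by decide)) (he 0 3 (by decide)) (he 0 5 (by decide)),
    legUnit_comulLegs_left (he 2 0 (by decide)) (he 2 4 (by decide)) (he 0 4 (by decide)),
    legUnit_comulLegs_left (he 2 0 (by decide)) (he 2 5 (by decide)) (he 0 5 (by decide)),
    ← Units.val_mul, ← Units.val_mul]
  exact congrArg Units.val (twist_word (fun p q => 𝓡.legUnit (e p) (e q))
    (𝓡.legFamily_commute he) (𝓡.legFamily_yangBaxter he))

/-- The hexagon identity for the coproduct of `H^[2]` on the first argument of the crossing `T`. It
makes the exchange map of the elliptic double compatible with products in the left factor. -/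
theorem crossing_comulBraided_left :
    lift ((lift P₁ P₂ h₁₂).comp 𝓡.comulBraidedHom) P₃ ((h₁₂.lift_left h₁₃ h₂₃).comp_left _)
        𝓡.crossing = lift P₂ P₃ h₂₃ 𝓡.crossing * lift P₁ P₃ h₁₃ 𝓡.crossing := by
  have he := legsCommute_sixLegs h₁₂ h₁₃ h₂₃
  simp only [map_crossing, lift_comp_leg₁, lift_comp_leg₂, lift_comp_leg₃, lift_comp_leg₄,
    comp_comulBraidedHom_comp_includeLeft, comp_comulBraidedHom_comp_includeRight]
  generalize hs : sixLegs P₁ P₂ P₃ = e at he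
  have e0 : P₁.comp includeLeft = e 0 := by rw [← hs]; rfl
  have e1 : P₁.comp includeRight = e 1 := by rw [← hs]; rfl
  have e2 : P₂.comp includeLeft = e 2 := by rw [← hs]; rfl
  have e3 : P₂.comp includeRight = e 3 := by rw [← hs]; rfl
  have e4 : P₃.comp includeLeft = e 4 := by rw [← hs]; rfl
  have e5 : P₃.comp includeRight = e 5 := by rw [← hs]; rfl
  rw [e0, e1, e2, e3, e4, e5]
  have h4 := conjBy_comp_of_commute (commute_legUnit_apply (𝓡 := 𝓡) (he 2 1 (by decide))
    (he 2 4 (by decide)) (he 1 4 (by decide)))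
  have h5 := conjBy_comp_of_commute (commute_legUnit_apply (𝓡 := 𝓡) (he 2 1 (by decide))
    (he 2 5 (by decide)) (he 1 5 (by decide)))
  have w := crossing_word_left (fun p q => 𝓡.legUnit (e p) (e q))
    (𝓡.legFamily_commute he) (𝓡.legFamily_yangBaxter he)
  rw [← Units.val_mul, ← w]
  rw [← legUnit_comulLegs_right (he 3 1 (by decide)) (he 4 3 (by decide)) (he 4 1 (by decide)),
    ← legUnit_comulLegs_right (he 3 1 (by decide)) (he 5 3 (by decide)) (he 5 1 (by decide)),
    ← legUnit_comulLegs_right (he 2 0 (by decide)) (he 4 2 (by decide)) (he 4 0 (by decide)),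
    ← legUnit_comulLegs_left (he 2 0 (by decide)) (he 2 5 (by decide)) (he 0 5 (by decide)),
    ← legUnit_conjBy _ ((he 3 1 (by decide)).comulLegs_right (he 4 3 (by decide))
      (he 4 1 (by decide))),
    ← legUnit_conjBy _ ((he 3 1 (by decide)).comulLegs_right (he 5 3 (by decide))
      (he 5 1 (by decide))),
    ← legUnit_conjBy _ ((he 2 0 (by decide)).comulLegs_right (he 4 2 (by decide))
      (he 4 0 (by decide))),
    ← legUnit_conjBy _ ((he 2 0 (by decide)).comulLegs_left (he 2 5 (by decide))
      (he 0 5 (by decide))), h4, h5]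

/-- The hexagon identity for the coproduct of `H^[2]` on the second argument of the crossing `T`. It
makes the exchange map of the elliptic double compatible with products in the right factor. -/
theorem crossing_comulBraided_right :
    lift P₁ ((lift P₂ P₃ h₂₃).comp 𝓡.comulBraidedHom) ((h₂₃.lift_right h₁₂ h₁₃).comp_right _)
        𝓡.crossing = lift P₁ P₂ h₁₂ 𝓡.crossing * lift P₁ P₃ h₁₃ 𝓡.crossing := by
  have he := legsCommute_sixLegs h₁₂ h₁₃ h₂₃
  simp only [map_crossing, lift_comp_leg₁, lift_comp_leg₂, lift_comp_leg₃, lift_comp_leg₄,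
    comp_comulBraidedHom_comp_includeLeft, comp_comulBraidedHom_comp_includeRight]
  generalize hs : sixLegs P₁ P₂ P₃ = e at he
  have e0 : P₁.comp includeLeft = e 0 := by rw [← hs]; rfl
  have e1 : P₁.comp includeRight = e 1 := by rw [← hs]; rfl
  have e2 : P₂.comp includeLeft = e 2 := by rw [← hs]; rfl
  have e3 : P₂.comp includeRight = e 3 := by rw [← hs]; rfl
  have e4 : P₃.comp includeLeft = e 4 := by rw [← hs]; rfl
  have e5 : P₃.comp includeRight = e 5 := by rw [← hs]; rfl
  rw [e0, e1, e2, e3, e4, e5]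
  have h0 := conjBy_comp_of_commute (commute_legUnit_apply (𝓡 := 𝓡) (he 4 3 (by decide))
    (he 4 0 (by decide)) (he 3 0 (by decide)))
  have h1 := conjBy_comp_of_commute (commute_legUnit_apply (𝓡 := 𝓡) (he 4 3 (by decide))
    (he 4 1 (by decide)) (he 3 1 (by decide)))
  have w := crossing_word_right (fun p q => 𝓡.legUnit (e p) (e q))
    (𝓡.legFamily_commute he) (𝓡.legFamily_yangBaxter he)
  rw [← Units.val_mul, ← w]
  rw [← legUnit_comulLegs_left (he 4 2 (by decide)) (he 4 1 (by decide)) (he 2 1 (by decide)),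
    ← legUnit_comulLegs_left (he 4 2 (by decide)) (he 4 0 (by decide)) (he 2 0 (by decide)),
    ← legUnit_comulLegs_left (he 5 3 (by decide)) (he 5 1 (by decide)) (he 3 1 (by decide)),
    ← legUnit_comulLegs_right (he 5 3 (by decide)) (he 0 5 (by decide)) (he 0 3 (by decide)),
    ← legUnit_conjBy _ ((he 4 2 (by decide)).comulLegs_left (he 4 1 (by decide))
      (he 2 1 (by decide))),
    ← legUnit_conjBy _ ((he 4 2 (by decide)).comulLegs_left (he 4 0 (by decide))
      (he 2 0 (by decide))),
    ← legUnit_conjBy _ ((he 5 3 (by decide)).comulLegs_left (he 5 1 (by decide))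
      (he 3 1 (by decide))),
    ← legUnit_conjBy _ ((he 5 3 (by decide)).comulLegs_right (he 0 5 (by decide))
      (he 0 3 (by decide))), h0, h1]

/-- The coproduct of `H^[2]` is coassociative. -/
theorem comulBraided_coassoc :
    (lift ((lift P₁ P₂ h₁₂).comp 𝓡.comulBraidedHom) P₃
        ((h₁₂.lift_left h₁₃ h₂₃).comp_left _)).comp 𝓡.comulBraidedHom =
      (lift P₁ ((lift P₂ P₃ h₂₃).comp 𝓡.comulBraidedHom)
        ((h₂₃.lift_right h₁₂ h₁₃).comp_right _)).comp 𝓡.comulBraidedHom := by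
  have he := legsCommute_sixLegs h₁₂ h₁₃ h₂₃
  generalize hs : sixLegs P₁ P₂ P₃ = e at he
  have e0 : P₁.comp includeLeft = e 0 := by rw [← hs]; rfl
  have e1 : P₁.comp includeRight = e 1 := by rw [← hs]; rfl
  have e2 : P₂.comp includeLeft = e 2 := by rw [← hs]; rfl
  have e3 : P₂.comp includeRight = e 3 := by rw [← hs]; rfl
  have e4 : P₃.comp includeLeft = e 4 := by rw [← hs]; rfl
  have e5 : P₃.comp includeRight = e 5 := by rw [← hs]; rfl
  -- on both sides, the iterated coproduct is conjugate to the ordinary one by `u * w = v * z`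
  let u := 𝓡.legUnit (e 2) (e 1)
  let v := 𝓡.legUnit (e 4) (e 3)
  let w := 𝓡.legUnit (e 4) ((conjBy k u).comp (comulLegs (e 3) (e 1)))
  let z := 𝓡.legUnit ((conjBy k v).comp (comulLegs (e 4) (e 2))) (e 1)
  have hu : ∀ p, p ≠ 2 → p ≠ 1 → (conjBy k u).comp (e p) = e p := fun p hp hq =>
    conjBy_comp_of_commute (commute_legUnit_apply (he 2 1 (by decide)) (he _ _ hp.symm)
      (he _ _ hq.symm))
  have hv : ∀ p, p ≠ 4 → p ≠ 3 → (conjBy k v).comp (e p) = e p := fun p hp hq =>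
    conjBy_comp_of_commute (commute_legUnit_apply (he 4 3 (by decide)) (he _ _ hp.symm)
      (he _ _ hq.symm))
  have hw : w = u⁻¹ * (𝓡.legUnit (e 4) (e 1) * 𝓡.legUnit (e 4) (e 3)) * u := by
    rw [← legUnit_comulLegs_right (he 3 1 (by decide)) (he 4 3 (by decide)) (he 4 1 (by decide)),
      ← legUnit_conjBy _ ((he 3 1 (by decide)).comulLegs_right (he 4 3 (by decide))
      (he 4 1 (by decide))), hu 4 (by decide) (by decide)]
  have hz : z = v⁻¹ * (𝓡.legUnit (e 4) (e 1) * 𝓡.legUnit (e 2) (e 1)) * v := by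
    rw [← legUnit_comulLegs_left (he 4 2 (by decide)) (he 4 1 (by decide)) (he 2 1 (by decide)),
      ← legUnit_conjBy _ ((he 4 2 (by decide)).comulLegs_left (he 4 1 (by decide))
      (he 2 1 (by decide))), hv 1 (by decide) (by decide)]
  have huw : u * w = v * z := by
    have hc : Commute v u := 𝓡.legFamily_commute he 4 3 2 1 (by decide)
    rw [hw, hz]
    change u * (u⁻¹ * (_ * v) * u) = v * (v⁻¹ * (_ * u) * v)
    calc _ = 𝓡.legUnit (e 4) (e 1) * (v * u) := by group
      _ = _ := by rw [hc.eq]; group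
  apply Algebra.TensorProduct.ext
  · simp only [comp_comulBraidedHom_comp_includeLeft, comp_comulBraidedHom_comp_includeRight,
      lift_comp_leg₁, lift_comp_leg₂, lift_comp_leg₃, lift_comp_leg₄, e0, e1, e2, e3, e4]
    change (conjBy k w).comp (comulLegs (e 4) ((conjBy k u).comp (comulLegs (e 2) (e 0)))) =
      (conjBy k z).comp (comulLegs ((conjBy k v).comp (comulLegs (e 4) (e 2))) (e 0))
    rw [← hu 4 (by decide) (by decide), ← map_comulLegs _ ((he 2 0 (by decide)).comulLegs_right
      (he 4 2 (by decide)) (he 4 0 (by decide))), hu 4 (by decide) (by decide),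
      ← hv 0 (by decide) (by decide), ← map_comulLegs _ ((he 4 2 (by decide)).comulLegs_left
      (he 4 0 (by decide)) (he 2 0 (by decide))), hv 0 (by decide) (by decide),
      ← AlgHom.comp_assoc, ← AlgHom.comp_assoc, conjBy_comp_conjBy, conjBy_comp_conjBy, huw,
      comulLegs_assoc (he 4 2 (by decide)) (he 4 0 (by decide)) (he 2 0 (by decide))]
  · have hr : ∀ f : H ⊗[k] H →ₐ[k] A, AlgHom.restrictScalars k f = f := fun _ => rfl
    simp only [hr, comp_comulBraidedHom_comp_includeLeft, comp_comulBraidedHom_comp_includeRight,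
      lift_comp_leg₁, lift_comp_leg₂, lift_comp_leg₃, lift_comp_leg₄, e1, e2, e3, e4, e5]
    change (conjBy k w).comp (comulLegs (e 5) ((conjBy k u).comp (comulLegs (e 3) (e 1)))) =
      (conjBy k z).comp (comulLegs ((conjBy k v).comp (comulLegs (e 5) (e 3))) (e 1))
    rw [← hu 5 (by decide) (by decide), ← map_comulLegs _ ((he 3 1 (by decide)).comulLegs_right
      (he 5 3 (by decide)) (he 5 1 (by decide))), hu 5 (by decide) (by decide),
      ← hv 1 (by decide) (by decide), ← map_comulLegs _ ((he 5 3 (by decide)).comulLegs_left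
      (he 5 1 (by decide)) (he 3 1 (by decide))), hv 1 (by decide) (by decide),
      ← AlgHom.comp_assoc, ← AlgHom.comp_assoc, conjBy_comp_conjBy, conjBy_comp_conjBy, huw,
      comulLegs_assoc (he 5 3 (by decide)) (he 5 1 (by decide)) (he 3 1 (by decide))]

end UniversalRMatrix

end TripleLegs

/-! ### Twisted tensor products of algebras -/

section TwistedTensorProduct

variable {k A C : Type*} [Field k] [AddCommGroup A] [Module k A] [AddCommGroup C] [Module k C]
  {mA : A →ₗ[k] A →ₗ[k] A} {mC : C →ₗ[k] C →ₗ[k] C} {τ : C →ₗ[k] A →ₗ[k] A ⊗[k] C}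
  {m : A ⊗[k] C →ₗ[k] A ⊗[k] C →ₗ[k] A ⊗[k] C} {oneA : A} {oneC : C}

/-- A twisted tensor product of two associative algebras, with product
`(a ⊗ c) (a' ⊗ c') = a τ(c ⊗ a') c'`, is associative if the exchange map `τ` is compatible with
both products. -/
theorem twistedTensorProduct_assoc
    (hA : ∀ a b c, mA (mA a b) c = mA a (mA b c)) (hC : ∀ a b c, mC (mC a b) c = mC a (mC b c))
    (hA1 : ∀ a, mA oneA a = a) (hC1 : ∀ c, mC c oneC = c)
    (hm : ∀ a c a' c', m (a ⊗ₜ c) (a' ⊗ₜ c') = TensorProduct.map (mA a) (mC.flip c') (τ c a'))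
    (hτA : ∀ c a a', τ c (mA a a') = m (τ c a) (a' ⊗ₜ oneC))
    (hτC : ∀ c c' a, τ (mC c c') a = m (oneA ⊗ₜ c) (τ c' a)) (x y z : A ⊗[k] C) :
    m (m x y) z = m x (m y z) := by
  -- `a (p ((1 ⊗ q) t)) b = a ((p ⊗ q) t) b`, and the mirror image `hr`
  have hl : ∀ a p q b t, TensorProduct.map (mA (mA a p)) (mC.flip b) (m (oneA ⊗ₜ q) t) =
      TensorProduct.map (mA a) (mC.flip b) (m (p ⊗ₜ q) t) := by
    intro a p q b t
    induction t using TensorProduct.induction_on with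
    | zero => simp
    | add t t' h h' => simp only [map_add, h, h']
    | tmul r s =>
      rw [hm, hm]
      induction τ q r using TensorProduct.induction_on with
      | zero => simp
      | add t t' h h' => simp only [map_add, h, h']
      | tmul u v => simp [hA, hA1]
  have hr : ∀ a s r b t, TensorProduct.map (mA a) (mC.flip (mC s b)) (m t (r ⊗ₜ oneC)) =
      TensorProduct.map (mA a) (mC.flip b) (m t (r ⊗ₜ s)) := by
    intro a s r b t
    induction t using TensorProduct.induction_on with
    | zero => simp
    | add t t' h h' => simp only [map_add, LinearMap.add_apply, h, h']
    | tmul p q =>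
      rw [hm, hm]
      induction τ q r using TensorProduct.induction_on with
      | zero => simp
      | add t t' h h' => simp only [map_add, h, h']
      | tmul u v => simp [hC, hC1]
  have h1 : ∀ a b' a'' b'' t, m (TensorProduct.map (mA a) (mC.flip b') t) (a'' ⊗ₜ b'') =
      TensorProduct.map (mA a) (mC.flip b'') (m t (τ b' a'')) := by
    intro a b' a'' b'' t
    induction t using TensorProduct.induction_on with
    | zero => simp
    | add t t' h h' => simp only [map_add, LinearMap.add_apply, h, h']
    | tmul p q => rw [TensorProduct.map_tmul, hm, LinearMap.flip_apply, hτC, hl]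
  have h2 : ∀ a b a' b'' t, m (a ⊗ₜ b) (TensorProduct.map (mA a') (mC.flip b'') t) =
      TensorProduct.map (mA a) (mC.flip b'') (m (τ b a') t) := by
    intro a b a' b'' t
    induction t using TensorProduct.induction_on with
    | zero => simp
    | add t t' h h' => simp only [map_add, h, h']
    | tmul r s => rw [TensorProduct.map_tmul, hm, LinearMap.flip_apply, hτA, hr]
  induction x using TensorProduct.induction_on with
  | zero => simp
  | add x x' h h' => simp only [map_add, LinearMap.add_apply, h, h']
  | tmul a b =>
    induction y using TensorProduct.induction_on with
    | zero => simp
    | add y y' h h' => simp only [map_add, LinearMap.add_apply, h, h']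
    | tmul a' b' =>
      induction z using TensorProduct.induction_on with
      | zero => simp
      | add z z' h h' => simp only [map_add, h, h']
      | tmul a'' b'' => rw [hm, hm, h1, h2]

theorem twistedTensorProduct_one_mul
    (hA1 : ∀ a, mA oneA a = a)
    (hm : ∀ a c a' c', m (a ⊗ₜ c) (a' ⊗ₜ c') = TensorProduct.map (mA a) (mC.flip c') (τ c a'))
    (hC1 : ∀ c, mC oneC c = c) (hτ : ∀ a, τ oneC a = a ⊗ₜ oneC) (x : A ⊗[k] C) :
    m (oneA ⊗ₜ oneC) x = x := by
  induction x using TensorProduct.induction_on with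
  | zero => simp
  | add x x' h h' => simp only [map_add, h, h']
  | tmul a b => simp [hm, hτ, hA1, hC1]

theorem twistedTensorProduct_mul_one
    (hA1 : ∀ a, mA a oneA = a)
    (hm : ∀ a c a' c', m (a ⊗ₜ c) (a' ⊗ₜ c') = TensorProduct.map (mA a) (mC.flip c') (τ c a'))
    (hC1 : ∀ c, mC c oneC = c) (hτ : ∀ c, τ c oneA = oneA ⊗ₜ c) (x : A ⊗[k] C) :
    m x (oneA ⊗ₜ oneC) = x := by
  induction x using TensorProduct.induction_on with
  | zero => simp
  | add x x' h h' => simp only [map_add, LinearMap.add_apply, h, h']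
  | tmul a b => simp [hm, hτ, hA1, hC1]

end TwistedTensorProduct

/-! ### Actions on tensor squares and cubes -/

section TripleAction

variable {k H V : Type*} [Field k] [Ring H] [HopfAlgebra k H] [AddCommGroup V] [Module k V]
  (ρ : H ⊗[k] H →ₐ[k] Module.End k V)

/-- The action of `H ⊗ H` on `V ⊗ (V ⊗ V)` through the first factor. -/
noncomputable def actFst : H ⊗[k] H →ₐ[k] Module.End k (V ⊗[k] (V ⊗[k] V)) :=
  (Module.End.rTensorAlgHom k V (V ⊗[k] V)).comp ρ

/-- The action of `H ⊗ H` on `V ⊗ (V ⊗ V)` through the second factor. -/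
noncomputable def actSnd : H ⊗[k] H →ₐ[k] Module.End k (V ⊗[k] (V ⊗[k] V)) :=
  (Module.End.lTensorAlgHom k (V ⊗[k] V) V).comp ((Module.End.rTensorAlgHom k V V).comp ρ)

/-- The action of `H ⊗ H` on `V ⊗ (V ⊗ V)` through the third factor. -/
noncomputable def actThd : H ⊗[k] H →ₐ[k] Module.End k (V ⊗[k] (V ⊗[k] V)) :=
  (Module.End.lTensorAlgHom k (V ⊗[k] V) V).comp ((Module.End.lTensorAlgHom k V V).comp ρ)

@[simp]
theorem actFst_tmul (h : H ⊗[k] H) (u v w : V) :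
    actFst ρ h (u ⊗ₜ[k] (v ⊗ₜ[k] w)) = ρ h u ⊗ₜ (v ⊗ₜ w) := rfl

@[simp]
theorem actSnd_tmul (h : H ⊗[k] H) (u v w : V) :
    actSnd ρ h (u ⊗ₜ[k] (v ⊗ₜ[k] w)) = u ⊗ₜ (ρ h v ⊗ₜ w) := rfl

@[simp]
theorem actThd_tmul (h : H ⊗[k] H) (u v w : V) :
    actThd ρ h (u ⊗ₜ[k] (v ⊗ₜ[k] w)) = u ⊗ₜ (v ⊗ₜ ρ h w) := rfl

theorem commute_actFst_actSnd : LegsCommute (actFst ρ) (actSnd ρ) := by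
  intro x y
  refine TensorProduct.ext_threefold' fun u v w => ?_
  simp

theorem commute_actFst_actThd : LegsCommute (actFst ρ) (actThd ρ) := by
  intro x y
  refine TensorProduct.ext_threefold' fun u v w => ?_
  simp

theorem commute_actSnd_actThd : LegsCommute (actSnd ρ) (actThd ρ) := by
  intro x y
  refine TensorProduct.ext_threefold' fun u v w => ?_
  simp

open Algebra.TensorProduct

/-- The action of `(H ⊗ H) ⊗ (H ⊗ H)` on `V ⊗ V`. -/
noncomputable def actTwo :
    (H ⊗[k] H) ⊗[k] (H ⊗[k] H) →ₗ[k] V ⊗[k] V →ₗ[k] V ⊗[k] V :=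
  TensorProduct.map₂ ρ.toLinearMap ρ.toLinearMap

@[simp]
theorem actTwo_tmul (x y : H ⊗[k] H) (u v : V) :
    actTwo ρ (x ⊗ₜ[k] y) (u ⊗ₜ[k] v) = ρ x u ⊗ₜ ρ y v := rfl

theorem actTwo_mul (X Y : (H ⊗[k] H) ⊗[k] (H ⊗[k] H)) (t : V ⊗[k] V) :
    actTwo ρ (X * Y) t = actTwo ρ X (actTwo ρ Y t) := by
  induction t using TensorProduct.induction_on with
  | zero => simp
  | add t t' h h' => simp only [map_add, h, h']
  | tmul u v =>
    induction X using TensorProduct.induction_on with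
    | zero => simp
    | add X X' h h' => simp only [add_mul, map_add, LinearMap.add_apply, h, h']
    | tmul x y =>
      induction Y using TensorProduct.induction_on with
      | zero => simp
      | add Y Y' h h' => simp only [mul_add, map_add, LinearMap.add_apply, h, h']
      | tmul x' y' => simp

theorem actFstSnd_apply (X : (H ⊗[k] H) ⊗[k] (H ⊗[k] H)) (t : V ⊗[k] V) (w : V) :
    lift (actFst ρ) (actSnd ρ) (commute_actFst_actSnd ρ) X (TensorProduct.assoc k V V V (t ⊗ₜ w)) =
      TensorProduct.assoc k V V V (actTwo ρ X t ⊗ₜ w) := by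
  induction X using TensorProduct.induction_on with
  | zero => simp
  | add X X' h h' => simp only [map_add, LinearMap.add_apply, TensorProduct.add_tmul, h, h']
  | tmul x y =>
    induction t using TensorProduct.induction_on with
    | zero => simp
    | add t t' h h' => simp only [map_add, TensorProduct.add_tmul, h, h']
    | tmul u v => simp

theorem actFstThd_apply (X : (H ⊗[k] H) ⊗[k] (H ⊗[k] H)) (t : V ⊗[k] V) (v : V) :
    lift (actFst ρ) (actThd ρ) (commute_actFst_actThd ρ) X
        (TensorProduct.map LinearMap.id (TensorProduct.mk k V V v) t) =
      TensorProduct.map LinearMap.id (TensorProduct.mk k V V v) (actTwo ρ X t) := by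
  induction X using TensorProduct.induction_on with
  | zero => simp
  | add X X' h h' => simp only [map_add, LinearMap.add_apply, h, h']
  | tmul x y =>
    induction t using TensorProduct.induction_on with
    | zero => simp
    | add t t' h h' => simp only [map_add, h, h']
    | tmul u v => simp

theorem actSndThd_apply (X : (H ⊗[k] H) ⊗[k] (H ⊗[k] H)) (u : V) (t : V ⊗[k] V) :
    lift (actSnd ρ) (actThd ρ) (commute_actSnd_actThd ρ) X (u ⊗ₜ t) = u ⊗ₜ actTwo ρ X t := by
  induction X using TensorProduct.induction_on with
  | zero => simp
  | add X X' h h' => simp only [map_add, LinearMap.add_apply, TensorProduct.tmul_add, h, h']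
  | tmul x y =>
    induction t using TensorProduct.induction_on with
    | zero => simp
    | add t t' h h' => simp only [map_add, TensorProduct.tmul_add, h, h']
    | tmul u v => simp

variable {ρ} {m : V →ₗ[k] V →ₗ[k] V} {δ : H ⊗[k] H →ₐ[k] (H ⊗[k] H) ⊗[k] (H ⊗[k] H)}

/-- If `δ` is compatible with the product `m` on `V`, then acting on a product in the first
factor amounts to acting through `δ` before multiplying. -/
theorem actTwo_mul_tmul
    (hm : ∀ h t, ρ h (TensorProduct.lift m t) = TensorProduct.lift m (actTwo ρ (δ h) t))
    (X : (H ⊗[k] H) ⊗[k] (H ⊗[k] H)) (t : V ⊗[k] V) (w : V) :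
    actTwo ρ X (TensorProduct.lift m t ⊗ₜ w) =
      TensorProduct.map (TensorProduct.lift m) LinearMap.id ((TensorProduct.assoc k V V V).symm
        (lift ((lift (actFst ρ) (actSnd ρ) (commute_actFst_actSnd ρ)).comp δ) (actThd ρ)
          (((commute_actFst_actSnd ρ).lift_left (commute_actFst_actThd ρ)
            (commute_actSnd_actThd ρ)).comp_left _) X (TensorProduct.assoc k V V V (t ⊗ₜ w)))) := by
  induction X using TensorProduct.induction_on with
  | zero => simp
  | add X X' h h' => simp only [map_add, LinearMap.add_apply, h, h']
  | tmul x y =>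
    have h : ∀ s : V ⊗[k] V, actThd ρ y (TensorProduct.assoc k V V V (s ⊗ₜ w)) =
        TensorProduct.assoc k V V V (s ⊗ₜ ρ y w) := by
      intro s
      induction s using TensorProduct.induction_on with
      | zero => simp
      | add t t' h h' => simp only [map_add, TensorProduct.add_tmul, h, h']
      | tmul u v => simp
    rw [lift_tmul, Module.End.mul_apply, h, AlgHom.comp_apply, actFstSnd_apply]
    rw [LinearEquiv.symm_apply_apply, TensorProduct.map_tmul, ← hm]
    rfl

theorem actTwo_tmul_mul
    (hm : ∀ h t, ρ h (TensorProduct.lift m t) = TensorProduct.lift m (actTwo ρ (δ h) t))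
    (X : (H ⊗[k] H) ⊗[k] (H ⊗[k] H)) (u : V) (t : V ⊗[k] V) :
    actTwo ρ X (u ⊗ₜ TensorProduct.lift m t) =
      TensorProduct.map LinearMap.id (TensorProduct.lift m)
        (lift (actFst ρ) ((lift (actSnd ρ) (actThd ρ) (commute_actSnd_actThd ρ)).comp δ)
          (((commute_actSnd_actThd ρ).lift_right (commute_actFst_actSnd ρ)
            (commute_actFst_actThd ρ)).comp_right _) X (u ⊗ₜ t)) := by
  induction X using TensorProduct.induction_on with
  | zero => simp
  | add X X' h h' => simp only [map_add, LinearMap.add_apply, h, h']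
  | tmul x y =>
    rw [lift_tmul, Module.End.mul_apply, AlgHom.comp_apply, actSndThd_apply]
    change _ = TensorProduct.map LinearMap.id (TensorProduct.lift m) (ρ x u ⊗ₜ[k] actTwo ρ (δ y) t)
    rw [TensorProduct.map_tmul, ← hm]
    rfl

end TripleAction

/-! ### The antipode and the Drinfeld element -/

section Antipode

variable {k H : Type*} [Field k] [Ring H] [HopfAlgebra k H]

open Algebra.TensorProduct HopfAlgebra

namespace UniversalRMatrix

variable (𝓡 : UniversalRMatrix k H)

theorem onLegs_trivialLeg_left (i : H →ₐ[k] H ⊗[k] H) :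
    onLegs (trivialLeg k H (H ⊗[k] H)) i 𝓡.R.val = 1 := by
  rw [← coe_legUnit (legsCommute_trivialLeg_left _), legUnit_trivialLeg_left, Units.val_one]

theorem onLegs_trivialLeg_right (i : H →ₐ[k] H ⊗[k] H) :
    onLegs i (trivialLeg k H (H ⊗[k] H)) 𝓡.R.val = 1 := by
  rw [← coe_legUnit (legsCommute_trivialLeg_right _), legUnit_trivialLeg_right, Units.val_one]

theorem onLegs_trivialLeg_right_inv (i : H →ₐ[k] H ⊗[k] H) :
    onLegs i (trivialLeg k H (H ⊗[k] H)) 𝓡.R.inv = 1 := by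
  rw [← coe_inv_legUnit (legsCommute_trivialLeg_right _), legUnit_trivialLeg_right, inv_one,
    Units.val_one]

/-- `(S ⊗ id)(R) = R⁻¹`: apply `S(x) y ⊗ z` to the two sides of `(Δ ⊗ id)(R) = R^{1,3} R^{2,3}`. -/
theorem rTensor_antipode_R : (antipode k).rTensor H 𝓡.R.val = 𝓡.R.inv := by
  let i : H →ₐ[k] (H ⊗[k] H) ⊗[k] H := includeLeft.comp includeLeft
  let j : H →ₐ[k] (H ⊗[k] H) ⊗[k] H := includeLeft.comp includeRight
  let l : H →ₐ[k] (H ⊗[k] H) ⊗[k] H := includeRight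
  have hij : LegsCommute i j := legsCommute_includeLeft_includeRight.map _
  have hil : LegsCommute i l := legsCommute_includeLeft_includeRight.comp_left _
  have hjl : LegsCommute j l := legsCommute_includeLeft_includeRight.comp_left _
  let Λ : (H ⊗[k] H) ⊗[k] H →ₗ[k] H ⊗[k] H :=
    (LinearMap.mul' k H ∘ₗ (antipode k).rTensor H).rTensor H
  have h1 : ∀ X Y : H ⊗[k] H, Λ (onLegs i l X * onLegs j l Y) = (antipode k).rTensor H X * Y := by
    intro X Y
    induction X using TensorProduct.induction_on with
    | zero => simp
    | add X X' h h' => simp only [map_add, add_mul, h, h']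
    | tmul x y =>
      induction Y using TensorProduct.induction_on with
      | zero => simp
      | add Y Y' h h' => simp only [map_add, mul_add, h, h']
      | tmul z w => simp [Λ, i, j, l]
  have h2 : ∀ X : H ⊗[k] H, Λ (onLegs (comulLegs i j) l X) =
      onLegs (trivialLeg k H (H ⊗[k] H)) includeRight X := by
    intro X
    induction X using TensorProduct.induction_on with
    | zero => simp
    | add X X' h h' => simp only [map_add, h, h']
    | tmul x y =>
      have h3 : ∀ Z : H ⊗[k] H, onLegs i j Z * l y = Z ⊗ₜ[k] y := by
        intro Z
        induction Z using TensorProduct.induction_on with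
        | zero => simp
        | add X X' h h' => simp only [map_add, add_mul, TensorProduct.add_tmul, h, h']
        | tmul x y => simp [i, j, l]
      rw [onLegs_tmul, comulLegs_apply hij, h3]
      simp [Λ, trivialLeg_apply, mul_antipode_rTensor_comul_apply,
        Algebra.TensorProduct.algebraMap_apply]
  have h := congrArg Units.val (legUnit_comulLegs_left (𝓡 := 𝓡) hij hil hjl)
  rw [coe_legUnit (hij.comulLegs_left hil hjl), Units.val_mul, coe_legUnit hil,
    coe_legUnit hjl] at h
  have h' := congrArg Λ h
  rw [h1, h2, onLegs_trivialLeg_left] at h'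
  exact (Units.inv_eq_of_mul_eq_one_left h'.symm).symm

variable (k H) in
/-- The map `x ⊗ (y ⊗ z) ↦ x ⊗ y S(z)`. -/
noncomputable def mulAntipode : H ⊗[k] (H ⊗[k] H) →ₗ[k] H ⊗[k] H :=
  (LinearMap.mul' k H ∘ₗ (antipode k).lTensor H).lTensor H

variable (k H) in
/-- The second leg `H → H ⊗ (H ⊗ H)`. -/
noncomputable def midLeg : H →ₐ[k] H ⊗[k] (H ⊗[k] H) := includeRight.comp includeLeft

variable (k H) in
/-- The third leg `H → H ⊗ (H ⊗ H)`. -/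
noncomputable def lastLeg : H →ₐ[k] H ⊗[k] (H ⊗[k] H) := includeRight.comp includeRight

theorem legsCommute_midLeg_lastLeg : LegsCommute (midLeg k H) (lastLeg k H) :=
  legsCommute_includeLeft_includeRight.map _

theorem legsCommute_includeLeft_midLeg : LegsCommute includeLeft (midLeg k H) :=
  legsCommute_includeLeft_includeRight.comp_right _

theorem legsCommute_includeLeft_lastLeg : LegsCommute includeLeft (lastLeg k H) :=
  legsCommute_includeLeft_includeRight.comp_right _

theorem mulAntipode_onLegs_comulLegs (X : H ⊗[k] H) :
    mulAntipode k H (onLegs includeLeft (comulLegs (midLeg k H) (lastLeg k H)) X) =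
      onLegs includeLeft (trivialLeg k H (H ⊗[k] H)) X := by
  induction X using TensorProduct.induction_on with
  | zero => simp
  | add X X' h h' => simp only [map_add, h, h']
  | tmul x y =>
    have h3 : ∀ Z : H ⊗[k] H,
        (includeLeft : H →ₐ[k] H ⊗[k] (H ⊗[k] H)) x * onLegs (midLeg k H) (lastLeg k H) Z =
          x ⊗ₜ[k] Z := by
      intro Z
      induction Z using TensorProduct.induction_on with
      | zero => simp
      | add X X' h h' => simp only [map_add, mul_add, TensorProduct.tmul_add, h, h']
      | tmul x y => simp [midLeg, lastLeg]
    rw [onLegs_tmul, comulLegs_apply legsCommute_midLeg_lastLeg, h3]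
    simp [mulAntipode, trivialLeg_apply, mul_antipode_lTensor_comul_apply,
      TensorProduct.smul_tmul',
      Algebra.algebraMap_eq_smul_one]

/-- `(id ⊗ S)(R⁻¹) = R`: apply `x ⊗ y S(z)` to the inverses of the two sides of
`(id ⊗ Δ)(R) = R^{1,3} R^{1,2}`. -/
theorem lTensor_antipode_R_inv : (antipode k).lTensor H 𝓡.R.inv = 𝓡.R.val := by
  have h1 : ∀ X Y : H ⊗[k] H, mulAntipode k H
      (onLegs includeLeft (midLeg k H) X * onLegs includeLeft (lastLeg k H) Y) =
        X * (antipode k).lTensor H Y := by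
    intro X Y
    induction X using TensorProduct.induction_on with
    | zero => simp
    | add X X' h h' => simp only [map_add, add_mul, h, h']
    | tmul x y =>
      induction Y using TensorProduct.induction_on with
      | zero => simp
      | add Y Y' h h' => simp only [map_add, mul_add, h, h']
      | tmul z w => simp [mulAntipode, midLeg, lastLeg]
  have h := congrArg (fun u : (H ⊗[k] (H ⊗[k] H))ˣ => (↑u⁻¹ : H ⊗[k] (H ⊗[k] H)))
    (legUnit_comulLegs_right (𝓡 := 𝓡) legsCommute_midLeg_lastLeg
      legsCommute_includeLeft_midLeg legsCommute_includeLeft_lastLeg)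
  simp only [mul_inv_rev, Units.val_mul] at h
  rw [coe_inv_legUnit (legsCommute_midLeg_lastLeg.comulLegs_right
      legsCommute_includeLeft_midLeg legsCommute_includeLeft_lastLeg),
    coe_inv_legUnit legsCommute_includeLeft_midLeg,
    coe_inv_legUnit legsCommute_includeLeft_lastLeg] at h
  have h' := congrArg (mulAntipode k H) h
  rw [h1, mulAntipode_onLegs_comulLegs, onLegs_trivialLeg_right_inv] at h'
  exact (Units.inv_eq_of_mul_eq_one_right (u := 𝓡.R⁻¹) h'.symm).symm

theorem map_antipode_antipode_R :
    TensorProduct.map (antipode k) (antipode k) 𝓡.R.val = 𝓡.R.val := by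
  conv_rhs => rw [← lTensor_antipode_R_inv, ← rTensor_antipode_R]
  rw [← LinearMap.comp_apply, LinearMap.lTensor_comp_rTensor]

variable (k H) in
/-- The map `x ⊗ y ↦ S(y) x`; it maps the R-matrix to the Drinfeld element. -/
noncomputable def antipodeMulRev : H ⊗[k] H →ₗ[k] H :=
  LinearMap.mul' k H ∘ₗ (antipode k).rTensor H ∘ₗ (TensorProduct.comm k H H).toLinearMap

@[simp]
theorem antipodeMulRev_tmul (x y : H) :
    antipodeMulRev k H (x ⊗ₜ y) = antipode k y * x := rfl

/-- The Drinfeld element implements the square of the antipode. -/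
theorem antipode_sq_mul_drinfeld (h : H) :
    antipode k (antipode k h) * antipodeMulRev k H 𝓡.R.val = antipodeMulRev k H 𝓡.R.val * h := by
  let S : H →ₗ[k] H := antipode k
  let u := antipodeMulRev k H 𝓡.R.val
  have hS : ∀ x y, S (x * y) = S y * S x := antipode_mul_antidistrib
  have h1 : ∀ p X, antipodeMulRev k H
      (TensorProduct.comm k H H (Coalgebra.comul (R := k) p) * X) =
        Coalgebra.counit (R := k) p • antipodeMulRev k H X := by
    intro p X
    induction X using TensorProduct.induction_on with
    | zero => simp
    | add X X' h h' => simp only [map_add, mul_add, smul_add, h, h']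
    | tmul a b =>
      have h2 : ∀ Z : H ⊗[k] H, antipodeMulRev k H (TensorProduct.comm k H H Z * (a ⊗ₜ b)) =
          S b * LinearMap.mul' k H (S.rTensor H Z) * a := by
        intro Z
        induction Z using TensorProduct.induction_on with
        | zero => simp
        | add X X' h h' => simp only [map_add, add_mul, mul_add, h, h']
        | tmul x y => simp [S, antipode_mul_antidistrib, mul_assoc]
      rw [h2, mul_antipode_rTensor_comul_apply]
      simp [S, Algebra.algebraMap_eq_smul_one]
  -- `Σ S²(h₂) ν(R Δ(h₁))`, where `ν` is `antipodeMulRev`, is computed in two ways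
  let Θ : H ⊗[k] H →ₗ[k] H := TensorProduct.lift ((LinearMap.mul k H).compl₁₂ (S ∘ₗ S)
    (antipodeMulRev k H ∘ₗ LinearMap.mulLeft k 𝓡.R.val ∘ₗ Coalgebra.comul)).flip
  have hΘ1 : ∀ Z, Θ Z = S (S (TensorProduct.lid k H (Coalgebra.counit.rTensor H Z))) * u := by
    intro Z
    induction Z using TensorProduct.induction_on with
    | zero => simp
    | add X X' h h' => simp only [map_add, add_mul, h, h']
    | tmul p q =>
      change S (S q) * antipodeMulRev k H (𝓡.R.val * Coalgebra.comul (R := k) p) = _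
      rw [← 𝓡.comul_op_mul, h1]
      simp [u]
  let Γ : H ⊗[k] (H ⊗[k] H) →ₗ[k] H := TensorProduct.lift ((LinearMap.mul k H).compl₁₂
    (LinearMap.mul' k H ∘ₗ TensorProduct.map (S ∘ₗ S) S ∘ₗ (TensorProduct.comm k H H).toLinearMap)
    (LinearMap.mulLeft k u)).flip
  have hΘ2 : ∀ Z, Θ Z = Γ (TensorProduct.assoc k H H H (Coalgebra.comul.rTensor H Z)) := by
    intro Z
    induction Z using TensorProduct.induction_on with
    | zero => simp
    | add X X' h h' => simp only [map_add, h, h']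
    | tmul p q =>
      change S (S q) * antipodeMulRev k H (𝓡.R.val * Coalgebra.comul (R := k) p) = _
      rw [LinearMap.rTensor_tmul]
      induction Coalgebra.comul (R := k) p using TensorProduct.induction_on with
      | zero => simp
      | add X X' h h' => simp only [map_add, mul_add, TensorProduct.add_tmul, h, h']
      | tmul x y =>
        have h2 : ∀ X : H ⊗[k] H, antipodeMulRev k H (X * (x ⊗ₜ y)) =
            S y * antipodeMulRev k H X * x := by
          intro X
          induction X using TensorProduct.induction_on with
          | zero => simp
          | add X X' h h' => simp only [map_add, add_mul, mul_add, h, h']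
          | tmul z w => simp [S, antipode_mul_antidistrib, mul_assoc]
        rw [h2]
        simp [Γ, u, mul_assoc]
  have hΓ : ∀ Z, Γ (Coalgebra.comul.lTensor H Z) =
      u * TensorProduct.rid k H (Coalgebra.counit.lTensor H Z) := by
    intro Z
    induction Z using TensorProduct.induction_on with
    | zero => simp
    | add X X' h h' => simp only [map_add, mul_add, h, h']
    | tmul x y =>
      have h2 : ∀ Z : H ⊗[k] H, Γ (x ⊗ₜ Z) =
          S (LinearMap.mul' k H (S.lTensor H Z)) * (u * x) := by
        intro Z
        induction Z using TensorProduct.induction_on with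
        | zero => simp
        | add X X' h h' => simp only [map_add, TensorProduct.tmul_add, add_mul, h, h']
        | tmul x y => simp [Γ, hS]
      rw [LinearMap.lTensor_tmul, h2, mul_antipode_lTensor_comul_apply]
      simp [S, Algebra.algebraMap_eq_smul_one]
  have h3 := hΘ1 (Coalgebra.comul h)
  rw [hΘ2, Coalgebra.coassoc_apply, hΓ, Coalgebra.rTensor_counit_comul,
    Coalgebra.lTensor_counit_comul] at h3
  simpa using h3.symm

/-- The Drinfeld element `u = Σ S(b) a`, where `R = Σ a ⊗ b`, has the inverse `v = Σ b S²(a)`, and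
`S²(h) u = u h`; hence `S²`, being conjugation by `u`, is bijective. -/
theorem bijective_antipode (𝓡 : UniversalRMatrix k H) :
    Function.Bijective (antipode k : H →ₗ[k] H) := by
  let S : H →ₗ[k] H := antipode k
  let u := antipodeMulRev k H 𝓡.R.val
  let v : H ⊗[k] H →ₗ[k] H := LinearMap.mul' k H ∘ₗ (S ∘ₗ S).lTensor H ∘ₗ
    (TensorProduct.comm k H H).toLinearMap
  have hu : ∀ h, S (S h) * u = u * h := 𝓡.antipode_sq_mul_drinfeld
  have huv : u * v 𝓡.R.val = 1 := by
    have h1 : ∀ Y, u * v Y = antipodeMulRev k H (𝓡.R.val * TensorProduct.map (S ∘ₗ S) S Y) := by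
      intro Y
      induction Y using TensorProduct.induction_on with
      | zero => simp
      | add X X' h h' => simp only [map_add, mul_add, h, h']
      | tmul x y =>
        have h2 : ∀ X, antipodeMulRev k H (X * (S (S x) ⊗ₜ[k] S y)) =
            S (S y) * antipodeMulRev k H X * S (S x) := by
          intro X
          induction X using TensorProduct.induction_on with
          | zero => simp
          | add X X' h h' => simp only [map_add, mul_add, add_mul, h, h']
          | tmul z w => simp [S, antipode_mul_antidistrib, mul_assoc]
        rw [TensorProduct.map_tmul]
        change u * (y * S (S x)) = antipodeMulRev k H (𝓡.R.val * (S (S x) ⊗ₜ[k] S y))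
        rw [h2, hu, mul_assoc]
    have h3 : TensorProduct.map (S ∘ₗ S) S 𝓡.R.val = 𝓡.R.inv := by
      rw [← rTensor_antipode_R]
      conv_rhs => rw [← map_antipode_antipode_R]
      rw [← LinearMap.comp_apply, LinearMap.rTensor_comp_map]
    rw [h1, h3, Units.val_inv]
    simp [antipodeMulRev, one_def]
  have hvu : v 𝓡.R.val * u = 1 := by
    have h1 : ∀ Y, v Y * u = LinearMap.mul' k H (TensorProduct.comm k H H
        (mulAntipode k H (onLegs includeLeft (lastLeg k H) 𝓡.R.val *
          onLegs includeLeft (midLeg k H) Y))) := by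
      intro Y
      induction Y using TensorProduct.induction_on with
      | zero => simp
      | add X X' h h' => simp only [map_add, mul_add, add_mul, h, h']
      | tmul x y =>
        have h2 : ∀ X, y * antipodeMulRev k H X * x =
            LinearMap.mul' k H (TensorProduct.comm k H H
              (mulAntipode k H (onLegs includeLeft (lastLeg k H) X *
                onLegs includeLeft (midLeg k H) (x ⊗ₜ[k] y)))) := by
          intro X
          induction X using TensorProduct.induction_on with
          | zero => simp
          | add X X' h h' => simp only [map_add, mul_add, add_mul, h, h']
          | tmul z w => simp [mulAntipode, midLeg, lastLeg, mul_assoc]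
        rw [← h2]
        change y * S (S x) * u = y * u * x
        rw [mul_assoc, mul_assoc, hu]
    have h := congrArg Units.val (legUnit_comulLegs_right (𝓡 := 𝓡) legsCommute_midLeg_lastLeg
      legsCommute_includeLeft_midLeg legsCommute_includeLeft_lastLeg)
    rw [Units.val_mul, coe_legUnit (legsCommute_midLeg_lastLeg.comulLegs_right
        legsCommute_includeLeft_midLeg legsCommute_includeLeft_lastLeg),
      coe_legUnit legsCommute_includeLeft_midLeg,
      coe_legUnit legsCommute_includeLeft_lastLeg] at h
    rw [h1, ← h, mulAntipode_onLegs_comulLegs, onLegs_trivialLeg_right]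
    simp [one_def]
  have hinj : Function.Injective (S ∘ S) := by
    intro x y hxy
    have h : u * x = u * y := by rw [← hu, ← hu]; exact congrArg (· * u) hxy
    rw [← one_mul x, ← one_mul y, ← hvu, mul_assoc, mul_assoc, h]
  have hsurj : Function.Surjective (S ∘ S) := by
    intro y
    refine ⟨v 𝓡.R.val * y * u, ?_⟩
    have h := hu (v 𝓡.R.val * y * u)
    have h' := congrArg (· * v 𝓡.R.val) h
    rw [Function.comp_apply]
    simpa only [mul_assoc, huv, mul_one, ← mul_assoc u, one_mul] using h'
  exact ⟨hinj.of_comp, hsurj.of_comp⟩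

end UniversalRMatrix

end Antipode

/-! ### The inverse of the antipode -/

section AntipodeInv

variable {k H : Type*} [Field k] [Ring H] [HopfAlgebra k H]

open Algebra.TensorProduct HopfAlgebra

/-- The antipode reverses the coproduct: both sides are convolution inverses of
`Δ = (x ↦ x ⊗ 1) * (x ↦ 1 ⊗ x)`. -/
theorem comul_antipode (x : H) : Coalgebra.comul (R := k) (antipode k x) =
    TensorProduct.comm k H H
      (TensorProduct.map (antipode k) (antipode k) (Coalgebra.comul (R := k) x)) := by
  have hr : ∀ i : H →ₐ[k] H ⊗[k] H, WithConv.toConv i.toLinearMap *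
      WithConv.toConv (i.toLinearMap ∘ₗ antipode k) = 1 := by
    intro i
    have h := LinearMap.algHom_comp_convMul_distrib i (WithConv.toConv LinearMap.id)
      (WithConv.toConv (antipode k (A := H)))
    rw [LinearMap.id_mul_antipode] at h
    ext x
    have h' := LinearMap.congr_fun h x
    simpa using h'.symm
  have hl : ∀ i : H →ₐ[k] H ⊗[k] H, WithConv.toConv (i.toLinearMap ∘ₗ antipode k) *
      WithConv.toConv i.toLinearMap = 1 := by
    intro i
    have h := LinearMap.algHom_comp_convMul_distrib i (WithConv.toConv (antipode k (A := H)))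
      (WithConv.toConv LinearMap.id)
    rw [LinearMap.antipode_mul_id] at h
    ext x
    have h' := LinearMap.congr_fun h x
    simpa using h'.symm
  let i : H →ₐ[k] H ⊗[k] H := includeLeft
  let j : H →ₐ[k] H ⊗[k] H := includeRight
  have hΔ : WithConv.toConv (Bialgebra.comulAlgHom k H).toLinearMap =
      WithConv.toConv i.toLinearMap * WithConv.toConv j.toLinearMap := by
    ext x
    rw [LinearMap.convMul_apply]
    change Coalgebra.comul (R := k) x = _
    induction Coalgebra.comul (R := k) x using TensorProduct.induction_on with
    | zero => simp
    | add X X' h h' => simp only [map_add, ← h, ← h']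
    | tmul x y => simp [i, j]
  have h := left_inv_eq_right_inv (hl (Bialgebra.comulAlgHom k H))
    (c := WithConv.toConv (j.toLinearMap ∘ₗ antipode k) *
      WithConv.toConv (i.toLinearMap ∘ₗ antipode k)) (by
      rw [hΔ, mul_assoc, ← mul_assoc (WithConv.toConv j.toLinearMap), hr, one_mul, hr])
  have h' := congrArg (fun f => f.ofConv x) h
  change Coalgebra.comul (R := k) (antipode k x) = _ at h'
  rw [h']
  change (WithConv.toConv (j.toLinearMap ∘ₗ antipode k) *
      WithConv.toConv (i.toLinearMap ∘ₗ antipode k)) x = _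
  rw [LinearMap.convMul_apply]
  induction Coalgebra.comul (R := k) x using TensorProduct.induction_on with
  | zero => simp
  | add X X' h h' => simp only [map_add, ← h, ← h']
  | tmul x y => simp [i, j]

namespace UniversalRMatrix

variable (𝓡 : UniversalRMatrix k H)
include 𝓡

theorem isUnit_antipode : IsUnit (antipode k : Module.End k H) :=
  (Module.End.isUnit_iff _).2 𝓡.bijective_antipode

theorem antipode_antipodeInv (x : H) : antipode k (antipodeInv k H x) = x :=
  LinearMap.congr_fun (Ring.mul_inverse_cancel _ 𝓡.isUnit_antipode) x

theorem antipodeInv_antipode (x : H) : antipodeInv k H (antipode k x) = x :=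
  LinearMap.congr_fun (Ring.inverse_mul_cancel _ 𝓡.isUnit_antipode) x

theorem antipodeInv_mul (x y : H) :
    antipodeInv k H (x * y) = antipodeInv k H y * antipodeInv k H x := by
  apply 𝓡.bijective_antipode.1
  simp only [antipode_mul_antidistrib, 𝓡.antipode_antipodeInv]

theorem antipodeInv_one : antipodeInv k H (1 : H) = 1 := by
  apply 𝓡.bijective_antipode.1
  rw [𝓡.antipode_antipodeInv, antipode_one]

theorem counit_antipodeInv (x : H) :
    Coalgebra.counit (R := k) (antipodeInv k H x) = Coalgebra.counit (R := k) x := by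
  rw [← counit_antipode (R := k) (antipodeInv k H x), 𝓡.antipode_antipodeInv]

theorem antipodeInv_comp_antipode : antipodeInv k H ∘ₗ antipode k = LinearMap.id :=
  LinearMap.ext 𝓡.antipodeInv_antipode

theorem comul_antipodeInv (x : H) : Coalgebra.comul (R := k) (antipodeInv k H x) =
    TensorProduct.comm k H H
      (TensorProduct.map (antipodeInv k H) (antipodeInv k H) (Coalgebra.comul (R := k) x)) := by
  conv_rhs => rw [← 𝓡.antipode_antipodeInv x, comul_antipode, TensorProduct.map_comm,
    ← LinearMap.comp_apply, ← TensorProduct.map_comp, 𝓡.antipodeInv_comp_antipode]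
  simp

theorem rTensor_antipodeInv_R_inv : (antipodeInv k H).rTensor H 𝓡.R.inv = 𝓡.R.val := by
  rw [← rTensor_antipode_R, ← LinearMap.comp_apply, ← LinearMap.rTensor_comp,
    𝓡.antipodeInv_comp_antipode]
  simp

theorem map_antipodeInv_R :
    TensorProduct.map (antipodeInv k H) (antipodeInv k H) 𝓡.R.val = 𝓡.R.val := by
  conv_lhs => rw [← map_antipode_antipode_R, ← LinearMap.comp_apply, ← TensorProduct.map_comp,
    𝓡.antipodeInv_comp_antipode]
  simp

end UniversalRMatrix

end AntipodeInv

/-! ### The action on the restricted dual -/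

section BraidedDualAlgebra

variable {k H : Type*} [Field k] [Ring H] [HopfAlgebra k H]

open HopfAlgebra

namespace UniversalRMatrix

variable (𝓡 : UniversalRMatrix k H)

variable {𝓡} in
theorem BraidedDual.ext {f g : 𝓡.BraidedDual} (h : ∀ u, 𝓡.toDual f u = 𝓡.toDual g u) : f = g :=
  Subtype.ext (LinearMap.ext h)

theorem toDual_one (u : H) : 𝓡.toDual 1 u = Coalgebra.counit (R := k) u := rfl

theorem toDual_actB (x y : H) (f : 𝓡.BraidedDual) (u : H) :
    𝓡.toDual (𝓡.actB (x ⊗ₜ y) f) u = 𝓡.toDual f (antipodeInv k H x * (u * y)) := rfl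

/-- The product of the Hopf algebra `H°`, on the vector space underlying the braided dual. -/
noncomputable def convMulB : 𝓡.BraidedDual →ₗ[k] 𝓡.BraidedDual →ₗ[k] 𝓡.BraidedDual := dualMul k H

theorem toDual_convMulB (f g : 𝓡.BraidedDual) (u : H) : 𝓡.toDual (𝓡.convMulB f g) u =
    TensorProduct.dualDistrib k H H (𝓡.toDual f ⊗ₜ 𝓡.toDual g) (Coalgebra.comul u) := rfl

/-- The action of `H ⊗ H` on the braided dual as an algebra map. -/
noncomputable def actHom : H ⊗[k] H →ₐ[k] Module.End k 𝓡.BraidedDual :=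
  Algebra.TensorProduct.algHomOfLinearMapTensorProduct (𝓡.actB)
    (fun x x' y y' => by
      refine LinearMap.ext fun f => BraidedDual.ext fun u => ?_
      rw [Module.End.mul_apply]
      simp only [toDual_actB, 𝓡.antipodeInv_mul, mul_assoc])
    (by
      refine LinearMap.ext fun f => BraidedDual.ext fun u => ?_
      rw [toDual_actB, 𝓡.antipodeInv_one, one_mul, mul_one]
      rfl)

theorem toDual_actHom (x y : H) (f : 𝓡.BraidedDual) (u : H) :
    𝓡.toDual (𝓡.actHom (x ⊗ₜ y) f) u = 𝓡.toDual f (antipodeInv k H x * (u * y)) := rfl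

/-- The definition of the product of the braided dual, in terms of `actTwo`. -/
theorem mulB_eq (f g : 𝓡.BraidedDual) :
    𝓡.mulB f g = TensorProduct.lift 𝓡.convMulB (actTwo 𝓡.actHom 𝓡.twist (g ⊗ₜ f)) := rfl

theorem convMulB_assoc (f g h : 𝓡.BraidedDual) :
    𝓡.convMulB (𝓡.convMulB f g) h = 𝓡.convMulB f (𝓡.convMulB g h) := by
  apply BraidedDual.ext
  intro u
  let Ξ : H ⊗[k] (H ⊗[k] H) →ₗ[k] k := TensorProduct.dualDistrib k H (H ⊗[k] H)
    (𝓡.toDual f ⊗ₜ TensorProduct.dualDistrib k H H (𝓡.toDual g ⊗ₜ 𝓡.toDual h))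
  have h1 : ∀ Z, TensorProduct.dualDistrib k H H (𝓡.toDual (𝓡.convMulB f g) ⊗ₜ 𝓡.toDual h) Z =
      Ξ (TensorProduct.assoc k H H H (Coalgebra.comul.rTensor H Z)) := by
    intro Z
    induction Z using TensorProduct.induction_on with
    | zero => simp
    | add X X' h h' => simp only [map_add, h, h']
    | tmul x y =>
      rw [TensorProduct.dualDistrib_apply, toDual_convMulB, LinearMap.rTensor_tmul]
      induction Coalgebra.comul (R := k) x using TensorProduct.induction_on with
      | zero => simp
      | add X X' h h' => simp only [map_add, TensorProduct.add_tmul, add_mul, h, h']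
      | tmul z w => simp [Ξ, mul_assoc]
  have h2 : ∀ Z, TensorProduct.dualDistrib k H H (𝓡.toDual f ⊗ₜ 𝓡.toDual (𝓡.convMulB g h)) Z =
      Ξ (Coalgebra.comul.lTensor H Z) := by
    intro Z
    induction Z using TensorProduct.induction_on with
    | zero => simp
    | add X X' h h' => simp only [map_add, h, h']
    | tmul x y => rfl
  rw [toDual_convMulB, toDual_convMulB, h1, h2, Coalgebra.coassoc_apply]

theorem one_convMulB (f : 𝓡.BraidedDual) : 𝓡.convMulB 1 f = f := by
  apply BraidedDual.ext
  intro u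
  have h : ∀ Z, TensorProduct.dualDistrib k H H (𝓡.toDual 1 ⊗ₜ 𝓡.toDual f) Z =
      𝓡.toDual f (TensorProduct.lid k H (Coalgebra.counit.rTensor H Z)) := by
    intro Z
    induction Z using TensorProduct.induction_on with
    | zero => simp
    | add X X' h h' => simp only [map_add, h, h']
    | tmul x y => simp [toDual_one]
  rw [toDual_convMulB, h, Coalgebra.rTensor_counit_comul]
  simp

theorem convMulB_one (f : 𝓡.BraidedDual) : 𝓡.convMulB f 1 = f := by
  apply BraidedDual.ext
  intro u
  have h : ∀ Z, TensorProduct.dualDistrib k H H (𝓡.toDual f ⊗ₜ 𝓡.toDual 1) Z =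
      𝓡.toDual f (TensorProduct.rid k H (Coalgebra.counit.lTensor H Z)) := by
    intro Z
    induction Z using TensorProduct.induction_on with
    | zero => simp
    | add X X' h h' => simp only [map_add, h, h']
    | tmul x y => simp [toDual_one, mul_comm]
  rw [toDual_convMulB, h, Coalgebra.lTensor_counit_comul]
  simp

/-- `H°` is a module algebra over `H^e = H^coop ⊗ H`. -/
theorem actHom_convMulB (h : H ⊗[k] H) (t : 𝓡.BraidedDual ⊗[k] 𝓡.BraidedDual) :
    𝓡.actHom h (TensorProduct.lift 𝓡.convMulB t) =
      TensorProduct.lift 𝓡.convMulB (actTwo 𝓡.actHom (comulEnvHom k H h) t) := by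
  induction t using TensorProduct.induction_on with
  | zero => simp
  | add X X' h h' => simp only [map_add, h, h']
  | tmul f g =>
    induction h using TensorProduct.induction_on with
    | zero => simp
    | add X X' h h' => simp only [map_add, LinearMap.add_apply, h, h']
    | tmul x y =>
      apply BraidedDual.ext
      intro u
      -- the claim for `Δ(x)`, `Δ(y)` replaced by arbitrary tensors
      have key : ∀ X Y : H ⊗[k] H, 𝓡.toDual (TensorProduct.lift 𝓡.convMulB (actTwo 𝓡.actHom
          (TensorProduct.tensorTensorTensorComm k H H H H (TensorProduct.comm k H H X ⊗ₜ Y))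
            (f ⊗ₜ g))) u = TensorProduct.dualDistrib k H H (𝓡.toDual f ⊗ₜ 𝓡.toDual g)
          (TensorProduct.comm k H H (TensorProduct.map (antipodeInv k H) (antipodeInv k H) X) *
            (Coalgebra.comul (R := k) u * Y)) := by
        intro X Y
        induction X using TensorProduct.induction_on with
        | zero => simp
        | add X X' h h' =>
          simp only [map_add, TensorProduct.add_tmul, LinearMap.add_apply, add_mul, h, h']
        | tmul a b =>
          induction Y using TensorProduct.induction_on with
          | zero => simp
          | add X X' h h' =>
            simp only [map_add, TensorProduct.tmul_add, LinearMap.add_apply, mul_add, h, h']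
          | tmul c d =>
            simp only [TensorProduct.comm_tmul, TensorProduct.tensorTensorTensorComm_tmul,
              actTwo_tmul, TensorProduct.lift.tmul, TensorProduct.map_tmul, toDual_convMulB]
            induction Coalgebra.comul (R := k) u using TensorProduct.induction_on with
            | zero => simp
            | add X X' h h' => simp only [map_add, mul_add, add_mul, h, h']
            | tmul p q => simp [toDual_actHom]
      rw [comulEnvHom_apply]
      change _ = 𝓡.toDual (TensorProduct.lift 𝓡.convMulB (actTwo 𝓡.actHom
          (TensorProduct.tensorTensorTensorComm k H H H H
            (TensorProduct.comm k H H (Coalgebra.comul x) ⊗ₜ Coalgebra.comul y)) (f ⊗ₜ g))) u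
      rw [key, ← 𝓡.comul_antipodeInv, ← Bialgebra.comul_mul, ← Bialgebra.comul_mul]
      rfl

end UniversalRMatrix

end BraidedDualAlgebra

/-! ### Counit identities -/

section Counit

variable {k H V : Type*} [Field k] [Ring H] [HopfAlgebra k H] [AddCommGroup V] [Module k V]

open Algebra.TensorProduct

variable (k H) in
/-- The counit of `H ⊗ H`. -/
noncomputable def envCounit : H ⊗[k] H →ₐ[k] k :=
  lift (Bialgebra.counitAlgHom k H) (Bialgebra.counitAlgHom k H) (fun _ _ => Commute.all _ _)

theorem legsCommute_envCounit :
    LegsCommute ((Algebra.ofId k (H ⊗[k] H)).comp (envCounit k H)) (AlgHom.id k (H ⊗[k] H)) :=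
  fun x y => Algebra.commute_algebraMap_left (envCounit k H x) y

variable (k H) in
/-- The counit applied to the first of two factors `H ⊗ H`. -/
noncomputable def counitFst : (H ⊗[k] H) ⊗[k] (H ⊗[k] H) →ₐ[k] H ⊗[k] H :=
  lift ((Algebra.ofId k (H ⊗[k] H)).comp (envCounit k H)) (AlgHom.id k (H ⊗[k] H))
    legsCommute_envCounit

variable (k H) in
/-- The counit applied to the second of two factors `H ⊗ H`. -/
noncomputable def counitSnd : (H ⊗[k] H) ⊗[k] (H ⊗[k] H) →ₐ[k] H ⊗[k] H :=
  lift (AlgHom.id k (H ⊗[k] H)) ((Algebra.ofId k (H ⊗[k] H)).comp (envCounit k H))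
    legsCommute_envCounit.symm

theorem counit_comp_includeLeft :
    ((Algebra.ofId k (H ⊗[k] H)).comp (envCounit k H)).comp includeLeft =
      trivialLeg k H (H ⊗[k] H) := by
  ext x
  simp [envCounit, trivialLeg_apply, Algebra.ofId_apply]

theorem counit_comp_includeRight :
    ((Algebra.ofId k (H ⊗[k] H)).comp (envCounit k H)).comp includeRight =
      trivialLeg k H (H ⊗[k] H) := by
  ext x
  simp [envCounit, trivialLeg_apply, Algebra.ofId_apply]

theorem conjBy_one {A : Type*} [Ring A] [Algebra k A] : conjBy k (1 : Aˣ) = AlgHom.id k A := by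
  ext x
  simp

namespace UniversalRMatrix

variable (𝓡 : UniversalRMatrix k H)

theorem counitFst_twist : counitFst k H 𝓡.twist = 1 := by
  rw [map_twist, counitFst, lift_comp_leg₁, counit_comp_includeLeft]
  simp [legUnit_trivialLeg_left]

theorem counitSnd_twist : counitSnd k H 𝓡.twist = 1 := by
  rw [map_twist, counitSnd, lift_comp_leg₃, lift_comp_leg₄, counit_comp_includeLeft,
    counit_comp_includeRight]
  simp [legUnit_trivialLeg_right]

theorem counitFst_crossing : counitFst k H 𝓡.crossing = 1 := by
  rw [map_crossing, counitFst, lift_comp_leg₁, lift_comp_leg₂, counit_comp_includeLeft,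
    counit_comp_includeRight]
  simp [legUnit_trivialLeg_right, legUnit_trivialLeg_left]

theorem counitSnd_crossing : counitSnd k H 𝓡.crossing = 1 := by
  rw [map_crossing, counitSnd, lift_comp_leg₃, lift_comp_leg₄, counit_comp_includeLeft,
    counit_comp_includeRight]
  simp [legUnit_trivialLeg_right, legUnit_trivialLeg_left]

theorem counitFst_comp_comulBraidedHom :
    (counitFst k H).comp 𝓡.comulBraidedHom = AlgHom.id k (H ⊗[k] H) := by
  have h1 := 𝓡.comp_comulBraidedHom_comp_includeLeft (counitFst k H)
  have h2 := 𝓡.comp_comulBraidedHom_comp_includeRight (counitFst k H)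
  rw [counitFst, lift_comp_leg₁, lift_comp_leg₂, lift_comp_leg₃, counit_comp_includeLeft,
    counit_comp_includeRight, legUnit_trivialLeg_right, conjBy_one,
    comulLegs_trivialLeg_right] at h1
  rw [counitFst, lift_comp_leg₂, lift_comp_leg₃, lift_comp_leg₄,
    counit_comp_includeRight, legUnit_trivialLeg_right, conjBy_one,
    comulLegs_trivialLeg_right] at h2
  exact Algebra.TensorProduct.ext h1 h2

end UniversalRMatrix

variable {ρ : H ⊗[k] H →ₐ[k] Module.End k V} {e : V}

theorem actTwo_counitFst (he : ∀ h, ρ h e = envCounit k H h • e)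
    (X : (H ⊗[k] H) ⊗[k] (H ⊗[k] H)) (v : V) :
    actTwo ρ X (e ⊗ₜ v) = e ⊗ₜ ρ (counitFst k H X) v := by
  induction X using TensorProduct.induction_on with
  | zero => simp
  | add X X' h h' => simp only [map_add, TensorProduct.tmul_add, LinearMap.add_apply, h, h']
  | tmul x y =>
    have h : counitFst k H (x ⊗ₜ y) = envCounit k H x • y := by
      rw [counitFst, lift_tmul, AlgHom.comp_apply, Algebra.ofId_apply, Algebra.smul_def]
      rfl
    simp [h, he, TensorProduct.smul_tmul']

theorem actTwo_counitSnd (he : ∀ h, ρ h e = envCounit k H h • e)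
    (X : (H ⊗[k] H) ⊗[k] (H ⊗[k] H)) (v : V) :
    actTwo ρ X (v ⊗ₜ e) = ρ (counitSnd k H X) v ⊗ₜ e := by
  induction X using TensorProduct.induction_on with
  | zero => simp
  | add X X' h h' => simp only [map_add, TensorProduct.add_tmul, LinearMap.add_apply, h, h']
  | tmul x y =>
    have h : counitSnd k H (x ⊗ₜ y) = envCounit k H y • x := by
      rw [counitSnd, lift_tmul, AlgHom.comp_apply, Algebra.ofId_apply, Algebra.smul_def,
        Algebra.commutes]
      rfl
    simp [h, he, TensorProduct.smul_tmul']

end Counit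

/-! ### The braided dual and the elliptic double -/

section Algebras

variable {k H : Type*} [Field k] [Ring H] [HopfAlgebra k H]

open Algebra.TensorProduct

namespace UniversalRMatrix

variable (𝓡 : UniversalRMatrix k H)

/-- The unit of the braided dual is invariant: `H ⊗ H` acts on it by the counit. -/
theorem actHom_one (h : H ⊗[k] H) :
    𝓡.actHom h (1 : 𝓡.BraidedDual) = envCounit k H h • (1 : 𝓡.BraidedDual) := by
  induction h using TensorProduct.induction_on with
  | zero => simp
  | add X X' h h' => simp only [map_add, add_smul, LinearMap.add_apply, h, h']
  | tmul x y =>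
    apply BraidedDual.ext
    intro u
    rw [toDual_actHom, map_smul, LinearMap.smul_apply, toDual_one, toDual_one]
    simp [envCounit, 𝓡.counit_antipodeInv]
    ring

theorem lift_mulB (t : 𝓡.BraidedDual ⊗[k] 𝓡.BraidedDual) : TensorProduct.lift 𝓡.mulB t =
    TensorProduct.lift 𝓡.convMulB (actTwo 𝓡.actHom 𝓡.twist (TensorProduct.comm k _ _ t)) := by
  induction t using TensorProduct.induction_on with
  | zero => simp
  | add X X' h h' => simp only [map_add, h, h']
  | tmul f g => rfl

theorem one_mulB (f : 𝓡.BraidedDual) : 𝓡.mulB 1 f = f := by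
  rw [mulB_eq, actTwo_counitSnd 𝓡.actHom_one, counitSnd_twist, map_one]
  exact 𝓡.convMulB_one f

theorem mulB_one (f : 𝓡.BraidedDual) : 𝓡.mulB f 1 = f := by
  rw [mulB_eq, actTwo_counitFst 𝓡.actHom_one, counitFst_twist, map_one]
  exact 𝓡.one_convMulB f

/-- Associativity follows from the cocycle property of the twist. -/
theorem mulB_assoc (f g h : 𝓡.BraidedDual) :
    𝓡.mulB (𝓡.mulB f g) h = 𝓡.mulB f (𝓡.mulB g h) := by
  let C := TensorProduct.lift 𝓡.convMulB
  have hC : ∀ t, C (TensorProduct.map LinearMap.id C t) =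
      C (TensorProduct.map C LinearMap.id ((TensorProduct.assoc k _ _ _).symm t)) := by
    refine LinearMap.congr_fun (f := C ∘ₗ TensorProduct.map LinearMap.id C)
      (g := C ∘ₗ TensorProduct.map C LinearMap.id ∘ₗ
        (TensorProduct.assoc k _ _ _).symm.toLinearMap) ?_
    refine TensorProduct.ext_threefold' fun u v w => ?_
    simp [C, convMulB_assoc]
  have hc := twist_cocycle 𝓡 (commute_actFst_actSnd 𝓡.actHom) (commute_actFst_actThd 𝓡.actHom)
    (commute_actSnd_actThd 𝓡.actHom)
  have hc' := LinearMap.congr_fun hc (h ⊗ₜ (g ⊗ₜ f))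
  rw [Module.End.mul_apply, Module.End.mul_apply, actSndThd_apply,
    ← TensorProduct.assoc_tmul, actFstSnd_apply] at hc'
  rw [𝓡.mulB_eq _ h, 𝓡.mulB_eq f g, 𝓡.mulB_eq f, 𝓡.mulB_eq g h,
    actTwo_tmul_mul 𝓡.actHom_convMulB, actTwo_mul_tmul 𝓡.actHom_convMulB]
  change C (TensorProduct.map LinearMap.id C _) = C (TensorProduct.map C LinearMap.id _)
  rw [hC, hc']

theorem actTwo_comm (X : (H ⊗[k] H) ⊗[k] (H ⊗[k] H)) (t : 𝓡.BraidedDual ⊗[k] 𝓡.BraidedDual) :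
    TensorProduct.comm k _ _ (actTwo 𝓡.actHom (Algebra.TensorProduct.comm k _ _ X) t) =
      actTwo 𝓡.actHom X (TensorProduct.comm k _ _ t) := by
  induction X using TensorProduct.induction_on with
  | zero => simp
  | add X X' h h' => simp only [map_add, LinearMap.add_apply, h, h']
  | tmul x y =>
    induction t using TensorProduct.induction_on with
    | zero => simp
    | add X X' h h' => simp only [map_add, h, h']
    | tmul f g => simp

/-- The braided dual is a module algebra over `H^[2]`. -/
theorem actHom_mulB (h : H ⊗[k] H) (t : 𝓡.BraidedDual ⊗[k] 𝓡.BraidedDual) :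
    𝓡.actHom h (TensorProduct.lift 𝓡.mulB t) =
      TensorProduct.lift 𝓡.mulB (actTwo 𝓡.actHom (𝓡.comulBraidedHom h) t) := by
  rw [lift_mulB, lift_mulB, actHom_convMulB, ← actTwo_mul]
  change _ = TensorProduct.lift 𝓡.convMulB (actTwo 𝓡.actHom 𝓡.twist (TensorProduct.comm k _ _
    (actTwo 𝓡.actHom (Algebra.TensorProduct.comm k _ _
      (conjBy k 𝓡.twistUnit (comulEnvHom k H h))) t)))
  rw [actTwo_comm, ← actTwo_mul, conjBy_apply, ← coe_twistUnit, mul_assoc,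
    Units.mul_inv_cancel_left]

/-- The exchange map of the elliptic double, `g ⊗ f ↦ T ▷ (f ⊗ g)`. -/
noncomputable def ellipticExchange :
    𝓡.BraidedDual →ₗ[k] 𝓡.BraidedDual →ₗ[k] 𝓡.BraidedDual ⊗[k] 𝓡.BraidedDual :=
  (TensorProduct.mk k 𝓡.BraidedDual 𝓡.BraidedDual).flip.compr₂ (actTwo 𝓡.actHom 𝓡.crossing)

theorem ellipticExchange_apply (f g : 𝓡.BraidedDual) :
    𝓡.ellipticExchange g f = actTwo 𝓡.actHom 𝓡.crossing (f ⊗ₜ g) := rfl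

theorem ellipticMul_tmul (f g f' g' : 𝓡.BraidedDual) :
    𝓡.ellipticMul (f ⊗ₜ g) (f' ⊗ₜ g') =
      TensorProduct.map (𝓡.mulB f) (𝓡.mulB.flip g') (𝓡.ellipticExchange g f') := rfl

theorem one_ellipticExchange (f : 𝓡.BraidedDual) : 𝓡.ellipticExchange 1 f = f ⊗ₜ 1 := by
  rw [ellipticExchange_apply, actTwo_counitSnd 𝓡.actHom_one, counitSnd_crossing, map_one]
  rfl

theorem ellipticExchange_one (g : 𝓡.BraidedDual) : 𝓡.ellipticExchange g 1 = 1 ⊗ₜ g := by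
  rw [ellipticExchange_apply, actTwo_counitFst 𝓡.actHom_one, counitFst_crossing, map_one]
  rfl

theorem ellipticExchange_mul_left (g f f' : 𝓡.BraidedDual) :
    𝓡.ellipticExchange g (𝓡.mulB f f') =
      𝓡.ellipticMul (𝓡.ellipticExchange g f) (f' ⊗ₜ 1) := by
  have hc := LinearMap.congr_fun (crossing_comulBraided_left 𝓡 (commute_actFst_actSnd 𝓡.actHom)
    (commute_actFst_actThd 𝓡.actHom) (commute_actSnd_actThd 𝓡.actHom)) (f ⊗ₜ (f' ⊗ₜ g))
  have h1 : f ⊗ₜ (f' ⊗ₜ g) = TensorProduct.map LinearMap.id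
    (TensorProduct.mk k 𝓡.BraidedDual 𝓡.BraidedDual f') (f ⊗ₜ[k] g) := rfl
  rw [Module.End.mul_apply, h1, actFstThd_apply, ← h1] at hc
  rw [ellipticExchange_apply, ellipticExchange_apply,
    ← TensorProduct.lift.tmul (f' := 𝓡.mulB), actTwo_mul_tmul 𝓡.actHom_mulB,
    TensorProduct.assoc_tmul, hc]
  induction actTwo 𝓡.actHom 𝓡.crossing (f ⊗ₜ g) using TensorProduct.induction_on with
  | zero => simp
  | add X X' h h' => simp only [map_add, LinearMap.add_apply, h, h']
  | tmul p q =>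
    rw [ellipticMul_tmul, TensorProduct.map_tmul, LinearMap.id_apply, TensorProduct.mk_apply,
      actSndThd_apply, ellipticExchange_apply]
    induction actTwo 𝓡.actHom 𝓡.crossing (f' ⊗ₜ q) using TensorProduct.induction_on with
    | zero => simp
    | add X X' h h' => simp only [map_add, TensorProduct.tmul_add, h, h']
    | tmul r s => simp [mulB_one]

theorem ellipticExchange_mul_right (g g' f : 𝓡.BraidedDual) :
    𝓡.ellipticExchange (𝓡.mulB g g') f =
      𝓡.ellipticMul (1 ⊗ₜ g) (𝓡.ellipticExchange g' f) := by
  have hc := LinearMap.congr_fun (crossing_comulBraided_right 𝓡 (commute_actFst_actSnd 𝓡.actHom)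
    (commute_actFst_actThd 𝓡.actHom) (commute_actSnd_actThd 𝓡.actHom)) (f ⊗ₜ (g ⊗ₜ g'))
  have h1 : f ⊗ₜ (g ⊗ₜ g') = TensorProduct.map LinearMap.id
    (TensorProduct.mk k 𝓡.BraidedDual 𝓡.BraidedDual g) (f ⊗ₜ[k] g') := rfl
  rw [Module.End.mul_apply, h1, actFstThd_apply, ← h1] at hc
  rw [ellipticExchange_apply, ellipticExchange_apply,
    ← TensorProduct.lift.tmul (f' := 𝓡.mulB), actTwo_tmul_mul 𝓡.actHom_mulB, hc]
  induction actTwo 𝓡.actHom 𝓡.crossing (f ⊗ₜ g') using TensorProduct.induction_on with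
  | zero => simp
  | add X X' h h' => simp only [map_add, h, h']
  | tmul p q =>
    rw [ellipticMul_tmul, TensorProduct.map_tmul, LinearMap.id_apply, TensorProduct.mk_apply,
      ← TensorProduct.assoc_tmul, actFstSnd_apply, ellipticExchange_apply]
    induction actTwo 𝓡.actHom 𝓡.crossing (p ⊗ₜ g) using TensorProduct.induction_on with
    | zero => simp
    | add X X' h h' => simp only [map_add, TensorProduct.add_tmul, h, h']
    | tmul r s => simp [one_mulB]

theorem isAssociativeUnital_braidedDual : IsAssociativeUnital 𝓡.BraidedDual :=
  ⟨𝓡.mulB_assoc, fun f => ⟨𝓡.one_mulB f, 𝓡.mulB_one f⟩⟩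

theorem isAssociativeUnital_ellipticDouble : IsAssociativeUnital 𝓡.EllipticDouble :=
  ⟨twistedTensorProduct_assoc 𝓡.mulB_assoc 𝓡.mulB_assoc 𝓡.one_mulB 𝓡.mulB_one
      𝓡.ellipticMul_tmul 𝓡.ellipticExchange_mul_left 𝓡.ellipticExchange_mul_right,
    fun x => ⟨twistedTensorProduct_one_mul 𝓡.one_mulB 𝓡.ellipticMul_tmul 𝓡.one_mulB
      𝓡.one_ellipticExchange x, twistedTensorProduct_mul_one 𝓡.mulB_one 𝓡.ellipticMul_tmul
      𝓡.mulB_one 𝓡.ellipticExchange_one x⟩⟩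

end UniversalRMatrix

end Algebras

/-! ### The semi-direct product -/

section Semidirect

variable {k H : Type*} [Field k] [Ring H] [HopfAlgebra k H]

open Algebra.TensorProduct

namespace UniversalRMatrix

variable (𝓡 : UniversalRMatrix k H)

/-- The linear map `x ⊗ y ↦ (x ▷ f) ⊗ y`. -/
noncomputable def actOn (f : 𝓡.BraidedDual) :
    (H ⊗[k] H) ⊗[k] (H ⊗[k] H) →ₗ[k] 𝓡.BraidedDual ⊗[k] (H ⊗[k] H) :=
  TensorProduct.map (𝓡.actB.flip f) LinearMap.id

@[simp]
theorem actOn_tmul (f : 𝓡.BraidedDual) (x y : H ⊗[k] H) :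
    𝓡.actOn f (x ⊗ₜ y) = 𝓡.actHom x f ⊗ₜ y := rfl

/-- The exchange map of the semi-direct product, `h ⊗ f ↦ (h₁ ▷ f) ⊗ h₂`. -/
noncomputable def semidirectExchange :
    H ⊗[k] H →ₗ[k] 𝓡.BraidedDual →ₗ[k] 𝓡.BraidedDual ⊗[k] (H ⊗[k] H) :=
  LinearMap.mk₂ k (fun h f => 𝓡.actOn f (𝓡.comulBraided h))
    (fun _ _ _ => by simp only [map_add])
    (fun _ _ _ => by simp only [map_smul])
    (fun _ _ _ => by
      simp only [actOn, map_add, TensorProduct.map_add_left, LinearMap.add_apply])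
    (fun _ _ _ => by
      simp only [actOn, map_smul, TensorProduct.map_smul_left, LinearMap.smul_apply])

theorem semidirectExchange_apply (h : H ⊗[k] H) (f : 𝓡.BraidedDual) :
    𝓡.semidirectExchange h f = 𝓡.actOn f (𝓡.comulBraidedHom h) := by
  rw [comulBraidedHom_apply]
  rfl

theorem semidirectMul_tmul (f : 𝓡.BraidedDual) (h : H ⊗[k] H) (f' : 𝓡.BraidedDual)
    (h' : H ⊗[k] H) : 𝓡.semidirectMul (f ⊗ₜ h) (f' ⊗ₜ h') =
      TensorProduct.map (𝓡.mulB f) ((LinearMap.mul k (H ⊗[k] H)).flip h')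
        (𝓡.semidirectExchange h f') := by
  change TensorProduct.map (𝓡.mulB f ∘ₗ 𝓡.actB.flip f')
        ((LinearMap.mul k (H ⊗[k] H)).flip h') (𝓡.comulBraided h) =
    TensorProduct.map (𝓡.mulB f) ((LinearMap.mul k (H ⊗[k] H)).flip h')
      (TensorProduct.map (𝓡.actB.flip f') LinearMap.id (𝓡.comulBraided h))
  rw [← LinearMap.comp_apply (TensorProduct.map _ _) (TensorProduct.map _ _),
    ← TensorProduct.map_comp, LinearMap.comp_id]

theorem one_semidirectExchange (f : 𝓡.BraidedDual) :
    𝓡.semidirectExchange 1 f = f ⊗ₜ (1 : H ⊗[k] H) := by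
  rw [semidirectExchange_apply, map_one, one_def, actOn_tmul, map_one]
  rfl

theorem actOn_one (X : (H ⊗[k] H) ⊗[k] (H ⊗[k] H)) :
    𝓡.actOn 1 X = 1 ⊗ₜ counitFst k H X := by
  induction X using TensorProduct.induction_on with
  | zero => simp
  | add X X' h h' => simp only [map_add, TensorProduct.tmul_add, h, h']
  | tmul x y =>
    have h : counitFst k H (x ⊗ₜ y) = envCounit k H x • y := by
      rw [counitFst, lift_tmul, AlgHom.comp_apply, Algebra.ofId_apply, Algebra.smul_def]
      rfl
    rw [actOn_tmul, h, actHom_one, TensorProduct.smul_tmul]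

theorem semidirectExchange_one (h : H ⊗[k] H) :
    𝓡.semidirectExchange h 1 = 1 ⊗ₜ h := by
  rw [semidirectExchange_apply, actOn_one]
  exact congrArg _ (AlgHom.congr_fun 𝓡.counitFst_comp_comulBraidedHom h)

/-- Compatibility with the product of the braided dual holds because the braided dual is a module
algebra over `H^[2]` and the coproduct of `H^[2]` is coassociative. -/
theorem semidirectExchange_mul_left (h : H ⊗[k] H) (f f' : 𝓡.BraidedDual) :
    𝓡.semidirectExchange h (𝓡.mulB f f') =
      𝓡.semidirectMul (𝓡.semidirectExchange h f) (f' ⊗ₜ 1) := by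
  let P₁ : H ⊗[k] H →ₐ[k] (H ⊗[k] H) ⊗[k] ((H ⊗[k] H) ⊗[k] (H ⊗[k] H)) := includeLeft
  let P₂ : H ⊗[k] H →ₐ[k] (H ⊗[k] H) ⊗[k] ((H ⊗[k] H) ⊗[k] (H ⊗[k] H)) :=
    includeRight.comp includeLeft
  let P₃ : H ⊗[k] H →ₐ[k] (H ⊗[k] H) ⊗[k] ((H ⊗[k] H) ⊗[k] (H ⊗[k] H)) :=
    includeRight.comp includeRight
  have h₁₂ : LegsCommute (k := k) (B := H ⊗[k] H) (C := H ⊗[k] H)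
      (A := (H ⊗[k] H) ⊗[k] ((H ⊗[k] H) ⊗[k] (H ⊗[k] H))) P₁ P₂ :=
    legsCommute_includeLeft_includeRight.comp_right _
  have h₁₃ : LegsCommute (k := k) (B := H ⊗[k] H) (C := H ⊗[k] H)
      (A := (H ⊗[k] H) ⊗[k] ((H ⊗[k] H) ⊗[k] (H ⊗[k] H))) P₁ P₃ :=
    legsCommute_includeLeft_includeRight.comp_right _
  have h₂₃ : LegsCommute (k := k) (B := H ⊗[k] H) (C := H ⊗[k] H)
      (A := (H ⊗[k] H) ⊗[k] ((H ⊗[k] H) ⊗[k] (H ⊗[k] H))) P₂ P₃ :=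
    legsCommute_includeLeft_includeRight.map _
  -- both sides are the image under `Ω` of an iterated coproduct of `h`
  let Ω : (H ⊗[k] H) ⊗[k] ((H ⊗[k] H) ⊗[k] (H ⊗[k] H)) →ₗ[k]
      𝓡.BraidedDual ⊗[k] (H ⊗[k] H) :=
    TensorProduct.map (TensorProduct.lift 𝓡.mulB ∘ₗ
      TensorProduct.map (𝓡.actB.flip f) (𝓡.actB.flip f')) LinearMap.id ∘ₗ
      (TensorProduct.assoc k _ _ _).symm.toLinearMap
  have hΩ : ∀ a b c : H ⊗[k] H, Ω (a ⊗ₜ (b ⊗ₜ c)) = 𝓡.mulB (𝓡.actHom a f) (𝓡.actHom b f') ⊗ₜ c :=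
    fun a b c => rfl
  have h1 : ∀ X, 𝓡.actOn (𝓡.mulB f f') X = Ω (lift ((lift P₁ P₂ h₁₂).comp 𝓡.comulBraidedHom) P₃
      ((h₁₂.lift_left h₁₃ h₂₃).comp_left _) X) := by
    intro X
    induction X using TensorProduct.induction_on with
    | zero => simp
    | add X X' h h' => simp only [map_add, h, h']
    | tmul x y =>
      rw [actOn_tmul, ← TensorProduct.lift.tmul (f' := 𝓡.mulB), actHom_mulB, lift_tmul,
        AlgHom.comp_apply]
      induction 𝓡.comulBraidedHom x using TensorProduct.induction_on with
      | zero =>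
        simp only [map_zero, LinearMap.zero_apply, TensorProduct.zero_tmul]
        exact ((congrArg Ω (zero_mul (P₃ y))).trans (map_zero Ω)).symm
      | add X X' h h' =>
        simp only [map_add, LinearMap.add_apply, TensorProduct.add_tmul, add_mul, h, h']
      | tmul a b => simp [P₁, P₂, P₃, hΩ]
  have h2 : ∀ X, 𝓡.semidirectMul (𝓡.actOn f X) (f' ⊗ₜ 1) =
      Ω (lift P₁ ((lift P₂ P₃ h₂₃).comp 𝓡.comulBraidedHom)
        ((h₂₃.lift_right h₁₂ h₁₃).comp_right _) X) := by
    intro X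
    induction X using TensorProduct.induction_on with
    | zero => simp
    | add X X' h h' => simp only [map_add, LinearMap.add_apply, h, h']
    | tmul x y =>
      rw [actOn_tmul, semidirectMul_tmul, semidirectExchange_apply, lift_tmul, AlgHom.comp_apply]
      induction 𝓡.comulBraidedHom y using TensorProduct.induction_on with
      | zero =>
        simp only [map_zero]
        exact ((congrArg Ω (mul_zero (P₁ x))).trans (map_zero Ω)).symm
      | add X X' h h' => simp only [map_add, mul_add, h, h']
      | tmul a b => simp [P₁, P₂, P₃, hΩ]
  have h3 := AlgHom.congr_fun (comulBraided_coassoc 𝓡 h₁₂ h₁₃ h₂₃) h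
  rw [semidirectExchange_apply, semidirectExchange_apply, h1, h2]
  exact congrArg Ω h3

theorem semidirectExchange_mul_right (h h' : H ⊗[k] H) (f : 𝓡.BraidedDual) :
    𝓡.semidirectExchange (LinearMap.mul k (H ⊗[k] H) h h') f =
      𝓡.semidirectMul (1 ⊗ₜ h) (𝓡.semidirectExchange h' f) := by
  rw [LinearMap.mul_apply', semidirectExchange_apply, semidirectExchange_apply, map_mul]
  induction 𝓡.comulBraidedHom h' using TensorProduct.induction_on with
  | zero => simp
  | add X X' h h' => simp only [map_add, mul_add, h, h']
  | tmul c d =>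
    rw [actOn_tmul, semidirectMul_tmul, semidirectExchange_apply]
    induction 𝓡.comulBraidedHom h using TensorProduct.induction_on with
    | zero => simp
    | add X X' h h' => simp only [map_add, add_mul, h, h']
    | tmul a b => simp [one_mulB]

theorem isAssociativeUnital_semidirectProduct : IsAssociativeUnital 𝓡.SemidirectProduct :=
  ⟨twistedTensorProduct_assoc 𝓡.mulB_assoc (fun a b c => mul_assoc a b c) 𝓡.one_mulB
      (fun c => mul_one c) 𝓡.semidirectMul_tmul 𝓡.semidirectExchange_mul_left
      𝓡.semidirectExchange_mul_right,
    fun x => ⟨twistedTensorProduct_one_mul 𝓡.one_mulB 𝓡.semidirectMul_tmul (fun c => one_mul c)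
      𝓡.one_semidirectExchange x, twistedTensorProduct_mul_one 𝓡.mulB_one 𝓡.semidirectMul_tmul
      (fun c => mul_one c) 𝓡.semidirectExchange_one x⟩⟩

end UniversalRMatrix

end Semidirect

/-! ### Transposed actions -/

section Sandwich

variable {k H A : Type*} [Field k] [Ring H] [HopfAlgebra k H] [Ring A] [Algebra k A]

open Algebra.TensorProduct MulOpposite

namespace UniversalRMatrix

variable (𝓡 : UniversalRMatrix k H)

/-- Left multiplication by `e (S⁻¹ x)`, as an algebra map to the opposite of the endomorphisms; the
opposite appears because these operators are transposes of a left action on functionals. -/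
noncomputable def mulLeftLeg (e : H →ₐ[k] A) : H →ₐ[k] (Module.End k A)ᵐᵒᵖ :=
  AlgHom.ofLinearMap ((opLinearEquiv k).toLinearMap ∘ₗ LinearMap.mul k A ∘ₗ e.toLinearMap ∘ₗ
      antipodeInv k H)
    (by
      apply unop_injective
      refine LinearMap.ext fun a => ?_
      simp [𝓡.antipodeInv_one])
    (fun x y => by
      apply unop_injective
      refine LinearMap.ext fun a => ?_
      simp [𝓡.antipodeInv_mul, mul_assoc])

/-- Right multiplication by `e x`, as an algebra map to the opposite of the endomorphisms. -/
noncomputable def mulRightLeg (e : H →ₐ[k] A) : H →ₐ[k] (Module.End k A)ᵐᵒᵖ :=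
  AlgHom.ofLinearMap ((opLinearEquiv k).toLinearMap ∘ₗ (LinearMap.mul k A).flip ∘ₗ e.toLinearMap)
    (by
      apply unop_injective
      refine LinearMap.ext fun a => ?_
      simp)
    (fun x y => by
      apply unop_injective
      refine LinearMap.ext fun a => ?_
      simp [mul_assoc])

@[simp]
theorem unop_mulLeftLeg (e : H →ₐ[k] A) (x : H) (a : A) :
    unop (𝓡.mulLeftLeg e x) a = e (antipodeInv k H x) * a := rfl

@[simp]
theorem unop_mulRightLeg (e : H →ₐ[k] A) (x : H) (a : A) :
    unop (mulRightLeg e x) a = a * e x := rfl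

theorem commute_mulLeftLeg_mulRightLeg (e e' : H →ₐ[k] A) :
    LegsCommute (𝓡.mulLeftLeg e) (mulRightLeg e') := by
  intro x y
  apply unop_injective
  refine LinearMap.ext fun a => ?_
  simp [mul_assoc]

theorem commute_mulLeftLeg {e e' : H →ₐ[k] A} (h : LegsCommute e e') :
    LegsCommute (𝓡.mulLeftLeg e) (𝓡.mulLeftLeg e') := by
  intro x y
  apply unop_injective
  refine LinearMap.ext fun a => ?_
  simp [← mul_assoc, (h (antipodeInv k H x) (antipodeInv k H y)).eq]

theorem commute_mulRightLeg {e e' : H →ₐ[k] A} (h : LegsCommute e e') :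
    LegsCommute (mulRightLeg e) (mulRightLeg e') := by
  intro x y
  apply unop_injective
  refine LinearMap.ext fun a => ?_
  simp [mul_assoc, (h x y).eq]

theorem unop_onLegs_left_right {e e' : H →ₐ[k] A} {a b : A} (ha : ∀ x, Commute a (e x))
    (hb : ∀ x, Commute b (e' x)) (X : H ⊗[k] H) :
    unop (onLegs (𝓡.mulLeftLeg e) (mulRightLeg e') X) (a * b) =
      a * onLegs e e' ((antipodeInv k H).rTensor H X) * b := by
  induction X using TensorProduct.induction_on with
  | zero => simp
  | add X X' h h' => simp only [map_add, unop_add, LinearMap.add_apply, mul_add, add_mul, h, h']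
  | tmul x y =>
    simp only [onLegs_tmul, unop_mul, Module.End.mul_apply, unop_mulLeftLeg, unop_mulRightLeg,
      LinearMap.rTensor_tmul]
    rw [mul_assoc, mul_assoc, (hb y).eq, ← mul_assoc, ← (ha _).eq]
    simp only [mul_assoc]

theorem unop_onLegs_right_right (e e' : H →ₐ[k] A) (a : A) (X : H ⊗[k] H) :
    unop (onLegs (mulRightLeg e) (mulRightLeg e') X) a = a * onLegs e e' X := by
  induction X using TensorProduct.induction_on with
  | zero => simp
  | add X X' h h' => simp only [map_add, unop_add, LinearMap.add_apply, mul_add, h, h']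
  | tmul x y => simp [mul_assoc]

theorem unop_onLegs_left_left {e e' : H →ₐ[k] A} (he : LegsCommute e e') (a : A)
    (X : H ⊗[k] H) : unop (onLegs (𝓡.mulLeftLeg e) (𝓡.mulLeftLeg e') X) a =
      onLegs e e' (TensorProduct.map (antipodeInv k H) (antipodeInv k H) X) * a := by
  induction X using TensorProduct.induction_on with
  | zero => simp
  | add X X' h h' => simp only [map_add, unop_add, LinearMap.add_apply, add_mul, h, h']
  | tmul x y => simp [← mul_assoc, (he (antipodeInv k H x) (antipodeInv k H y)).eq]

/-- For commuting `e`, `e'`, the operators `(x ⊗ y) ⊗ (z ⊗ w)` that send `a` to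
`e (S⁻¹ x) * e' (S⁻¹ z) * a * e y * e' w`. If `e`, `e'` are the inclusions of two tensor legs, this
is the transpose of the action of `H^e ⊗ H^e` on pairs of functionals that are evaluated on these
legs. -/
noncomputable def sandwich {e e' : H →ₐ[k] A} (h : LegsCommute e e') :
    (H ⊗[k] H) ⊗[k] (H ⊗[k] H) →ₐ[k] (Module.End k A)ᵐᵒᵖ :=
  lift (lift (𝓡.mulLeftLeg e) (mulRightLeg e) (𝓡.commute_mulLeftLeg_mulRightLeg _ _))
    (lift (𝓡.mulLeftLeg e') (mulRightLeg e') (𝓡.commute_mulLeftLeg_mulRightLeg _ _))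
    (LegsCommute.lift_left _
      (LegsCommute.lift_right _ (𝓡.commute_mulLeftLeg h)
        (𝓡.commute_mulLeftLeg_mulRightLeg _ _))
      (LegsCommute.lift_right _ (𝓡.commute_mulLeftLeg_mulRightLeg _ _).symm
        (commute_mulRightLeg h)))

/-- For commuting `i`, `j`, `e`, the operators `(x ⊗ y) ⊗ (z ⊗ w)` that send `a` to
`e (S⁻¹ z) * a * i x * j y * e w`: the transpose of the action of `H^e ⊗ H^e` on an element of a
left module, on which the legs `i`, `j` act, and a functional, evaluated on the leg `e`. -/
noncomputable def mixedSandwich {i j e : H →ₐ[k] A} (hij : LegsCommute i j)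
    (hi : LegsCommute i e) (hj : LegsCommute j e) :
    (H ⊗[k] H) ⊗[k] (H ⊗[k] H) →ₐ[k] (Module.End k A)ᵐᵒᵖ :=
  lift (lift (mulRightLeg i) (mulRightLeg j) (commute_mulRightLeg hij))
    (lift (𝓡.mulLeftLeg e) (mulRightLeg e) (𝓡.commute_mulLeftLeg_mulRightLeg _ _))
    (LegsCommute.lift_left _
      (LegsCommute.lift_right _ (𝓡.commute_mulLeftLeg_mulRightLeg _ _).symm
        (commute_mulRightLeg hi))
      (LegsCommute.lift_right _ (𝓡.commute_mulLeftLeg_mulRightLeg _ _).symm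
        (commute_mulRightLeg hj)))

end UniversalRMatrix

end Sandwich

/-! ### The double braiding and the factorization map -/

section Factorization

variable {k H : Type*} [Field k] [Ring H] [HopfAlgebra k H]

open Algebra.TensorProduct MulOpposite

namespace UniversalRMatrix

variable (𝓡 : UniversalRMatrix k H)

theorem onLegs_doubleBraiding {A : Type*} [Ring A] [Algebra k A] {i j : H →ₐ[k] A}
    (h : LegsCommute i j) :
    onLegs i j 𝓡.doubleBraiding = ↑(𝓡.legUnit j i * 𝓡.legUnit i j) := by
  rw [doubleBraiding, onLegs_mul h, onLegs_comm h, Units.val_mul, coe_legUnit h,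
    coe_legUnit h.symm]

theorem factorizationMap_eq (f : 𝓡.BraidedDual) : 𝓡.factorizationMap f =
    TensorProduct.rid k H (LinearMap.lTensor H (𝓡.toDual f) 𝓡.doubleBraiding) := rfl

theorem factorizationMap_one : 𝓡.factorizationMap 1 = 1 := by
  have h : ∀ X : H ⊗[k] H, TensorProduct.rid k H (LinearMap.lTensor H (𝓡.toDual 1) X) =
      onLegs (AlgHom.id k H) (trivialLeg k H H) X := by
    intro X
    induction X using TensorProduct.induction_on with
    | zero => simp
    | add X X' h h' => simp only [map_add, h, h']
    | tmul x y =>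
      simp [toDual_one, trivialLeg_apply, Algebra.algebraMap_eq_smul_one]
  rw [factorizationMap_eq, h, onLegs_doubleBraiding _ (legsCommute_trivialLeg_right _),
    legUnit_trivialLeg_left, legUnit_trivialLeg_right]
  simp

/-- The pairing `x ⊗ (y ⊗ z) ↦ f(y) g(z) x`, as a function of `f ⊗ g`. -/
noncomputable def pairTwo : 𝓡.BraidedDual ⊗[k] 𝓡.BraidedDual →ₗ[k]
    H ⊗[k] (H ⊗[k] H) →ₗ[k] H :=
  LinearMap.llcomp k (H ⊗[k] (H ⊗[k] H)) (H ⊗[k] k) H (TensorProduct.rid k H).toLinearMap ∘ₗ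
    LinearMap.lTensorHom H ∘ₗ TensorProduct.dualDistrib k H H ∘ₗ
      TensorProduct.map 𝓡.toDual 𝓡.toDual

theorem pairTwo_tmul (f g : 𝓡.BraidedDual) (x y z : H) :
    𝓡.pairTwo (f ⊗ₜ g) (x ⊗ₜ (y ⊗ₜ z)) = (𝓡.toDual f y * 𝓡.toDual g z) • x := rfl

end UniversalRMatrix

end Factorization

/-! ### The double braiding under the twist and the crossing -/

section SandwichedDoubleBraiding

variable {k H A : Type*} [Field k] [Ring H] [HopfAlgebra k H] [Ring A] [Algebra k A]

open Algebra.TensorProduct MulOpposite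

/-- The identity of words behind `UniversalRMatrix.unop_sandwich_twist`. The letters are the values
of the R-matrix on pairs of the legs `i`, `m`, `l`; `h` holds because the double braiding of `i` and
`m` commutes with coproducts on these legs. -/
theorem twist_doubleBraiding_word {G : Type*} [Group G] {im ml il mi li : G}
    (ybe₁ : ml * mi * li = li * mi * ml) (ybe₂ : im * il * ml = ml * il * im)
    (h : mi * im * (il * ml) = il * ml * (mi * im)) :
    ml * (mi * li * (il * im)) = li * il * ml * (mi * im) := by
  calc ml * (mi * li * (il * im)) = ml * mi * li * (il * im) := by group
    _ = li * mi * (ml * il * im) := by rw [ybe₁]; group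
    _ = li * (mi * im * (il * ml)) := by rw [← ybe₂]; group
    _ = li * il * ml * (mi * im) := by rw [h]; group

/-- The identity of words behind `UniversalRMatrix.unop_mixedSandwich_crossing`. The letters are the
values of the R-matrix on pairs of the legs `a`, `b`, `c`, `d`, and `q` is the double braiding of
`c` and `d`; `hq` holds because `q` commutes with coproducts on these legs. -/
theorem crossing_doubleBraiding_word {G : Type*} [Group G] {da ad db cb q : G} (hda : Commute cb da)
    (had : Commute cb ad) (hq : Commute q (cb * db)) :
    da * (db * q) * db⁻¹ * ad = cb⁻¹ * (da * q * ad) * cb := by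
  have h : db * q * db⁻¹ = cb⁻¹ * q * cb := by
    rw [mul_inv_eq_iff_eq_mul, mul_assoc, mul_assoc, eq_inv_mul_iff_mul_eq, ← mul_assoc, ← hq.eq]
  calc da * (db * q) * db⁻¹ * ad = da * (db * q * db⁻¹) * ad := by group
    _ = da * cb⁻¹ * q * (cb * ad) := by rw [h]; group
    _ = cb⁻¹ * (da * q * ad) * cb := by rw [had.eq, ← hda.inv_left.eq]; group

namespace UniversalRMatrix

variable (𝓡 : UniversalRMatrix k H)

theorem commute_doubleBraiding_legUnit {i j l : H →ₐ[k] A} (hij : LegsCommute i j)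
    (hil : LegsCommute i l) (hjl : LegsCommute j l) :
    Commute (𝓡.legUnit j i * 𝓡.legUnit i j) (𝓡.legUnit i l * 𝓡.legUnit j l) := by
  rw [← legUnit_comulLegs_left hij hil hjl]
  refine Units.ext ?_
  rw [Units.val_mul _ (𝓡.legUnit (comulLegs i j) l), Units.val_mul (𝓡.legUnit (comulLegs i j) l),
    coe_legUnit (hij.comulLegs_left hil hjl)]
  refine commute_onLegs (fun x => commute_doubleBraiding_comulLegs hij x) (fun x => ?_) _
  rw [Units.val_mul]
  exact (commute_legUnit_apply hij.symm hjl hil x).mul_left (commute_legUnit_apply hij hil hjl x)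

/-- The twist turns the double braiding of a leg with a coproduct into a product of two double
braidings; this is the multiplicativity of the factorization map. -/
theorem unop_sandwich_twist {i m l : H →ₐ[k] A} (him : LegsCommute i m) (hil : LegsCommute i l)
    (hml : LegsCommute m l) :
    unop (𝓡.sandwich hml 𝓡.twist) (onLegs i (comulLegs m l) 𝓡.doubleBraiding) =
      onLegs i l 𝓡.doubleBraiding * onLegs i m 𝓡.doubleBraiding := by
  have hS := 𝓡.commute_mulLeftLeg_mulRightLeg m l
  have hW := 𝓡.unop_onLegs_left_right (e := m) (e' := l)
    (a := onLegs i l 𝓡.doubleBraiding) (b := onLegs i m 𝓡.doubleBraiding)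
    (fun x => (commute_onLegs (fun y => (him y x).symm) (fun y => hml x y) _).symm)
    (fun x => (commute_onLegs (fun y => (hil y x).symm) (fun y => (hml y x).symm) _).symm)
    𝓡.R.inv
  rw [𝓡.rTensor_antipodeInv_R_inv] at hW
  -- so it suffices to multiply by `R^{m,l}` and cancel `R` against `R⁻¹`
  have hword : onLegs m l 𝓡.R.val * onLegs i (comulLegs m l) 𝓡.doubleBraiding =
      onLegs i l 𝓡.doubleBraiding * onLegs m l 𝓡.R.val * onLegs i m 𝓡.doubleBraiding := by
    rw [onLegs_doubleBraiding _ (hml.comulLegs_right him hil), onLegs_doubleBraiding _ hil,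
      onLegs_doubleBraiding _ him, ← coe_legUnit hml, ← Units.val_mul, ← Units.val_mul,
      ← Units.val_mul, legUnit_comulLegs_left hml him.symm hil.symm,
      legUnit_comulLegs_right hml him hil]
    refine congrArg _ (twist_doubleBraiding_word (yangBaxter hml him.symm hil.symm)
      (yangBaxter him hil hml) ?_)
    exact 𝓡.commute_doubleBraiding_legUnit him hil hml
  have hF : 𝓡.sandwich hml 𝓡.twist =
      onLegs (𝓡.mulLeftLeg m) (𝓡.mulLeftLeg l) 𝓡.R.val *
        onLegs (𝓡.mulLeftLeg m) (mulRightLeg l) 𝓡.R.val := by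
    rw [twist, map_mul, map_onLegs, map_onLegs, sandwich, lift_comp_leg₁, lift_comp_leg₃,
      lift_comp_leg₄, lift_comp_includeLeft, lift_comp_includeLeft, lift_comp_includeRight']
  rw [hF, unop_mul, Module.End.mul_apply, 𝓡.unop_onLegs_left_left hml, 𝓡.map_antipodeInv_R,
    hword, ← hW, ← Module.End.mul_apply, ← unop_mul, ← onLegs_mul hS, Units.inv_eq_val_inv,
    Units.inv_mul, onLegs_one hS, unop_one, Module.End.one_apply]

/-- The crossing turns the double braiding of two legs into a conjugate of its double braiding with
a coproduct; this is the exchange relation of the Heisenberg double. -/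
theorem unop_mixedSandwich_crossing {a b c d : H →ₐ[k] A} (hab : LegsCommute a b)
    (hac : LegsCommute a c) (had : LegsCommute a d) (hbc : LegsCommute b c)
    (hbd : LegsCommute b d) (hcd : LegsCommute c d) :
    unop (𝓡.mixedSandwich hab had hbd 𝓡.crossing) (onLegs c d 𝓡.doubleBraiding) =
      onLegs ((conjBy k (𝓡.legUnit c b)).comp (comulLegs c a)) d 𝓡.doubleBraiding := by
  have hq : ∀ {l : H →ₐ[k] A}, LegsCommute c l → LegsCommute d l → ∀ x,
      Commute (onLegs c d 𝓡.doubleBraiding) (l x) := fun hc hd x =>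
    (commute_onLegs (fun y => (hc y x).symm) (fun y => (hd y x).symm) _).symm
  have hT : 𝓡.mixedSandwich hab had hbd 𝓡.crossing =
      onLegs (𝓡.mulLeftLeg d) (mulRightLeg b) 𝓡.R.inv *
        onLegs (𝓡.mulLeftLeg d) (mulRightLeg a) 𝓡.R.inv *
        onLegs (mulRightLeg d) (mulRightLeg b) 𝓡.R.inv *
        onLegs (mulRightLeg a) (mulRightLeg d) 𝓡.R.val := by
    rw [crossing, map_mul, map_mul, map_mul, map_onLegs, map_onLegs, map_onLegs, map_onLegs,
      mixedSandwich, lift_comp_leg₁, lift_comp_leg₂, lift_comp_leg₃, lift_comp_leg₄,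
      lift_comp_includeLeft, lift_comp_includeLeft, lift_comp_includeRight',
      lift_comp_includeRight']
  have h₁ := 𝓡.unop_onLegs_left_right (e := d) (e' := b) (a := 1)
    (b := onLegs c d 𝓡.doubleBraiding) (fun x => Commute.one_left _) (hq hbc.symm hbd.symm) 𝓡.R.inv
  have h₂ := 𝓡.unop_onLegs_left_right (e := d) (e' := a) (a := 1)
    (b := onLegs d b 𝓡.R.val * onLegs c d 𝓡.doubleBraiding) (fun x => Commute.one_left _)
    (fun x => (commute_onLegs (fun y => had x y) (fun y => hab x y) _).symm.mul_left
      (hq hac.symm had.symm x)) 𝓡.R.inv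
  rw [𝓡.rTensor_antipodeInv_R_inv, one_mul, one_mul] at h₁ h₂
  rw [hT, unop_mul, unop_mul, unop_mul, Module.End.mul_apply, Module.End.mul_apply,
    Module.End.mul_apply, h₁, h₂, unop_onLegs_right_right, unop_onLegs_right_right]
  have hconj : (conjBy k (𝓡.legUnit c b)).comp d = d :=
    conjBy_comp_of_commute (commute_legUnit_apply hbc.symm hcd hbd)
  have hca := hac.symm.comulLegs_left hcd had
  rw [onLegs_doubleBraiding _ hcd]
  conv_rhs => rw [← hconj]
  rw [← map_onLegs, onLegs_doubleBraiding _ hca, conjBy_apply,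
    ← coe_legUnit hbd.symm, ← coe_legUnit had.symm, ← coe_inv_legUnit hbd.symm,
    ← coe_legUnit had, legUnit_comulLegs_left hac.symm hcd had,
    legUnit_comulLegs_right hac.symm hcd.symm had.symm]
  simp only [← Units.val_mul]
  refine congrArg _ ((crossing_doubleBraiding_word (cb := 𝓡.legUnit c b)
    (commute_legUnit hbc.symm had.symm hcd hac.symm hbd hab.symm)
    (commute_legUnit hbc.symm had hac.symm hcd hab.symm hbd) ?_).trans (by group))
  exact 𝓡.commute_doubleBraiding_legUnit hcd hbc.symm hbd.symm

end UniversalRMatrix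

end SandwichedDoubleBraiding

/-! ### The canonical homomorphism -/

section CanonicalHom

variable {k H : Type*} [Field k] [Ring H] [HopfAlgebra k H]

open Algebra.TensorProduct MulOpposite

namespace UniversalRMatrix

variable (𝓡 : UniversalRMatrix k H)

/-- `sandwich` is the transpose of the action of `(H ⊗ H) ⊗ (H ⊗ H)` on pairs of functionals. -/
theorem pairTwo_actTwo (X : (H ⊗[k] H) ⊗[k] (H ⊗[k] H)) (t : 𝓡.BraidedDual ⊗[k] 𝓡.BraidedDual)
    (Y : H ⊗[k] (H ⊗[k] H)) : 𝓡.pairTwo (actTwo 𝓡.actHom X t) Y =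
      𝓡.pairTwo t (unop (𝓡.sandwich (legsCommute_midLeg_lastLeg (k := k) (H := H)) X) Y) := by
  induction X using TensorProduct.induction_on with
  | zero => simp
  | add X X' h h' => simp only [map_add, unop_add, LinearMap.add_apply, h, h']
  | tmul x y =>
    induction x using TensorProduct.induction_on with
    | zero => simp
    | add X X' h h' =>
      simp only [TensorProduct.add_tmul, map_add, unop_add, LinearMap.add_apply, h, h']
    | tmul a b =>
    induction y using TensorProduct.induction_on with
    | zero => simp
    | add X X' h h' =>
      simp only [TensorProduct.tmul_add, map_add, unop_add, LinearMap.add_apply, h, h']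
    | tmul c d =>
    induction t using TensorProduct.induction_on with
    | zero => simp
    | add t t' h h' => simp only [map_add, LinearMap.add_apply, h, h']
    | tmul f g =>
    induction Y using TensorProduct.induction_on with
    | zero => simp
    | add t t' h h' => simp only [map_add, h, h']
    | tmul u Z =>
    induction Z using TensorProduct.induction_on with
    | zero => simp
    | add t t' h h' => simp only [map_add, TensorProduct.tmul_add, h, h']
    | tmul v w =>
      rw [actTwo_tmul, pairTwo_tmul, toDual_actHom, toDual_actHom]
      have : unop (𝓡.sandwich (legsCommute_midLeg_lastLeg (k := k) (H := H))
          ((a ⊗ₜ b) ⊗ₜ (c ⊗ₜ d))) (u ⊗ₜ (v ⊗ₜ w)) =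
          u ⊗ₜ ((antipodeInv k H a * v * b) ⊗ₜ (antipodeInv k H c * w * d)) := by
        simp [sandwich, midLeg, lastLeg, mul_assoc]
      rw [this, pairTwo_tmul, mul_assoc, mul_assoc]

theorem factorizationMap_convMulB (t : 𝓡.BraidedDual ⊗[k] 𝓡.BraidedDual) :
    𝓡.factorizationMap (TensorProduct.lift 𝓡.convMulB t) = 𝓡.pairTwo t
      (onLegs includeLeft (comulLegs (midLeg k H) (lastLeg k H)) 𝓡.doubleBraiding) := by
  have h : ∀ (f g : 𝓡.BraidedDual) (X : H ⊗[k] H),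
      TensorProduct.rid k H (LinearMap.lTensor H (𝓡.toDual (𝓡.convMulB f g)) X) =
        𝓡.pairTwo (f ⊗ₜ g) (onLegs includeLeft (comulLegs (midLeg k H) (lastLeg k H)) X) := by
    intro f g X
    induction X using TensorProduct.induction_on with
    | zero => simp
    | add X X' h h' => simp only [map_add, h, h']
    | tmul x y =>
      rw [LinearMap.lTensor_tmul, TensorProduct.rid_tmul, toDual_convMulB, onLegs_tmul,
        comulLegs_apply legsCommute_midLeg_lastLeg]
      induction Coalgebra.comul (R := k) y using TensorProduct.induction_on with
      | zero => simp
      | add X X' h h' => simp only [map_add, mul_add, add_smul, h, h']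
      | tmul v w => simp [midLeg, lastLeg, pairTwo_tmul]
  induction t using TensorProduct.induction_on with
  | zero => simp
  | add t t' h h' => simp only [map_add, LinearMap.add_apply, h, h']
  | tmul f g => rw [TensorProduct.lift.tmul, factorizationMap_eq, h]

theorem factorizationMap_mul_factorizationMap (f g : 𝓡.BraidedDual) :
    𝓡.factorizationMap f * 𝓡.factorizationMap g = 𝓡.pairTwo (g ⊗ₜ f)
      (onLegs includeLeft (lastLeg k H) 𝓡.doubleBraiding *
        onLegs includeLeft (midLeg k H) 𝓡.doubleBraiding) := by
  rw [factorizationMap_eq, factorizationMap_eq]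
  generalize 𝓡.doubleBraiding = X
  suffices h : ∀ Y : H ⊗[k] H, TensorProduct.rid k H (LinearMap.lTensor H (𝓡.toDual f) X) *
      TensorProduct.rid k H (LinearMap.lTensor H (𝓡.toDual g) Y) = 𝓡.pairTwo (g ⊗ₜ f)
        (onLegs includeLeft (lastLeg k H) X * onLegs includeLeft (midLeg k H) Y) from h X
  intro Y
  induction X using TensorProduct.induction_on with
  | zero => simp
  | add X X' h h' => simp only [map_add, add_mul, h, h']
  | tmul x y =>
  induction Y using TensorProduct.induction_on with
  | zero => simp
  | add X X' h h' => simp only [map_add, mul_add, h, h']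
  | tmul z w =>
    simp [midLeg, lastLeg, pairTwo_tmul, mul_smul]

/-- The factorization map is multiplicative. -/
theorem factorizationMap_mulB (f g : 𝓡.BraidedDual) :
    𝓡.factorizationMap (𝓡.mulB f g) = 𝓡.factorizationMap f * 𝓡.factorizationMap g := by
  rw [mulB_eq, factorizationMap_convMulB, pairTwo_actTwo, unop_sandwich_twist _
    legsCommute_includeLeft_midLeg legsCommute_includeLeft_lastLeg,
    factorizationMap_mul_factorizationMap]

/-- The map `f ↦ φ(f) ⊗ 1` from the braided dual to `H ⊗ H`. -/
noncomputable def factorizationLeft : 𝓡.BraidedDual →ₗ[k] H ⊗[k] H :=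
  (includeLeft : H →ₐ[k] H ⊗[k] H).toLinearMap ∘ₗ 𝓡.factorizationMap

theorem factorizationLeft_apply (f : 𝓡.BraidedDual) :
    𝓡.factorizationLeft f = 𝓡.factorizationMap f ⊗ₜ 1 := rfl

/-- The pairing `x ⊗ (c ⊗ d) ↦ (x ▷ f) ⊗ (g(d) c ⊗ 1)`, as a function of `f ⊗ g`. -/
noncomputable def actPair : 𝓡.BraidedDual ⊗[k] 𝓡.BraidedDual →ₗ[k]
    (H ⊗[k] H) ⊗[k] (H ⊗[k] H) →ₗ[k] 𝓡.BraidedDual ⊗[k] (H ⊗[k] H) :=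
  TensorProduct.homTensorHomMap (RingHom.id k) (H ⊗[k] H) (H ⊗[k] H) 𝓡.BraidedDual (H ⊗[k] H) ∘ₗ
    TensorProduct.map 𝓡.actHom.toLinearMap.flip
      (LinearMap.llcomp k (H ⊗[k] H) (H ⊗[k] k) (H ⊗[k] H)
        ((includeLeft : H →ₐ[k] H ⊗[k] H).toLinearMap ∘ₗ (TensorProduct.rid k H).toLinearMap) ∘ₗ
          LinearMap.lTensorHom H ∘ₗ 𝓡.toDual)

theorem actPair_tmul (f g : 𝓡.BraidedDual) (x : H ⊗[k] H) (c d : H) :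
    𝓡.actPair (f ⊗ₜ g) (x ⊗ₜ (c ⊗ₜ d)) = 𝓡.actHom x f ⊗ₜ ((𝓡.toDual g d • c) ⊗ₜ 1) := rfl

/-- `mixedSandwich` is the transpose of the action of `(H ⊗ H) ⊗ (H ⊗ H)` for `actPair`. -/
theorem actPair_actTwo (X : (H ⊗[k] H) ⊗[k] (H ⊗[k] H)) (t : 𝓡.BraidedDual ⊗[k] 𝓡.BraidedDual)
    (Y : (H ⊗[k] H) ⊗[k] (H ⊗[k] H)) : 𝓡.actPair (actTwo 𝓡.actHom X t) Y =
      𝓡.actPair t (unop (𝓡.mixedSandwich (legsCommute_leg₁₂ k H) (legsCommute_leg₁₄ k H)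
        (legsCommute_leg₂₄ k H) X) Y) := by
  induction X using TensorProduct.induction_on with
  | zero => simp
  | add X X' h h' => simp only [map_add, unop_add, LinearMap.add_apply, h, h']
  | tmul x y =>
    induction x using TensorProduct.induction_on with
    | zero => simp
    | add X X' h h' =>
      simp only [TensorProduct.add_tmul, map_add, unop_add, LinearMap.add_apply, h, h']
    | tmul a b =>
    induction y using TensorProduct.induction_on with
    | zero => simp
    | add X X' h h' =>
      simp only [TensorProduct.tmul_add, map_add, unop_add, LinearMap.add_apply, h, h']
    | tmul c d =>
    induction t using TensorProduct.induction_on with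
    | zero => simp
    | add t t' h h' => simp only [map_add, LinearMap.add_apply, h, h']
    | tmul f g =>
    induction Y using TensorProduct.induction_on with
    | zero => simp
    | add t t' h h' => simp only [map_add, h, h']
    | tmul u Z =>
    induction Z using TensorProduct.induction_on with
    | zero => simp
    | add t t' h h' => simp only [map_add, TensorProduct.tmul_add, h, h']
    | tmul v w =>
      rw [actTwo_tmul, actPair_tmul, toDual_actHom, ← Module.End.mul_apply, ← map_mul]
      have : unop (𝓡.mixedSandwich (legsCommute_leg₁₂ k H) (legsCommute_leg₁₄ k H)
          (legsCommute_leg₂₄ k H) ((a ⊗ₜ b) ⊗ₜ (c ⊗ₜ d))) (u ⊗ₜ (v ⊗ₜ w)) =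
          (u * (a ⊗ₜ b)) ⊗ₜ (v ⊗ₜ (antipodeInv k H c * w * d)) := by
        simp [mixedSandwich, leg₁, leg₂, leg₄, mul_assoc]
      rw [this, actPair_tmul, mul_assoc]

theorem tmul_factorizationLeft (t : 𝓡.BraidedDual ⊗[k] 𝓡.BraidedDual) :
    TensorProduct.map LinearMap.id 𝓡.factorizationLeft t =
      𝓡.actPair t (onLegs (leg₃ k H) (leg₄ k H) 𝓡.doubleBraiding) := by
  induction t using TensorProduct.induction_on with
  | zero => simp
  | add t t' h h' => simp only [map_add, LinearMap.add_apply, h, h']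
  | tmul f g =>
    rw [TensorProduct.map_tmul, factorizationLeft_apply, factorizationMap_eq, LinearMap.id_apply]
    induction 𝓡.doubleBraiding using TensorProduct.induction_on with
    | zero => simp
    | add X X' h h' => simp only [map_add, TensorProduct.add_tmul, TensorProduct.tmul_add, h, h']
    | tmul x y =>
      simp [leg₃, leg₄, actPair_tmul]

variable (k H) in
/-- The inclusion of the first three legs. -/
noncomputable def firstThreeLegs : (H ⊗[k] H) ⊗[k] H →ₐ[k] (H ⊗[k] H) ⊗[k] (H ⊗[k] H) :=
  Algebra.TensorProduct.map (AlgHom.id k (H ⊗[k] H)) includeLeft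

/-- The coproduct of `x ⊗ 1` in `H^[2]` lies in `(H ⊗ H) ⊗ (H ⊗ 1)`. -/
theorem exists_firstThreeLegs_eq (x : H) :
    ∃ z, firstThreeLegs k H z = 𝓡.comulBraidedHom (x ⊗ₜ 1) := by
  have h := 𝓡.comp_comulBraidedHom_comp_includeLeft (AlgHom.id k ((H ⊗[k] H) ⊗[k] (H ⊗[k] H)))
  -- the formula for the coproduct only involves legs in the image of `firstThreeLegs`
  have h₁ : (firstThreeLegs k H).comp (includeLeft.comp includeLeft) = leg₁ k H := by
    ext x; simp [firstThreeLegs, leg₁, one_def]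
  have h₂ : (firstThreeLegs k H).comp (includeLeft.comp includeRight) = leg₂ k H := by
    ext x; simp [firstThreeLegs, leg₂, one_def]
  have h₃ : (firstThreeLegs k H).comp includeRight = leg₃ k H := by
    ext x; simp [firstThreeLegs, leg₃, one_def]
  have c₁ : LegsCommute (includeRight : H →ₐ[k] (H ⊗[k] H) ⊗[k] H)
      (includeLeft.comp includeLeft) := legsCommute_includeLeft_includeRight.symm.comp_right _
  have c₂ : LegsCommute (includeRight : H →ₐ[k] (H ⊗[k] H) ⊗[k] H)
      (includeLeft.comp includeRight) := legsCommute_includeLeft_includeRight.symm.comp_right _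
  simp only [AlgHom.id_comp] at h
  rw [← h₁, ← h₂, ← h₃, map_legUnit _ c₂, ← map_comulLegs _ c₁, ← AlgHom.comp_assoc,
    ← comp_conjBy, AlgHom.comp_assoc] at h
  exact ⟨_, (DFunLike.congr_fun h x).symm⟩

/-- The exchange relation of the Heisenberg double agrees with that of the elliptic double. -/
theorem semidirectExchange_factorizationLeft (f g : 𝓡.BraidedDual) :
    𝓡.semidirectExchange (𝓡.factorizationLeft g) f =
      TensorProduct.map LinearMap.id 𝓡.factorizationLeft (𝓡.ellipticExchange g f) := by
  rw [ellipticExchange_apply, tmul_factorizationLeft, actPair_actTwo,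
    unop_mixedSandwich_crossing _ _ (legsCommute_leg₁₃ k H) _ (legsCommute_leg₂₃ k H) _
      (legsCommute_leg₃₄ k H), semidirectExchange_apply, factorizationLeft_apply,
    factorizationMap_eq]
  have h := 𝓡.comp_comulBraidedHom_comp_includeLeft (AlgHom.id k ((H ⊗[k] H) ⊗[k] (H ⊗[k] H)))
  simp only [AlgHom.id_comp] at h
  rw [← h]
  induction 𝓡.doubleBraiding using TensorProduct.induction_on with
  | zero => simp
  | add X X' h h' => simp only [map_add, TensorProduct.add_tmul, h, h']
  | tmul x y =>
    obtain ⟨z, hz⟩ := 𝓡.exists_firstThreeLegs_eq x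
    rw [onLegs_tmul, AlgHom.comp_apply, includeLeft_apply, ← hz, LinearMap.lTensor_tmul,
      TensorProduct.rid_tmul, ← TensorProduct.smul_tmul', map_smul, map_smul, ← hz]
    clear hz
    induction z using TensorProduct.induction_on with
    | zero => simp
    | add X X' h h' => simp only [map_add, smul_add, add_mul, h, h']
    | tmul u v => simp [firstThreeLegs, leg₄, actPair_tmul, ← TensorProduct.smul_tmul']

variable {𝓡} in
theorem mul_mem_heisenbergDouble {a b : 𝓡.SemidirectProduct} (ha : a ∈ 𝓡.heisenbergDouble)
    (hb : b ∈ 𝓡.heisenbergDouble) : a * b ∈ 𝓡.heisenbergDouble := by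
  let μ : 𝓡.SemidirectProduct →ₗ[k] 𝓡.SemidirectProduct →ₗ[k] 𝓡.SemidirectProduct :=
    𝓡.semidirectMul
  have h : μ a b ∈ _ := Submodule.apply_mem_map₂ μ ha hb
  rw [heisenbergDouble, semidirectWith, Submodule.map₂_span_span] at h
  refine Submodule.span_le.2 ?_ h
  rintro _ ⟨_, ⟨f, v, -, rfl⟩, _, ⟨f', v', -, rfl⟩, rfl⟩
  obtain ⟨z, hz⟩ := 𝓡.exists_firstThreeLegs_eq v
  let L : (H ⊗[k] H) ⊗[k] H →ₗ[k] 𝓡.SemidirectProduct :=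
    TensorProduct.map (𝓡.mulB f) ((LinearMap.mul k (H ⊗[k] H)).flip (v' ⊗ₜ 1)) ∘ₗ
      𝓡.actOn f' ∘ₗ (firstThreeLegs k H).toLinearMap
  have hL : μ (𝓡.semidirectMk f (v ⊗ₜ 1)) (𝓡.semidirectMk f' (v' ⊗ₜ 1)) = L z := by
    refine (𝓡.semidirectMul_tmul _ _ _ _).trans ?_
    rw [semidirectExchange_apply, ← hz]
    rfl
  change μ _ _ ∈ 𝓡.heisenbergDouble
  rw [hL]
  clear hz hL
  induction z using TensorProduct.induction_on with
  | zero => rw [map_zero]; exact zero_mem _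
  | add X X' h h' => rw [map_add]; exact add_mem h h'
  | tmul u w =>
    refine Submodule.subset_span ⟨𝓡.mulB f (𝓡.actHom u f'), w * v', trivial, ?_⟩
    change 𝓡.mulB f (𝓡.actHom u f') ⊗ₜ ((w ⊗ₜ[k] (1 : H)) * (v' ⊗ₜ[k] (1 : H))) = _
    rw [tmul_mul_tmul, one_mul]
    rfl

/-- The canonical map from the elliptic double to the semi-direct product,
`f ⊗ g ↦ f ⊗ (φ(g) ⊗ 1)`. -/
noncomputable def canonicalMap : 𝓡.EllipticDouble →ₗ[k] 𝓡.SemidirectProduct :=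
  TensorProduct.map LinearMap.id 𝓡.factorizationLeft

theorem canonicalMap_ellipticMk (f g : 𝓡.BraidedDual) :
    𝓡.canonicalMap (𝓡.ellipticMk f g) = 𝓡.semidirectMk f (𝓡.factorizationMap g ⊗ₜ 1) := rfl

/-- In the product of `f ⊗ g` and `f' ⊗ g'`, the factors `f` and `g'` are outermost on both sides,
and the inner factors `g`, `f'` are exchanged in the same way. -/
theorem canonicalMap_mul (x y : 𝓡.EllipticDouble) :
    𝓡.canonicalMap (x * y) = 𝓡.canonicalMap x * 𝓡.canonicalMap y := by
  change TensorProduct.map LinearMap.id 𝓡.factorizationLeft (𝓡.ellipticMul x y) =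
    𝓡.semidirectMul (TensorProduct.map LinearMap.id 𝓡.factorizationLeft x)
      (TensorProduct.map LinearMap.id 𝓡.factorizationLeft y)
  change 𝓡.BraidedDual ⊗[k] 𝓡.BraidedDual at x y
  induction x using TensorProduct.induction_on with
  | zero => simp
  | add x x' h h' => simp only [map_add, LinearMap.add_apply, h, h']
  | tmul f g =>
  induction y using TensorProduct.induction_on with
  | zero => simp
  | add x x' h h' => simp only [map_add, h, h']
  | tmul f' g' =>
  rw [TensorProduct.map_tmul, TensorProduct.map_tmul, LinearMap.id_apply, LinearMap.id_apply,
    semidirectMul_tmul, semidirectExchange_factorizationLeft, ellipticMul_tmul,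
    ← LinearMap.comp_apply (TensorProduct.map _ _), ← LinearMap.comp_apply (TensorProduct.map _ _),
    ← TensorProduct.map_comp, ← TensorProduct.map_comp]
  congr 2
  refine LinearMap.ext fun h => ?_
  simp [factorizationLeft_apply, factorizationMap_mulB]

theorem range_canonicalMap : LinearMap.range 𝓡.canonicalMap = 𝓡.heisenbergDouble' := by
  refine le_antisymm ?_ (Submodule.span_le.2 ?_)
  · rintro _ ⟨x, rfl⟩
    let Φ : 𝓡.BraidedDual ⊗[k] 𝓡.BraidedDual →ₗ[k] 𝓡.SemidirectProduct := 𝓡.canonicalMap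
    change Φ x ∈ _
    induction x using TensorProduct.induction_on with
    | zero => rw [map_zero]; exact zero_mem _
    | add x x' h h' => rw [map_add]; exact add_mem h h'
    | tmul f g => exact Submodule.subset_span ⟨f, _, ⟨g, rfl⟩, rfl⟩
  · rintro _ ⟨f, _, ⟨g, rfl⟩, rfl⟩
    exact ⟨𝓡.ellipticMk f g, rfl⟩

theorem heisenbergDouble'_le : 𝓡.heisenbergDouble' ≤ 𝓡.heisenbergDouble :=
  Submodule.span_mono fun _ ⟨f, v, _, h⟩ => ⟨f, v, trivial, h⟩

theorem injective_canonicalMap (h : 𝓡.IsFactorizable) : Function.Injective 𝓡.canonicalMap := by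
  -- the counit shows that `H` is not the zero ring
  have : Nontrivial H := (Bialgebra.counitAlgHom k H).toRingHom.domain_nontrivial
  have hl : Function.Injective 𝓡.factorizationLeft :=
    (Algebra.TensorProduct.includeLeft_injective (S := k)
      (FaithfulSMul.algebraMap_injective k H)).comp h
  exact Module.Flat.lTensor_preserves_injective_linearMap (M := 𝓡.BraidedDual) _ hl

theorem canonicalMap_one : 𝓡.canonicalMap 1 = 1 := by
  change 𝓡.canonicalMap (𝓡.ellipticMk 1 1) = 𝓡.semidirectMk 1 1
  rw [canonicalMap_ellipticMk, factorizationMap_one]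
  rfl

theorem ellipticMk_eq_mul (f g : 𝓡.BraidedDual) :
    𝓡.ellipticMk f g = 𝓡.ellipticMk f 1 * 𝓡.ellipticMk 1 g := by
  change f ⊗ₜ g = 𝓡.ellipticMul (f ⊗ₜ 1) (1 ⊗ₜ g)
  rw [ellipticMul_tmul, one_ellipticExchange, TensorProduct.map_tmul, mulB_one,
    LinearMap.flip_apply, one_mulB]

theorem linearMap_ext_ellipticDouble {M : Type*} [AddCommGroup M] [Module k M]
    {Φ Ψ : 𝓡.EllipticDouble →ₗ[k] M}
    (h : ∀ f g, Φ (𝓡.ellipticMk f g) = Ψ (𝓡.ellipticMk f g)) : Φ = Ψ :=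
  TensorProduct.ext' h

end UniversalRMatrix

end CanonicalHom

theorem mainTheorem5 {k H : Type*} [Field k] [Ring H] [HopfAlgebra k H]
    (𝓡 : UniversalRMatrix k H) :
    -- the objects are well defined
    Function.Bijective (HopfAlgebra.antipode k : H →ₗ[k] H) ∧
    IsAssociativeUnital 𝓡.BraidedDual ∧
    IsAssociativeUnital 𝓡.EllipticDouble ∧
    IsAssociativeUnital 𝓡.SemidirectProduct ∧
    IsUnitalSubalgebra 𝓡.heisenbergDouble ∧
    IsUnitalSubalgebra 𝓡.heisenbergDouble' ∧
    𝓡.heisenbergDouble' ≤ 𝓡.heisenbergDouble ∧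
    -- the canonical homomorphism to the Heisenberg double
    ∃ Φ : 𝓡.EllipticDouble →ₗ[k] 𝓡.SemidirectProduct,
      (Φ 1 = 1 ∧ ∀ x y, Φ (x * y) = Φ x * Φ y) ∧
      (∀ x, Φ x ∈ 𝓡.heisenbergDouble) ∧
      (∀ f, Φ (𝓡.ellipticMk f 1) = 𝓡.semidirectMk f 1) ∧
      (∀ f, Φ (𝓡.ellipticMk 1 f) = 𝓡.semidirectMk 1 (𝓡.factorizationMap f ⊗ₜ[k] 1)) ∧
      -- it is the only homomorphism with these values
      (∀ Ψ : 𝓡.EllipticDouble →ₗ[k] 𝓡.SemidirectProduct,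
        (∀ x y, Ψ (x * y) = Ψ x * Ψ y) →
        (∀ f, Ψ (𝓡.ellipticMk f 1) = 𝓡.semidirectMk f 1) →
        (∀ f, Ψ (𝓡.ellipticMk 1 f) = 𝓡.semidirectMk 1 (𝓡.factorizationMap f ⊗ₜ[k] 1)) →
        Ψ = Φ) ∧
      -- if `H` is factorizable, it is an isomorphism onto the subalgebra `D_H'`
      (𝓡.IsFactorizable →
        Function.Injective Φ ∧ LinearMap.range Φ = 𝓡.heisenbergDouble') := by
  have hleft : ∀ f, 𝓡.canonicalMap (𝓡.ellipticMk f 1) = 𝓡.semidirectMk f 1 := fun f => by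
    rw [UniversalRMatrix.canonicalMap_ellipticMk, UniversalRMatrix.factorizationMap_one,
      Algebra.TensorProduct.one_def]
  have hmem : ∀ x, 𝓡.canonicalMap x ∈ 𝓡.heisenbergDouble' := fun x =>
    𝓡.range_canonicalMap ▸ LinearMap.mem_range_self _ x
  refine ⟨𝓡.bijective_antipode, 𝓡.isAssociativeUnital_braidedDual,
    𝓡.isAssociativeUnital_ellipticDouble, 𝓡.isAssociativeUnital_semidirectProduct,
    ⟨𝓡.canonicalMap_one ▸ 𝓡.heisenbergDouble'_le (hmem 1),
      fun _ ha _ hb => UniversalRMatrix.mul_mem_heisenbergDouble ha hb⟩,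
    ⟨𝓡.canonicalMap_one ▸ hmem 1, ?_⟩, 𝓡.heisenbergDouble'_le, 𝓡.canonicalMap,
    ⟨𝓡.canonicalMap_one, 𝓡.canonicalMap_mul⟩, fun x => 𝓡.heisenbergDouble'_le (hmem x), hleft,
    fun f => 𝓡.canonicalMap_ellipticMk 1 f, fun Ψ hmul h₁ h₂ => ?_,
    fun h => ⟨𝓡.injective_canonicalMap h, 𝓡.range_canonicalMap⟩⟩
  · rw [← 𝓡.range_canonicalMap]
    rintro _ ⟨x, rfl⟩ _ ⟨y, rfl⟩
    exact ⟨x * y, 𝓡.canonicalMap_mul x y⟩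
  · refine 𝓡.linearMap_ext_ellipticDouble fun f g => ?_
    rw [𝓡.ellipticMk_eq_mul, hmul, h₁, h₂, 𝓡.canonicalMap_mul, hleft, 𝓡.canonicalMap_ellipticMk]
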